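/- Let $K$ be an algebraically closed field and let $\Lambda$ be a finite dimensional selfinjective Nakayama $K$-algebra, i.e. the regular module $\Lambda$ is injective and every indecomposable projective left or right $\Lambda$-module is uniserial. ($\Lambda$ is not assumed to be basic or ring-indecomposable.) Let $\mathcal{K}_\Lambda=\mathsf{K}^{\rm b}(\operatorname{proj}\Lambda)$ be the bounded homotopy category of finitely generated projective $\Lambda$-modules. An object $T$ of $\mathcal{K}_\Lambda$ is silting if $\operatorname{Hom}(T,T[i])=0$ for all $i>0$ and the smallest thick subcategory of $\mathcal{K}_\Lambda$ containing $T$ is $\mathcal{K}_\Lambda$. Write $T\geq U$ if $\operatorname{Hom}(T,U[i])=0$ for all $i>0$, and let $\operatorname{2silt}\Lambda$ be the set of isomorphism classes of basic silting objects $T$ with $\Lambda\geq T\geq\Lambda[1]$. Let $P$ be an indecomposable projective $\Lambda$-module. Let $B=P\oplus M$ be the basic module with $\operatorname{add}B=\operatorname{add}\Lambda$. Put $\mu_P^-(\Lambda):=Y\oplus M$, where $Y$ is the mapping cone of a minimal left $\operatorname{add}M$-approximation $P\to M'$. Put $\mu_{P[1]}^+(\Lambda[1]):=Z\oplus M[1]$,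 where $Z$ is the mapping cocone of a minimal right $\operatorname{add}M[1]$-approximation $M''\to P[1]$. Set $$\mathcal{T}_P^-=\{T\in\operatorname{2silt}\Lambda \mid \mu_P^-(\Lambda)\geq T\geq\Lambda[1]\},\qquad \mathcal{T}_P^+=\{T\in\operatorname{2silt}\Lambda\mid \Lambda\geq T\geq\mu_{P[1]}^+(\Lambda[1])\}.$$ Then there is an order-reversing bijection between $\mathcal{T}_P^-$ and $\mathcal{T}_P^+$, that is, a bijection $\varphi:\mathcal{T}_P^-\to\mathcal{T}_P^+$ such that $S\geq T$ if and only if $\varphi(T)\geq\varphi(S)$. In particular, $|\operatorname{2silt}\Lambda|=2\cdot|\mathcal{T}_P^-|$ as cardinal numbers. -/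

import Mathlib

open CategoryTheory Limits Pretriangulated

universe v u w

/-! ### Silting theory in a triangulated category -/

namespace Silting

section Order

variable {𝒯 : Type u} [Category.{v} 𝒯] [Preadditive 𝒯] [HasShift 𝒯 ℤ]

/-- `Geq T U` is the relation `T ≥ U`: `Hom (T, U[i]) = 0` for all `i > 0`. -/
def Geq (T U : 𝒯) : Prop :=
  ∀ i : ℤ, 0 < i → ∀ f : T ⟶ U⟦i⟧, f = 0

lemma Geq.of_iso {T T' U U' : 𝒯} (e : T ≅ T') (e' : U ≅ U') (H : Geq T U) : Geq T' U' := by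
  intro i hi f
  have h0 := H i hi (e.hom ≫ f ≫ e'.inv⟦i⟧')
  have h1 : f = e.inv ≫ (e.hom ≫ f ≫ e'.inv⟦i⟧') ≫ e'.hom⟦i⟧' := by
    simp [← Functor.map_comp]
  rw [h1, h0]
  simp

/-- Isomorphism classes of objects. -/
abbrev IsoClass (𝒯 : Type u) [Category.{v} 𝒯] : Type u :=
  Quotient (isIsomorphicSetoid 𝒯)

/-- The isomorphism class of an object. -/
def IsoClass.mk (T : 𝒯) : IsoClass 𝒯 := Quotient.mk (isIsomorphicSetoid 𝒯) T

/-- The relation `≥` on isomorphism classes of objects. -/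
def IsoClass.Geq : IsoClass 𝒯 → IsoClass 𝒯 → Prop :=
  Quotient.lift₂ (fun T U => Silting.Geq T U) (by
    rintro T U T' U' ⟨e⟩ ⟨e'⟩
    exact propext ⟨fun H => H.of_iso e e', fun H => H.of_iso e.symm e'.symm⟩)

end Order

section General

variable {𝒯 : Type u} [Category.{v} 𝒯] [HasZeroObject 𝒯] [Preadditive 𝒯] [HasShift 𝒯 ℤ]
  [∀ n : ℤ, (shiftFunctor 𝒯 n).Additive] [Pretriangulated 𝒯]

/-- `InAdd M X` says that `X` lies in `add M`: it is a direct summand of a finite direct sum of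
copies of `M` (in a triangulated category every retract is a direct summand). -/
def InAdd (M X : 𝒯) : Prop :=
  ∃ n : ℕ, Nonempty (Retract X (⨁ fun _ : Fin n => M))

/-- `thick T`: the smallest thick subcategory (triangulated subcategory closed under direct
summands) containing `T`. -/
def thick (T : 𝒯) : ObjectProperty 𝒯 := fun X =>
  ∀ P : ObjectProperty 𝒯, P.IsTriangulated → P.IsStableUnderRetracts → P T → P X

/-- `T` is silting: `Hom (T, T[i]) = 0` for all `i > 0`, and `thick T` is everything. -/
def IsSilting (T : 𝒯) : Prop :=
  Geq T T ∧ ∀ X : 𝒯, thick T X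

/-- `T` is basic: no nonzero object occurs twice in a direct sum decomposition of `T`.
In a Krull-Schmidt category, this says that `T` is a direct sum of pairwise non-isomorphic
indecomposable objects. -/
def IsBasic (T : 𝒯) : Prop :=
  ∀ X Z : 𝒯, Nonempty (T ≅ (X ⊞ X) ⊞ Z) → IsZero X

/-- `B` is a basic version of `A`: it is basic and `add B = add A`. -/
def IsBasicVersion (B A : 𝒯) : Prop :=
  IsBasic B ∧ ∀ X : 𝒯, InAdd B X ↔ InAdd A X

/-- `f : X ⟶ M'` is a minimal left `add M`-approximation of `X`. -/
def IsMinLeftApprox (M : 𝒯) {X M' : 𝒯} (f : X ⟶ M') : Prop :=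
  InAdd M M' ∧
  (∀ (M'' : 𝒯), InAdd M M'' → ∀ g : X ⟶ M'', ∃ h : M' ⟶ M'', f ≫ h = g) ∧
  ∀ h : M' ⟶ M', f ≫ h = f → IsIso h

/-- `f : M' ⟶ X` is a minimal right `add M`-approximation of `X`. -/
def IsMinRightApprox (M : 𝒯) {M' X : 𝒯} (f : M' ⟶ X) : Prop :=
  InAdd M M' ∧
  (∀ (M'' : 𝒯), InAdd M M'' → ∀ g : M'' ⟶ X, ∃ h : M'' ⟶ M', h ≫ f = g) ∧
  ∀ h : M' ⟶ M', h ≫ f = f → IsIso h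

/-- `U` is a left mutation `μ_X^-(T)`: `T = X ⊕ M`, there is a minimal left `add M`-approximation
`f : X ⟶ M'` with mapping cone `Y`, and `U = Y ⊕ M`. -/
def IsLeftMutation (X T U : 𝒯) : Prop :=
  ∃ (M M' Y : 𝒯) (f : X ⟶ M') (g : M' ⟶ Y) (h : Y ⟶ X⟦(1 : ℤ)⟧),
    Nonempty (T ≅ X ⊞ M) ∧ IsMinLeftApprox M f ∧ Triangle.mk f g h ∈ distTriang 𝒯 ∧
      Nonempty (U ≅ Y ⊞ M)

/-- `U` is a right mutation `μ_X^+(T)`: `T = X ⊕ M`, there is a minimal right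
`add M`-approximation `f : M' ⟶ X` with mapping cocone `Y`, and `U = Y ⊕ M`. -/
def IsRightMutation (X T U : 𝒯) : Prop :=
  ∃ (M M' Y : 𝒯) (g : Y ⟶ M') (f : M' ⟶ X) (h : X ⟶ Y⟦(1 : ℤ)⟧),
    Nonempty (T ≅ X ⊞ M) ∧ IsMinRightApprox M f ∧ Triangle.mk g f h ∈ distTriang 𝒯 ∧
      Nonempty (U ≅ Y ⊞ M)

/-- For an object `A` of `𝒯`, the set of isomorphism classes of basic silting objects `T` with
`A ≥ T ≥ A[1]`. -/
def twoSilt (A : 𝒯) : Set (IsoClass 𝒯) :=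
  IsoClass.mk '' {T | IsSilting T ∧ IsBasic T ∧ Geq A T ∧ Geq T (A⟦(1 : ℤ)⟧)}

/-- The classes `T` in `twoSilt A` with `μ_X^-(A) ≥ T ≥ A[1]`. The mutation is formed at the basic
version `B` of `A`. -/
def twoSiltMinus (A X : 𝒯) : Set (IsoClass 𝒯) :=
  {t ∈ twoSilt A | ∃ B U : 𝒯, IsBasicVersion B A ∧ IsLeftMutation X B U ∧
    (IsoClass.mk U).Geq t ∧ t.Geq (IsoClass.mk (A⟦(1 : ℤ)⟧))}

/-- The classes `T` in `twoSilt A` with `A ≥ T ≥ μ_{X[1]}^+(A[1])`. The mutation is formed at the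
shift of the basic version `B` of `A`. -/
def twoSiltPlus (A X : 𝒯) : Set (IsoClass 𝒯) :=
  {t ∈ twoSilt A | ∃ B U : 𝒯, IsBasicVersion B A ∧
    IsRightMutation (X⟦(1 : ℤ)⟧) (B⟦(1 : ℤ)⟧) U ∧
    (IsoClass.mk A).Geq t ∧ t.Geq (IsoClass.mk U)}

end General

/-! ### The bounded homotopy category of an additive category -/

section Bounded

variable (C : Type u) [Category.{v} C] [Preadditive C]

/-- The objects of the homotopy category whose underlying cochain complex is bounded. -/
def bounded : ObjectProperty (HomotopyCategory C (ComplexShape.up ℤ)) :=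
  ObjectProperty.strictMap
    (fun K : CochainComplex C ℤ => ∃ a b : ℤ, K.IsStrictlyGE a ∧ K.IsStrictlyLE b)
    (HomotopyCategory.quotient C (ComplexShape.up ℤ))

variable {C}

lemma bounded_quotient_iff (K : CochainComplex C ℤ) :
    bounded C ((HomotopyCategory.quotient C _).obj K) ↔
      ∃ a b : ℤ, K.IsStrictlyGE a ∧ K.IsStrictlyLE b := by
  refine ⟨?_, fun h => ⟨_, h⟩⟩
  simp only [bounded, ObjectProperty.strictMap_iff]
  rintro ⟨L, h, hL⟩
  obtain rfl : L = K := congr_arg CategoryTheory.Quotient.as hL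
  exact h

variable [HasBinaryBiproducts C]

lemma bounded_mappingCone {K L : CochainComplex C ℤ} (f : K ⟶ L)
    (hK : bounded C ((HomotopyCategory.quotient C _).obj K))
    (hL : bounded C ((HomotopyCategory.quotient C _).obj L)) :
    bounded C ((HomotopyCategory.quotient C _).obj (CochainComplex.mappingCone f)) := by
  obtain ⟨a, b, _, _⟩ := (bounded_quotient_iff K).1 hK
  obtain ⟨a', b', _, _⟩ := (bounded_quotient_iff L).1 hL
  refine (bounded_quotient_iff _).2 ⟨min (a - 1) a', max b b', ?_, ?_⟩
  · rw [CochainComplex.isStrictlyGE_iff]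
    intro i hi
    rw [CochainComplex.mappingCone.isZero_X_iff]
    exact ⟨K.isZero_of_isStrictlyGE a _ (by grind), L.isZero_of_isStrictlyGE a' _ (by grind)⟩
  · rw [CochainComplex.isStrictlyLE_iff]
    intro i hi
    rw [CochainComplex.mappingCone.isZero_X_iff]
    exact ⟨K.isZero_of_isStrictlyLE b _ (by grind), L.isZero_of_isStrictlyLE b' _ (by grind)⟩

variable [HasZeroObject C]

instance : (bounded C).ContainsZero where
  exists_zero :=
    ⟨(HomotopyCategory.quotient _ _).obj (HomologicalComplex.zero : CochainComplex C ℤ),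
      Functor.map_isZero _ HomologicalComplex.isZero_zero,
      (bounded_quotient_iff _).2 ⟨0, 0,
        (CochainComplex.isStrictlyGE_iff _ _).2 fun _ _ => isZero_zero C,
        (CochainComplex.isStrictlyLE_iff _ _).2 fun _ _ => isZero_zero C⟩⟩

instance : (bounded C).IsStableUnderShift ℤ where
  isStableUnderShiftBy n :=
    { le_shift K hK := by
        obtain ⟨K : CochainComplex _ _, rfl⟩ := K.quotient_obj_surjective
        obtain ⟨a, b, _, _⟩ := (bounded_quotient_iff K).1 hK
        rw [ObjectProperty.prop_shift_iff, HomotopyCategory.shift_quotient_obj,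
          bounded_quotient_iff]
        exact ⟨a - n, b - n, K.isStrictlyGE_shift a n (a - n) (by lia),
          K.isStrictlyLE_shift b n (b - n) (by lia)⟩ }

instance : (bounded C).IsTriangulatedClosed₃ where
  ext₃' T hT h₁ h₂ := by
    obtain ⟨X₁, X₂, X₃, f, g, h⟩ := T
    obtain ⟨K, rfl⟩ := HomotopyCategory.quotient_obj_surjective X₁
    obtain ⟨L, rfl⟩ := HomotopyCategory.quotient_obj_surjective X₂
    obtain ⟨f', rfl⟩ := (HomotopyCategory.quotient C (ComplexShape.up ℤ)).map_surjective f
    exact ⟨_, bounded_mappingCone f' h₁ h₂,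
      ⟨Triangle.π₃.mapIso (isoTriangleOfIso₁₂ _ _ hT
        (HomotopyCategory.mappingCone_triangleh_distinguished f')
        (Iso.refl _) (Iso.refl _) ((Category.comp_id _).trans (Category.id_comp _).symm))⟩⟩

instance : (bounded C).IsTriangulated where
  toIsTriangulatedClosed₂ := .of_isTriangulatedClosed₃

variable (C) in
/-- The bounded homotopy category `K^b(C)` with its standard triangulated structure. -/
abbrev Kb := (bounded C).FullSubcategory

variable (C) in
/-- The functor `C ⥤ K^b(C)` sending an object to the complex concentrated in degree zero. -/
noncomputable def stalk : C ⥤ Kb C :=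
  (bounded C).lift (HomotopyCategory.singleFunctor C 0) (fun X => by
    rw [← HomotopyCategory.quotient_obj_singleFunctors_obj, bounded_quotient_iff]
    exact ⟨0, 0, inferInstance, inferInstance⟩)

end Bounded

/-! ### Finitely generated projective modules and selfinjective Nakayama algebras -/

section Algebras

variable (Λ : Type u) [Ring Λ]

/-- The finitely generated projective left modules. -/
def fgProj : ObjectProperty (ModuleCat.{u} Λ) := fun M =>
  Module.Finite Λ M ∧ Module.Projective Λ M

instance : (fgProj Λ).IsClosedUnderIsomorphisms where
  of_iso {M N} e h := by
    obtain ⟨_, _⟩ := h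
    exact ⟨Module.Finite.equiv e.toLinearEquiv, Module.Projective.of_equiv e.toLinearEquiv⟩

instance : (fgProj Λ).ContainsZero where
  exists_zero := ⟨ModuleCat.of Λ PUnit.{u+1}, ModuleCat.isZero_of_subsingleton _,
    ⟨inferInstanceAs (Module.Finite Λ PUnit.{u+1}), inferInstanceAs (Module.Projective Λ PUnit.{u+1})⟩⟩

instance : (fgProj Λ).IsClosedUnderBinaryProducts where
  limitsOfShape_le := by
    rintro X ⟨p⟩
    have h₁ := p.prop_diag_obj ⟨WalkingPair.left⟩
    have h₂ := p.prop_diag_obj ⟨WalkingPair.right⟩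
    obtain ⟨_, _⟩ := h₁
    obtain ⟨_, _⟩ := h₂
    have h : fgProj Λ (ModuleCat.of Λ (p.diag.obj ⟨WalkingPair.left⟩ ×
        p.diag.obj ⟨WalkingPair.right⟩)) :=
      ⟨inferInstanceAs (Module.Finite Λ (_ × _)), inferInstanceAs (Module.Projective Λ (_ × _))⟩
    exact (fgProj Λ).prop_of_iso
      (((ModuleCat.biprodIsoProd _ _).symm ≪≫ biprod.isoProd _ _) ≪≫
        (HasLimit.isoOfNatIso (diagramIsoPair p.diag)).symm ≪≫
        (limit.isLimit p.diag).conePointUniqueUpToIso p.isLimit) h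

instance : (fgProj Λ).IsClosedUnderFiniteProducts := .mk'

/-- The category `proj Λ` of finitely generated projective left `Λ`-modules. -/
abbrev Proj := (fgProj Λ).FullSubcategory

instance : HasFiniteBiproducts (Proj Λ) := .of_hasFiniteProducts

instance : HasBinaryBiproducts (Proj Λ) := hasBinaryBiproducts_of_finite_biproducts _

/-- The perfect derived category `K^b(proj Λ)`. -/
abbrev Perf := Kb (Proj Λ)

/-- A finitely generated projective module, as an object of `proj Λ`. -/
def Proj.of (P : Type u) [AddCommGroup P] [Module Λ P] [hf : Module.Finite Λ P]
    [hp : Module.Projective Λ P] : Proj Λ :=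
  ⟨ModuleCat.of Λ P, hf, hp⟩

/-- A finitely generated projective module, as a complex concentrated in degree zero. -/
noncomputable def Perf.of (P : Type u) [AddCommGroup P] [Module Λ P] [Module.Finite Λ P]
    [Module.Projective Λ P] : Perf Λ :=
  (stalk (Proj Λ)).obj (Proj.of Λ P)

/-- A module is indecomposable if it is nonzero and not a direct sum of two nonzero submodules. -/
def IsIndecomposableModule (M : Type u) [AddCommGroup M] [Module Λ M] : Prop :=
  Nontrivial M ∧ ∀ A B : Submodule Λ M, IsCompl A B → A = ⊥ ∨ B = ⊥

/-- A module is uniserial if its submodules are totally ordered by inclusion. -/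
def IsUniserial (M : Type u) [AddCommGroup M] [Module Λ M] : Prop :=
  ∀ A B : Submodule Λ M, A ≤ B ∨ B ≤ A

/-- Every finitely generated indecomposable projective left module is uniserial. -/
def ProjIndecUniserial : Prop :=
  ∀ (M : Type u) [AddCommGroup M] [Module Λ M] [Module.Finite Λ M] [Module.Projective Λ M],
    IsIndecomposableModule Λ M → IsUniserial Λ M

/-- `Λ` is Nakayama: all indecomposable projective left modules and right modules are
uniserial. -/
def IsNakayama : Prop :=
  ProjIndecUniserial Λ ∧ ProjIndecUniserial Λᵐᵒᵖ

/-- `Λ` is selfinjective: the regular module is injective. -/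
def IsSelfinjective : Prop := Module.Injective Λ Λ

/-- `2silt Λ`. -/
def twoSiltAlg : Set (IsoClass (Perf Λ)) := twoSilt (Perf.of Λ Λ)

variable (P : Type u) [AddCommGroup P] [Module Λ P] [Module.Finite Λ P] [Module.Projective Λ P]

/-- The set `𝒯_P^-` of all `T` in `2silt Λ` with `μ_P^-(Λ) ≥ T ≥ Λ[1]`. -/
def tMinus : Set (IsoClass (Perf Λ)) := twoSiltMinus (Perf.of Λ Λ) (Perf.of Λ P)

/-- The set `𝒯_P^+` of all `T` in `2silt Λ` with `Λ ≥ T ≥ μ_{P[1]}^+(Λ[1])`. -/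
def tPlus : Set (IsoClass (Perf Λ)) := twoSiltPlus (Perf.of Λ Λ) (Perf.of Λ P)

end Algebras

end Silting

/-! The symmetry is `T ↦ D(T)[1]`, where `D` is a contravariant autoequivalence of `K^b(proj Λ)`
that preserves `add Λ` and fixes `P`. Such a functor reverses `≥`, and it turns `Λ ≥ T ≥ Λ[1]` into
`Λ ≥ D(T)[1] ≥ Λ[1]`.

To see that it exchanges the two halves, mutation is removed from their description. The left
mutation contains the cone of an approximation `P ⟶ M'`, and `Hom(cone, T[1])` is the cokernel of
`Hom(M', T) ⟶ Hom(P, T)`. Hence `T` lies in the lower half iff every map `P ⟶ T` factors through an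
object of `add Λ` without summand `P` (`IsLeftMutation.geq_iff`). Dually, `T` lies in the upper half
iff every map `T ⟶ P[1]` factors through an object of `add Λ[1]` without summand `P[1]`. The two
conditions are dual to each other.

For the cardinality, write `T` as the cone of `d : T₁ ⟶ T₀` with `T₁, T₀` in `add Λ` and with no
component `P ⟶ P` of `d` invertible. The two conditions say that `P` is not a summand of `T₀`,
respectively of `T₁`. If `P` were a summand of both, the composite `T₁ ⟶ P ⟶ T₀` would be
null-homotopic because `Hom(T, T[1]) = 0`, and some component of `d` would be invertible. If `P`
were a summand of neither, `T` would lie in the thick closure of the complement `M` of `P`; then `M`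
would be silting, and `P ≥ M ≥ P` would put `P` in `add M`. So the two halves partition all two-term
silting objects.

The functor `D` is induced by an anti-autoequivalence of `proj Λ`. Let `Q i` be the indecomposable
projectives and `Q (τ i)` the projective cover of the radical of `Q i`. Selfinjectivity makes `τ`
injective, hence a permutation, and makes the lengths of the `Q i` constant on its cycles. As `K` is
algebraically closed, the maps `Q j ⟶ Q i` have as basis the nonzero composites of `k` covers with
`τ^k i = j`. The category is thus determined by the cycles and their lengths, and reflecting each
cycle, with the index of `P` fixed, reverses all arrows (`IsProjFamily.exists_reversal`). Matrices
over these objects give all of `proj Λ`.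

No Krull-Schmidt theorem is invoked in the triangulated category: the local endomorphism ring of `P`
and the dimension of `Hom(Λ, -)` do its work. -/

namespace Silting

/-! ### Vanishing of morphisms -/

/-- There are no nonzero morphisms from `X` to `Y`. -/
def HomZero {𝒯 : Type u} [Category.{v} 𝒯] [Preadditive 𝒯] (X Y : 𝒯) : Prop :=
  ∀ f : X ⟶ Y, f = 0

section Vanishing

variable {𝒯 : Type u} [Category.{v} 𝒯] [Preadditive 𝒯]

lemma HomZero.of_retract {X X' Y Y' : 𝒯} (H : HomZero X Y) (r : Retract X' X)
    (s : Retract Y' Y) : HomZero X' Y' := by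
  intro f
  have h := H (r.r ≫ f ≫ s.i)
  have h' : f = r.i ≫ (r.r ≫ f ≫ s.i) ≫ s.r := by simp
  rw [h', h]
  simp

lemma HomZero.of_iso {X X' Y Y' : 𝒯} (H : HomZero X Y) (e : X' ≅ X) (e' : Y' ≅ Y) :
    HomZero X' Y' :=
  H.of_retract (.ofIso e) (.ofIso e')

lemma HomZero.isZero {X : 𝒯} (H : HomZero X X) : IsZero X :=
  (IsZero.iff_id_eq_zero X).2 (H _)

lemma homZero_of_sum {ι : Type*} [Fintype ι] {M X Z : 𝒯} (i : ι → (X ⟶ M)) (r : ι → (M ⟶ X))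
    (h : ∑ k, i k ≫ r k = 𝟙 X) (H : HomZero M Z) : HomZero X Z := by
  intro f
  rw [← Category.id_comp f, ← h, Preadditive.sum_comp]
  exact Finset.sum_eq_zero fun k _ => by rw [Category.assoc, H (r k ≫ f), comp_zero]

lemma homZero_of_sum' {ι : Type*} [Fintype ι] {M X Z : 𝒯} (i : ι → (X ⟶ M)) (r : ι → (M ⟶ X))
    (h : ∑ k, i k ≫ r k = 𝟙 X) (H : HomZero Z M) : HomZero Z X := by
  intro f
  rw [← Category.comp_id f, ← h, Preadditive.comp_sum]
  exact Finset.sum_eq_zero fun k _ => by rw [← Category.assoc, H (f ≫ i k), zero_comp]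

variable [HasShift 𝒯 ℤ]

lemma homZero_shift_iff {X Y : 𝒯} (n : ℤ) [(shiftFunctor 𝒯 n).Additive] :
    HomZero (X⟦n⟧) (Y⟦n⟧) ↔ HomZero X Y := by
  refine ⟨fun H f => ?_, fun H f => ?_⟩
  · exact (shiftFunctor 𝒯 n).map_injective (by rw [H (f⟦n⟧'), Functor.map_zero])
  · obtain ⟨g, rfl⟩ := (shiftFunctor 𝒯 n).map_surjective f
    rw [H g, Functor.map_zero]

lemma homZero_shift_add_iff {X Y : 𝒯} (a b c : ℤ) (h : a + b = c) :
    HomZero X (Y⟦a⟧⟦b⟧) ↔ HomZero X (Y⟦c⟧) :=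
  ⟨fun H => H.of_iso (Iso.refl _) ((shiftFunctorAdd' 𝒯 a b c h).app Y),
    fun H => H.of_iso (Iso.refl _) ((shiftFunctorAdd' 𝒯 a b c h).symm.app Y)⟩

lemma homZero_shift_left_iff [∀ n : ℤ, (shiftFunctor 𝒯 n).Additive] {X Y : 𝒯} (a b c : ℤ)
    (h : a + c = b) : HomZero (X⟦a⟧) (Y⟦b⟧) ↔ HomZero X (Y⟦c⟧) := by
  rw [← homZero_shift_add_iff c a b (by lia), homZero_shift_iff]

lemma geq_shift_right_iff {T U : 𝒯} (n : ℤ) :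
    Geq T (U⟦n⟧) ↔ ∀ i : ℤ, n < i → HomZero T (U⟦i⟧) :=
  ⟨fun H i hi => (homZero_shift_add_iff n (i - n) i (by lia)).1 (H _ (by lia)),
    fun H i hi => (homZero_shift_add_iff n i (n + i) rfl).2 (H _ (by lia))⟩

lemma geq_shift_iff [∀ n : ℤ, (shiftFunctor 𝒯 n).Additive] {T U : 𝒯} (n : ℤ) :
    Geq (T⟦n⟧) (U⟦n⟧) ↔ Geq T U := by
  refine ⟨fun H i hi => ?_, fun H i hi => ?_⟩
  · exact (homZero_shift_left_iff n (n + i) i rfl).1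
      ((homZero_shift_add_iff n i _ rfl).1 (H i hi))
  · exact (homZero_shift_add_iff n i _ rfl).2
      ((homZero_shift_left_iff n (n + i) i rfl).2 (H i hi))

lemma Geq.of_retract {T U T' U' : 𝒯} (H : Geq T U) (r : Retract T' T) (s : Retract U' U) :
    Geq T' U' := fun i hi =>
  HomZero.of_retract (H i hi) r (s.map (shiftFunctor 𝒯 i))

end Vanishing

/-! ### Vanishing and lifting along distinguished triangles -/

section Triangles

variable {𝒯 : Type u} [Category.{v} 𝒯] [HasZeroObject 𝒯] [Preadditive 𝒯] [HasShift 𝒯 ℤ]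
  [∀ n : ℤ, (shiftFunctor 𝒯 n).Additive] [Pretriangulated 𝒯]

lemma homZero_obj₂ {T : Triangle 𝒯} (hT : T ∈ distTriang 𝒯) {X : 𝒯} (n : ℤ)
    (h₁ : HomZero X (T.obj₁⟦n⟧)) (h₃ : HomZero X (T.obj₃⟦n⟧)) : HomZero X (T.obj₂⟦n⟧) := by
  intro f
  obtain ⟨g, hg⟩ := Triangle.coyoneda_exact₂ _ (T.shift_distinguished hT n) f (h₃ _)
  rw [hg, h₁ g]
  exact zero_comp

lemma homZero_obj₃ {T : Triangle 𝒯} (hT : T ∈ distTriang 𝒯) {X : 𝒯} (n m : ℤ) (hm : n + 1 = m)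
    (h₂ : HomZero X (T.obj₂⟦n⟧)) (h₁ : HomZero X (T.obj₁⟦m⟧)) : HomZero X (T.obj₃⟦n⟧) :=
  homZero_obj₂ (rot_of_distTriang _ hT) n h₂
    ((homZero_shift_add_iff 1 n m (by lia)).2 h₁)

lemma homZero_obj₁ {T : Triangle 𝒯} (hT : T ∈ distTriang 𝒯) {X : 𝒯} (n m : ℤ) (hm : m + 1 = n)
    (h₂ : HomZero X (T.obj₂⟦n⟧)) (h₃ : HomZero X (T.obj₃⟦m⟧)) : HomZero X (T.obj₁⟦n⟧) :=
  homZero_obj₂ (inv_rot_of_distTriang _ hT) n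
    ((homZero_shift_add_iff (-1) n m (by lia)).2 h₃) h₂

lemma homZero_of_obj₂ {T : Triangle 𝒯} (hT : T ∈ distTriang 𝒯) {Y : 𝒯}
    (h₁ : HomZero T.obj₁ Y) (h₃ : HomZero T.obj₃ Y) : HomZero T.obj₂ Y := by
  intro f
  obtain ⟨g, hg⟩ := Triangle.yoneda_exact₂ _ hT f (h₁ _)
  rw [hg, h₃ g, comp_zero]

lemma homZero_of_obj₁ {T : Triangle 𝒯} (hT : T ∈ distTriang 𝒯) {Y : 𝒯} (n m : ℤ) (hm : n + 1 = m)
    (h₂ : HomZero T.obj₂ (Y⟦n⟧)) (h₃ : HomZero T.obj₃ (Y⟦m⟧)) : HomZero T.obj₁ (Y⟦n⟧) :=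
  homZero_of_obj₂ (inv_rot_of_distTriang _ hT)
    ((homZero_shift_left_iff (-1) n m (by lia)).2 h₃) h₂

lemma homZero_of_obj₃ {T : Triangle 𝒯} (hT : T ∈ distTriang 𝒯) {Y : 𝒯} (n m : ℤ) (hm : m + 1 = n)
    (h₂ : HomZero T.obj₂ (Y⟦n⟧)) (h₁ : HomZero T.obj₁ (Y⟦m⟧)) : HomZero T.obj₃ (Y⟦n⟧) :=
  homZero_of_obj₂ (rot_of_distTriang _ hT) h₂
    ((homZero_shift_left_iff 1 n m (by lia)).2 h₁)

section Exact

variable {X Y Z : 𝒯} {f : X ⟶ Y} {g : Y ⟶ Z} {h : Z ⟶ X⟦(1 : ℤ)⟧} {W : 𝒯}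

lemma dist_comp₁₂ (hT : Triangle.mk f g h ∈ distTriang 𝒯) : f ≫ g = 0 := comp_distTriang_mor_zero₁₂ _ hT

lemma dist_comp₂₃ (hT : Triangle.mk f g h ∈ distTriang 𝒯) : g ≫ h = 0 := comp_distTriang_mor_zero₂₃ _ hT

lemma dist_comp₃₁ (hT : Triangle.mk f g h ∈ distTriang 𝒯) : h ≫ f⟦(1 : ℤ)⟧' = 0 := comp_distTriang_mor_zero₃₁ _ hT

lemma dist_lift₂ (hT : Triangle.mk f g h ∈ distTriang 𝒯) (x : W ⟶ Y)
    (hx : x ≫ g = 0) : ∃ l : W ⟶ X, l ≫ f = x := by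
  obtain ⟨l, hl⟩ := Triangle.coyoneda_exact₂ _ hT x hx
  exact ⟨l, hl.symm⟩

lemma dist_lift₃ (hT : Triangle.mk f g h ∈ distTriang 𝒯) (x : W ⟶ Z)
    (hx : x ≫ h = 0) : ∃ l : W ⟶ Y, l ≫ g = x := by
  obtain ⟨l, hl⟩ := Triangle.coyoneda_exact₃ _ hT x hx
  exact ⟨l, hl.symm⟩

lemma dist_lift₁ (hT : Triangle.mk f g h ∈ distTriang 𝒯) (x : W ⟶ X⟦(1 : ℤ)⟧)
    (hx : x ≫ f⟦(1 : ℤ)⟧' = 0) : ∃ l : W ⟶ Z, l ≫ h = x := by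
  obtain ⟨l, hl⟩ := Triangle.coyoneda_exact₁ _ hT x hx
  exact ⟨l, hl.symm⟩

lemma dist_desc₃ (hT : Triangle.mk f g h ∈ distTriang 𝒯) (x : Z ⟶ W)
    (hx : g ≫ x = 0) : ∃ l : X⟦(1 : ℤ)⟧ ⟶ W, h ≫ l = x := by
  obtain ⟨l, hl⟩ := Triangle.yoneda_exact₃ _ hT x hx
  exact ⟨l, hl.symm⟩

lemma dist_desc₁ (hT : Triangle.mk f g h ∈ distTriang 𝒯) (x : X ⟶ W)
    (hx : h ≫ x⟦(1 : ℤ)⟧' = 0) : ∃ l : Y ⟶ W, f ≫ l = x := by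
  obtain ⟨l, hl⟩ := Triangle.yoneda_exact₃ _ (rot_of_distTriang _ hT) (x⟦(1 : ℤ)⟧') hx
  obtain ⟨l, rfl⟩ := (shiftFunctor 𝒯 (1 : ℤ)).map_surjective l
  have hl' : x⟦(1 : ℤ)⟧' = (-f⟦(1 : ℤ)⟧') ≫ l⟦(1 : ℤ)⟧' := hl
  refine ⟨-(show Y ⟶ W from l), (shiftFunctor 𝒯 (1 : ℤ)).map_injective ?_⟩
  rw [hl', Preadditive.comp_neg, Functor.map_neg, Functor.map_comp, Preadditive.neg_comp]

end Exact

/-- A retract has a complement. -/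
lemma exists_biprod_of_retract {X Y : 𝒯} (r : Retract X Y) :
    ∃ (Z : 𝒯) (e : Y ≅ X ⊞ Z), r.i ≫ e.hom = biprod.inl := by
  obtain ⟨Z, g, h, hT⟩ := distinguished_cocone_triangle r.i
  have hm : Mono r.i := inferInstance
  obtain ⟨e, he, -⟩ := exists_iso_binaryBiproduct_of_distTriang _ hT
    (Triangle.mor₃_eq_zero_of_mono₁ _ hT hm)
  exact ⟨Z, e, he⟩

end Triangles

/-! ### The additive closure of an object -/

section Add

variable {𝒯 : Type u} [Category.{v} 𝒯] [HasZeroObject 𝒯] [Preadditive 𝒯] [HasShift 𝒯 ℤ]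
  [∀ n : ℤ, (shiftFunctor 𝒯 n).Additive] [Pretriangulated 𝒯]

lemma inAdd_of_sum {ι : Type} [Fintype ι] {M X : 𝒯} (i : ι → (X ⟶ M)) (r : ι → (M ⟶ X))
    (h : ∑ k, i k ≫ r k = 𝟙 X) : InAdd M X := by
  classical
  refine ⟨Fintype.card ι, ⟨⟨biproduct.lift fun k => i ((Fintype.equivFin ι).symm k),
    biproduct.desc fun k => r ((Fintype.equivFin ι).symm k), ?_⟩⟩⟩
  rw [biproduct.lift_desc, ← h]
  exact (Fintype.equivFin ι).symm.sum_comp fun k => i k ≫ r k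

lemma InAdd.exists_sum {M X : 𝒯} (H : InAdd M X) :
    ∃ (n : ℕ) (i : Fin n → (X ⟶ M)) (r : Fin n → (M ⟶ X)), ∑ k, i k ≫ r k = 𝟙 X := by
  obtain ⟨n, ⟨ρ⟩⟩ := H
  refine ⟨n, fun k => ρ.i ≫ biproduct.π _ k, fun k =>
    biproduct.ι (fun _ : Fin n => M) k ≫ ρ.r, ?_⟩
  have h := ρ.retract
  rw [← Category.id_comp ρ.r, ← biproduct.total, Preadditive.sum_comp, Preadditive.comp_sum] at h
  simpa using h

lemma InAdd.of_retract {M X Y : 𝒯} (H : InAdd M X) (r : Retract Y X) : InAdd M Y := by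
  obtain ⟨n, ⟨ρ⟩⟩ := H
  exact ⟨n, ⟨r.trans ρ⟩⟩

lemma inAdd_self (M : 𝒯) : InAdd M M :=
  inAdd_of_sum (ι := Unit) (fun _ => 𝟙 M) (fun _ => 𝟙 M) (by simp)

lemma inAdd_of_retract {M X : 𝒯} (r : Retract X M) : InAdd M X := (inAdd_self M).of_retract r

lemma InAdd.trans {M N X : 𝒯} (h : InAdd M N) (h' : InAdd N X) : InAdd M X := by
  obtain ⟨n, i, r, hir⟩ := h.exists_sum
  obtain ⟨m, j, s, hjs⟩ := h'.exists_sum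
  refine inAdd_of_sum (ι := Fin m × Fin n) (fun k => j k.1 ≫ i k.2) (fun k => r k.2 ≫ s k.1) ?_
  rw [Fintype.sum_prod_type, ← hjs]
  refine Finset.sum_congr rfl fun k _ => ?_
  have : j k ≫ s k = j k ≫ (∑ l, i l ≫ r l) ≫ s k := by rw [hir, Category.id_comp]
  rw [this, Preadditive.sum_comp, Preadditive.comp_sum]
  simp

lemma InAdd.biprod {M X Y : 𝒯} (h : InAdd M X) (h' : InAdd M Y) : InAdd M (X ⊞ Y) := by
  obtain ⟨n, i, r, hir⟩ := h.exists_sum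
  obtain ⟨m, j, s, hjs⟩ := h'.exists_sum
  refine inAdd_of_sum (ι := Fin n ⊕ Fin m)
    (Sum.elim (fun k => biprod.fst ≫ i k) (fun k => biprod.snd ≫ j k))
    (Sum.elim (fun k => r k ≫ biprod.inl) (fun k => s k ≫ biprod.inr)) ?_
  rw [Fintype.sum_sum_type]
  simp only [Sum.elim_inl, Sum.elim_inr, Category.assoc]
  simp only [← Preadditive.comp_sum, ← Category.assoc (i _), ← Category.assoc (j _),
    ← Preadditive.sum_comp, hir, hjs, Category.id_comp, biprod.total]

lemma inAdd_biproduct_fin (M : 𝒯) (n : ℕ) : InAdd M (⨁ fun _ : Fin n => M) :=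
  ⟨n, ⟨.refl _⟩⟩

lemma InAdd.map {M X : 𝒯} (h : InAdd M X) (F : 𝒯 ⥤ 𝒯) [F.Additive] :
    InAdd (F.obj M) (F.obj X) := by
  obtain ⟨n, i, r, hir⟩ := h.exists_sum
  refine inAdd_of_sum (fun k => F.map (i k)) (fun k => F.map (r k)) ?_
  simp only [← F.map_comp, ← F.map_sum, hir, F.map_id]

lemma InAdd.map_op {M X : 𝒯} (h : InAdd M X) (F : 𝒯ᵒᵖ ⥤ 𝒯) [F.Additive] :
    InAdd (F.obj (.op M)) (F.obj (.op X)) := by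
  obtain ⟨n, i, r, hir⟩ := h.exists_sum
  refine inAdd_of_sum (fun k => F.map (r k).op) (fun k => F.map (i k).op) ?_
  simp only [← F.map_comp, ← F.map_sum, ← op_comp, ← op_sum, hir, op_id, F.map_id]

lemma InAdd.exists_shift {M X : 𝒯} {n : ℤ} (h : InAdd (M⟦n⟧) X) :
    ∃ Y : 𝒯, InAdd M Y ∧ Nonempty (X ≅ Y⟦n⟧) := by
  refine ⟨X⟦-n⟧, ?_, ⟨((shiftFunctorCompIsoId 𝒯 (-n) n (by lia)).app X).symm⟩⟩
  exact (inAdd_of_retract (.ofIso ((shiftFunctorCompIsoId 𝒯 n (-n) (by lia)).app M))).trans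
    (h.map (shiftFunctor 𝒯 (-n)))

lemma InAdd.homZero_left {M X Z : 𝒯} (h : InAdd M X) (H : HomZero M Z) : HomZero X Z := by
  obtain ⟨n, i, r, hir⟩ := h.exists_sum
  exact homZero_of_sum i r hir H

lemma InAdd.homZero_right {M X Z : 𝒯} (h : InAdd M X) (H : HomZero Z M) : HomZero Z X := by
  obtain ⟨n, i, r, hir⟩ := h.exists_sum
  exact homZero_of_sum' i r hir H

lemma InAdd.geq_left {M X Z : 𝒯} (h : InAdd M X) (H : Geq M Z) : Geq X Z :=
  fun i hi => h.homZero_left (H i hi)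

lemma InAdd.geq_right {M X Z : 𝒯} (h : InAdd M X) (H : Geq Z M) : Geq Z X :=
  fun i hi => (h.map (shiftFunctor 𝒯 i)).homZero_right (H i hi)

lemma geq_biprod_left_iff {X Y Z : 𝒯} : Geq (X ⊞ Y) Z ↔ Geq X Z ∧ Geq Y Z := by
  refine ⟨fun H => ⟨H.of_retract ⟨biprod.inl, biprod.fst, by simp⟩ (.refl _),
    H.of_retract ⟨biprod.inr, biprod.snd, by simp⟩ (.refl _)⟩, fun H i hi f => ?_⟩
  apply biprod.hom_ext'
  · rw [H.1 i hi (biprod.inl ≫ f), comp_zero]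
  · rw [H.2 i hi (biprod.inr ≫ f), comp_zero]

lemma geq_biprod_right_iff {X Y Z : 𝒯} : Geq Z (X ⊞ Y) ↔ Geq Z X ∧ Geq Z Y := by
  refine ⟨fun H => ⟨H.of_retract (.refl _) ⟨biprod.inl, biprod.fst, by simp⟩,
    H.of_retract (.refl _) ⟨biprod.inr, biprod.snd, by simp⟩⟩, fun H i hi f => ?_⟩
  have h : f = f ≫ (𝟙 (X ⊞ Y))⟦i⟧' := by simp
  rw [h, ← biprod.total, Functor.map_add, Preadditive.comp_add, Functor.map_comp,
    Functor.map_comp, ← Category.assoc, ← Category.assoc, H.1 i hi (f ≫ _), H.2 i hi (f ≫ _)]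
  simp

lemma InAdd.exists_lift {M X Y Z : 𝒯} (h : InAdd M X) (p : Y ⟶ Z)
    (hp : ∀ g : M ⟶ Z, ∃ l : M ⟶ Y, l ≫ p = g) (f : X ⟶ Z) : ∃ l : X ⟶ Y, l ≫ p = f := by
  obtain ⟨n, i, r, hir⟩ := h.exists_sum
  choose l hl using fun k => hp (r k ≫ f)
  refine ⟨∑ k, i k ≫ l k, ?_⟩
  rw [Preadditive.sum_comp, ← Category.id_comp f, ← hir, Preadditive.sum_comp]
  simp [hl]

lemma InAdd.exists_desc {M X Y Z : 𝒯} (h : InAdd M X) (p : Z ⟶ Y)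
    (hp : ∀ g : Z ⟶ M, ∃ l : Y ⟶ M, p ≫ l = g) (f : Z ⟶ X) : ∃ l : Y ⟶ X, p ≫ l = f := by
  obtain ⟨n, i, r, hir⟩ := h.exists_sum
  choose l hl using fun k => hp (f ≫ i k)
  refine ⟨∑ k, l k ≫ r k, ?_⟩
  rw [Preadditive.comp_sum, ← Category.comp_id f, ← hir, Preadditive.comp_sum]
  simp [← Category.assoc, hl]

end Add

end Silting

/-! ### Minimal approximations and basic versions -/

namespace Silting

section Iterate

variable {𝒯 : Type u} [Category.{v} 𝒯]

/-- The powers of an endomorphism. -/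
def iterateHom {X : 𝒯} (h : X ⟶ X) : ℕ → (X ⟶ X)
  | 0 => 𝟙 X
  | n + 1 => h ≫ iterateHom h n

lemma comp_iterateHom {X Y : 𝒯} {f : Y ⟶ X} {h : X ⟶ X} (hf : f ≫ h = f) (n : ℕ) :
    f ≫ iterateHom h n = f := by
  induction n with
  | zero => exact Category.comp_id f
  | succ n ih => rw [iterateHom, ← Category.assoc, hf, ih]

lemma iterateHom_comp {X Y : 𝒯} {f : X ⟶ Y} {h : X ⟶ X} (hf : h ≫ f = f) (n : ℕ) :
    iterateHom h n ≫ f = f := by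
  induction n with
  | zero => exact Category.id_comp f
  | succ n ih => rw [iterateHom, Category.assoc, ih, hf]

end Iterate

section Finite

variable {𝒯 : Type u} [Category.{v} 𝒯] [HasZeroObject 𝒯] [Preadditive 𝒯] [HasShift 𝒯 ℤ]
  [∀ n : ℤ, (shiftFunctor 𝒯 n).Additive] [Pretriangulated 𝒯]
  (K : Type w) [Field K] [Linear K 𝒯] {A : 𝒯}

lemma InAdd.finite {X : 𝒯} (h : InAdd A X) (hfin : ∀ Y : 𝒯, Module.Finite K (A ⟶ Y)) (Y : 𝒯) :
    Module.Finite K (X ⟶ Y) := by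
  obtain ⟨n, i, r, hir⟩ := h.exists_sum
  let φ : (X ⟶ Y) →ₗ[K] (Fin n → (A ⟶ Y)) := LinearMap.pi fun k => Linear.leftComp K Y (r k)
  refine Module.Finite.of_injective φ ?_
  rw [← LinearMap.ker_eq_bot, LinearMap.ker_eq_bot']
  intro f hf
  rw [← Category.id_comp f, ← hir, Preadditive.sum_comp]
  refine Finset.sum_eq_zero fun k _ => ?_
  have := congr_fun hf k
  dsimp [φ] at this
  rw [Category.assoc, show r k ≫ f = 0 from this, comp_zero]

lemma exists_right_approx (X : 𝒯) [Module.Finite K (A ⟶ X)] :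
    ∃ (Y : 𝒯) (p : Y ⟶ X), InAdd A Y ∧ ∀ g : A ⟶ X, ∃ l : A ⟶ Y, l ≫ p = g := by
  obtain ⟨n, s, hs⟩ := Module.Finite.exists_fin (R := K) (M := A ⟶ X)
  refine ⟨⨁ fun _ : Fin n => A, biproduct.desc s, inAdd_biproduct_fin A n, fun g => ?_⟩
  have hg : g ∈ Submodule.span K (Set.range s) := hs ▸ Submodule.mem_top
  obtain ⟨c, hc⟩ := (Submodule.mem_span_range_iff_exists_fun K).1 hg
  exact ⟨biproduct.lift fun k => c k • 𝟙 A, by simp [biproduct.lift_desc, hc]⟩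

lemma exists_left_approx (X : 𝒯) [Module.Finite K (X ⟶ A)] :
    ∃ (Y : 𝒯) (p : X ⟶ Y), InAdd A Y ∧ ∀ g : X ⟶ A, ∃ l : Y ⟶ A, p ≫ l = g := by
  obtain ⟨n, s, hs⟩ := Module.Finite.exists_fin (R := K) (M := X ⟶ A)
  refine ⟨⨁ fun _ : Fin n => A, biproduct.lift s, inAdd_biproduct_fin A n, fun g => ?_⟩
  have hg : g ∈ Submodule.span K (Set.range s) := hs ▸ Submodule.mem_top
  obtain ⟨c, hc⟩ := (Submodule.mem_span_range_iff_exists_fun K).1 hg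
  exact ⟨biproduct.desc fun k => c k • 𝟙 A, by simp [biproduct.lift_desc, hc]⟩

/-- On `add A` the functor `Hom(A, -)` is faithful, so proper direct summands have strictly smaller
`Hom(A, -)`. Minimising this dimension produces basic versions, minimal approximations and reduced
presentations. -/
lemma isIso_of_finrank_le {X Y : 𝒯} [Module.Finite K (A ⟶ X)] (hX : InAdd A X) (ρ : Retract Y X)
    (h : Module.finrank K (A ⟶ X) ≤ Module.finrank K (A ⟶ Y)) : IsIso ρ.r := by
  let φ : (A ⟶ X) →ₗ[K] (A ⟶ Y) := Linear.rightComp K A ρ.r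
  have hφ : Function.Surjective φ := fun g => ⟨g ≫ ρ.i, by simp [φ]⟩
  have hfin : Module.Finite K (A ⟶ Y) := Module.Finite.of_surjective φ hφ
  have hinj : Function.Injective φ :=
    (LinearMap.injective_iff_surjective_of_finrank_eq_finrank
      (le_antisymm h (LinearMap.finrank_le_finrank_of_surjective hφ))).2 hφ
  refine ⟨ρ.i, ?_, ρ.retract⟩
  obtain ⟨n, i, r, hir⟩ := hX.exists_sum
  have key : (𝟙 X) ≫ (ρ.r ≫ ρ.i - 𝟙 X) = 0 := by
    nth_rw 1 [← hir]
    rw [Preadditive.sum_comp]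
    refine Finset.sum_eq_zero fun k _ => ?_
    have : r k ≫ (ρ.r ≫ ρ.i - 𝟙 X) = 0 := hinj (by simp [φ])
    rw [Category.assoc, this, comp_zero]
  rwa [Category.id_comp, sub_eq_zero] at key

/-- Every object of finite type has a basic version. -/
lemma exists_isBasicVersion (hfin : ∀ Y : 𝒯, Module.Finite K (A ⟶ Y)) :
    ∃ B : 𝒯, IsBasicVersion B A := by
  classical
  let S : Set ℕ := {n | ∃ B : 𝒯, (InAdd A B ∧ InAdd B A) ∧ Module.finrank K (A ⟶ B) = n}
  have hS : S.Nonempty := ⟨_, A, ⟨inAdd_self A, inAdd_self A⟩, rfl⟩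
  obtain ⟨B, ⟨hB, hB'⟩, hn⟩ := Nat.sInf_mem hS
  refine ⟨B, ?_, fun X => ⟨hB.trans, hB'.trans⟩⟩
  rintro X Z ⟨e⟩
  -- Dropping one of the two copies of `X` leaves the additive closure unchanged. By minimality
  -- nothing was lost, so the dropped copy is zero.
  let ρ : Retract (X ⊞ Z) B :=
    { i := biprod.map biprod.inl (𝟙 Z) ≫ e.inv
      r := e.hom ≫ biprod.map biprod.fst (𝟙 Z)
      retract := by ext <;> simp }
  have hX : InAdd (X ⊞ Z) X := inAdd_of_retract ⟨biprod.inl, biprod.fst, by simp⟩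
  have hZ : InAdd (X ⊞ Z) Z := inAdd_of_retract ⟨biprod.inr, biprod.snd, by simp⟩
  have h1 : InAdd (X ⊞ Z) B := ((hX.biprod hX).biprod hZ).of_retract (.ofIso e)
  have h2 : Module.finrank K (A ⟶ B) ≤ Module.finrank K (A ⟶ X ⊞ Z) := by
    rw [hn]
    exact Nat.sInf_le ⟨_, ⟨hB.of_retract ρ, h1.trans hB'⟩, rfl⟩
  have := isIso_of_finrank_le K hB ρ h2
  have h3 : (biprod.inr ≫ biprod.inl ≫ e.inv : X ⟶ B) = 0 := by
    rw [← cancel_mono ρ.r]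
    simp [ρ]
  rw [IsZero.iff_id_eq_zero]
  have h4 := congr_arg (fun f => f ≫ e.hom ≫ biprod.fst ≫ biprod.snd) h3
  simpa using h4

/-- Fitting's lemma for the additive closure of `A`: an endomorphism is invertible, or some power
of it lives on a proper direct summand. -/
def FittingProperty (A : 𝒯) : Prop :=
  ∀ X : 𝒯, InAdd A X → ∀ h : X ⟶ X, IsIso h ∨
    ∃ (Y : 𝒯) (ρ : Retract Y X) (n : ℕ), ¬ IsIso ρ.r ∧
      iterateHom h n ≫ ρ.r ≫ ρ.i = iterateHom h n ∧
      ρ.r ≫ ρ.i ≫ iterateHom h n = iterateHom h n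

/-- Take an approximation `f` whose target has the least dimension. If `f ≫ h = f` with `h` not
invertible, a power of `h` lives on a proper summand; `f` is unchanged by that power, so projecting
to the summand gives a smaller approximation. -/
lemma exists_isMinLeftApprox (hfin : ∀ Y : 𝒯, Module.Finite K (A ⟶ Y)) (hF : FittingProperty A)
    {M X : 𝒯} (hM : InAdd A M) (hX : InAdd A X) :
    ∃ (M' : 𝒯) (f : X ⟶ M'), IsMinLeftApprox M f := by
  classical
  have := hX.finite K hfin M
  let S : Set ℕ := {n | ∃ (Y : 𝒯) (p : X ⟶ Y), (InAdd M Y ∧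
    ∀ g : X ⟶ M, ∃ l : Y ⟶ M, p ≫ l = g) ∧ Module.finrank K (A ⟶ Y) = n}
  have hS : S.Nonempty := by
    obtain ⟨Y, p, h, h'⟩ := exists_left_approx K (A := M) X
    exact ⟨_, Y, p, ⟨h, h'⟩, rfl⟩
  obtain ⟨Y, f, ⟨hY, hf⟩, hn⟩ := Nat.sInf_mem hS
  refine ⟨Y, f, hY, fun M'' h'' g => h''.exists_desc f hf g, fun h hh => ?_⟩
  refine (hF Y (hM.trans hY) h).resolve_right ?_
  rintro ⟨Z, ρ, n, hρ, h1, h2⟩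
  refine hρ (isIso_of_finrank_le K (hM.trans hY) ρ ?_)
  rw [hn]
  refine Nat.sInf_le ⟨Z, f ≫ ρ.r, ⟨hY.of_retract ρ, fun g => ?_⟩, rfl⟩
  obtain ⟨l, rfl⟩ := hf g
  refine ⟨ρ.i ≫ l, ?_⟩
  have h3 : f ≫ ρ.r ≫ ρ.i = f := by
    conv_lhs => rw [← comp_iterateHom hh n, Category.assoc, h1]
    exact comp_iterateHom hh n
  simp only [Category.assoc]
  rw [← Category.assoc ρ.r, ← Category.assoc f, h3]

lemma exists_isMinRightApprox (hfin : ∀ Y : 𝒯, Module.Finite K (A ⟶ Y)) (hF : FittingProperty A)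
    {M : 𝒯} (hM : InAdd A M) (X : 𝒯) :
    ∃ (M' : 𝒯) (f : M' ⟶ X), IsMinRightApprox M f := by
  classical
  have := hM.finite K hfin X
  let S : Set ℕ := {n | ∃ (Y : 𝒯) (p : Y ⟶ X), (InAdd M Y ∧
    ∀ g : M ⟶ X, ∃ l : M ⟶ Y, l ≫ p = g) ∧ Module.finrank K (A ⟶ Y) = n}
  have hS : S.Nonempty := by
    obtain ⟨Y, p, h, h'⟩ := exists_right_approx K (A := M) X
    exact ⟨_, Y, p, ⟨h, h'⟩, rfl⟩
  obtain ⟨Y, f, ⟨hY, hf⟩, hn⟩ := Nat.sInf_mem hS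
  refine ⟨Y, f, hY, fun M'' h'' g => h''.exists_lift f hf g, fun h hh => ?_⟩
  refine (hF Y (hM.trans hY) h).resolve_right ?_
  rintro ⟨Z, ρ, n, hρ, h1, h2⟩
  refine hρ (isIso_of_finrank_le K (hM.trans hY) ρ ?_)
  rw [hn]
  refine Nat.sInf_le ⟨Z, ρ.i ≫ f, ⟨hY.of_retract ρ, fun g => ?_⟩, rfl⟩
  obtain ⟨l, rfl⟩ := hf g
  refine ⟨l ≫ ρ.r, ?_⟩
  have h3 : ρ.r ≫ ρ.i ≫ f = f := by
    conv_lhs => rw [← iterateHom_comp hh n]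
    rw [← Category.assoc ρ.i, ← Category.assoc, h2]
    exact iterateHom_comp hh n
  simp only [Category.assoc]
  rw [h3]

end Finite

/-! ### Transitivity of the silting order -/

section Order

variable {𝒯 : Type u} [Category.{v} 𝒯] [HasZeroObject 𝒯] [Preadditive 𝒯] [HasShift 𝒯 ℤ]
  [∀ n : ℤ, (shiftFunctor 𝒯 n).Additive] [Pretriangulated 𝒯] {A : 𝒯}

/-- Induction over the thick subcategory generated by an object. -/
lemma thick_induction (Q : ObjectProperty 𝒯) (hret : ∀ {X Y : 𝒯}, Retract X Y → Q Y → Q X)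
    (hshift : ∀ (X : 𝒯) (n : ℤ), Q X → Q (X⟦n⟧)) (hzero : ∀ X : 𝒯, IsZero X → Q X)
    (hext : ∀ T ∈ distTriang 𝒯, Q T.obj₁ → Q T.obj₃ → Q T.obj₂)
    (hA : Q A) {X : 𝒯} (hX : thick A X) : Q X :=
  hX Q
    { exists_zero := ⟨_, isZero_zero 𝒯, hzero _ (isZero_zero 𝒯)⟩
      isStableUnderShiftBy := fun n => ⟨fun X h => hshift X n h⟩
      ext₂' := fun T hT h1 h3 => ⟨T.obj₂, hext T hT h1 h3, ⟨Iso.refl _⟩⟩ }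
    ⟨fun h hY => hret h hY⟩ hA

/-- The objects `X` admitting a bound form a thick class containing `A`. The bound is uniform in
`Y`, so it survives when `Y` is replaced by successive cocones of approximations. -/
lemma IsSilting.exists_bound (hA : IsSilting A) (X : 𝒯) :
    ∃ n : ℕ, ∀ Y : 𝒯, Geq A Y → ∀ m : ℤ, (n : ℤ) ≤ m → HomZero X (Y⟦m⟧) := by
  refine thick_induction (A := A)
    (fun X => ∃ n : ℕ, ∀ Y : 𝒯, Geq A Y → ∀ m : ℤ, (n : ℤ) ≤ m → HomZero X (Y⟦m⟧))
    ?_ ?_ ?_ ?_ ?_ (hA.2 X)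
  · rintro X Y ρ ⟨n, H⟩
    exact ⟨n, fun Z hZ m hm => (H Z hZ m hm).of_retract ρ (.refl _)⟩
  · rintro X k ⟨n, H⟩
    refine ⟨n + k.natAbs, fun Z hZ m hm => ?_⟩
    exact (homZero_shift_left_iff k m (m - k) (by lia)).2 (H Z hZ _ (by lia))
  · exact fun X hX => ⟨0, fun Z hZ m hm f => hX.eq_of_src _ _⟩
  · rintro T hT ⟨n, H⟩ ⟨n', H'⟩
    exact ⟨n + n', fun Z hZ m hm => homZero_of_obj₂ hT (H Z hZ m (by lia)) (H' Z hZ m (by lia))⟩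
  · exact ⟨1, fun Y hY m hm => hY m (by lia)⟩

/-- The cocone of a right approximation. -/
lemma geq_of_right_approx (hA : Geq A A) {T : Triangle 𝒯} (hT : T ∈ distTriang 𝒯)
    (h₂ : InAdd A T.obj₂) (hp : ∀ g : A ⟶ T.obj₃, ∃ l : A ⟶ T.obj₂, l ≫ T.mor₂ = g)
    (h₃ : Geq A T.obj₃) : Geq A T.obj₁ := by
  intro i hi
  -- Only degree one uses the approximation: the connecting map out of `Hom(A, T.obj₃)` vanishes
  -- because everything there lifts to `T.obj₂`.
  by_cases h : i = 1
  · subst h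
    intro f
    obtain ⟨g, hg⟩ := Triangle.coyoneda_exact₁ _ hT f (h₂.geq_right hA 1 one_pos _)
    obtain ⟨l, rfl⟩ := hp g
    rw [hg, Category.assoc, comp_distTriang_mor_zero₂₃ _ hT, comp_zero]
  · exact homZero_obj₁ hT i (i - 1) (by lia) (h₂.geq_right hA i hi) (h₃ _ (by lia))

/-- Replacing `Y` by the cocone of an `add A`-approximation keeps it below `A` and moves the
vanishing to be proved one degree up. After finitely many steps the bound for `X` applies; the
induction counts down from that bound. -/
lemma IsSilting.geq_trans (hA : IsSilting A)
    (happ : ∀ X : 𝒯, ∃ (Y : 𝒯) (p : Y ⟶ X), InAdd A Y ∧ ∀ g : A ⟶ X, ∃ l : A ⟶ Y, l ≫ p = g)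
    {X Y : 𝒯} (hX : Geq X A) (hY : Geq A Y) : Geq X Y := by
  obtain ⟨N, hN⟩ := hA.exists_bound X
  have key : ∀ n : ℕ, n ≤ N → ∀ Y : 𝒯, Geq A Y →
      ∀ m : ℤ, ((N - n : ℕ) : ℤ) ≤ m → 0 < m → HomZero X (Y⟦m⟧) := by
    intro n
    induction n with
    | zero => exact fun _ Y hY m hm _ => hN Y hY m (by simpa using hm)
    | succ n ih =>
      intro hn Y hY m hm hm'
      obtain ⟨Y₀, p, hY₀, hp⟩ := happ Y
      obtain ⟨Y₁, f, h, hT⟩ := distinguished_cocone_triangle₁ p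
      have hY₁ : Geq A Y₁ := geq_of_right_approx hA.1 hT hY₀ hp hY
      exact homZero_obj₃ hT m (m + 1) rfl (hY₀.geq_right hX m hm')
        (ih (by lia) Y₁ hY₁ (m + 1) (by lia) (by lia))
  exact fun i hi => key N le_rfl Y hY i (by simpa using hi.le) hi

/-- The cocone `Y₁` of an `add A`-approximation of `X` satisfies `A ≥ Y₁`, hence `X ≥ Y₁` by
transitivity. The connecting map `X ⟶ Y₁[1]` is then zero and the approximation splits. -/
lemma IsSilting.inAdd_of_geq (hA : IsSilting A)
    (happ : ∀ X : 𝒯, ∃ (Y : 𝒯) (p : Y ⟶ X), InAdd A Y ∧ ∀ g : A ⟶ X, ∃ l : A ⟶ Y, l ≫ p = g)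
    {X : 𝒯} (hX : Geq X A) (hX' : Geq A X) : InAdd A X := by
  obtain ⟨Y₀, p, hY₀, hp⟩ := happ X
  obtain ⟨Y₁, f, h, hT⟩ := distinguished_cocone_triangle₁ p
  have hY₁ : Geq A Y₁ := geq_of_right_approx hA.1 hT hY₀ hp hX'
  have h0 : h = 0 := hA.geq_trans happ hX hY₁ 1 one_pos h
  obtain ⟨s, hs⟩ := Triangle.coyoneda_exact₃ _ hT (𝟙 X)
    (by subst h0; exact comp_zero)
  exact hY₀.of_retract ⟨s, p, hs.symm⟩

end Order

end Silting

namespace Silting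

/-! ### Objects with local endomorphism ring -/

section Local

variable {𝒯 : Type u} [Category.{v} 𝒯] [Preadditive 𝒯]

/-- The endomorphism ring of `P` is local. -/
def IsLocalObj (P : 𝒯) : Prop :=
  ¬ IsZero P ∧ ∀ f : P ⟶ P, IsIso f ∨ IsIso (𝟙 P - f)

omit [Preadditive 𝒯] in
lemma nonempty_retract_of_isIso {P X : 𝒯} (i : P ⟶ X) (r : X ⟶ P) (h : IsIso (i ≫ r)) :
    Nonempty (Retract P X) :=
  ⟨⟨i, r ≫ inv (i ≫ r), by rw [← Category.assoc, IsIso.hom_inv_id]⟩⟩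

variable {P : 𝒯}

lemma IsLocalObj.isIso_or (hP : IsLocalObj P) {f g : P ⟶ P} (h : IsIso (f + g)) :
    IsIso f ∨ IsIso g := by
  have h1 : f ≫ inv (f + g) + g ≫ inv (f + g) = 𝟙 P := by
    rw [← Preadditive.add_comp, IsIso.hom_inv_id]
  rcases hP.2 (f ≫ inv (f + g)) with h2 | h2
  · exact .inl (IsIso.of_isIso_comp_right f (inv (f + g)))
  · rw [← h1, add_sub_cancel_left] at h2
    exact .inr (IsIso.of_isIso_comp_right g (inv (f + g)))

lemma IsLocalObj.isIso_or_of_add_eq (hP : IsLocalObj P) {f g : P ⟶ P} (h : f + g = 𝟙 P) :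
    IsIso f ∨ IsIso g :=
  hP.isIso_or (by rw [h]; infer_instance)

lemma isZero_of_isIso_zero (h : IsIso (0 : P ⟶ P)) : IsZero P :=
  (IsZero.iff_id_eq_zero P).2 (by rw [← IsIso.hom_inv_id (0 : P ⟶ P), zero_comp])

lemma IsLocalObj.exists_isIso (hP : IsLocalObj P) {ι : Type*} (s : Finset ι) (f : ι → (P ⟶ P))
    (h : IsIso (∑ k ∈ s, f k)) : ∃ k, IsIso (f k) := by
  classical
  induction s using Finset.induction_on with
  | empty => exact (hP.1 (isZero_of_isIso_zero (by simpa using h))).elim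
  | insert a s ha ih =>
    rw [Finset.sum_insert ha] at h
    exact (hP.isIso_or h).elim (fun h => ⟨a, h⟩) ih

/-- This is the principle that `1 - ab` is invertible when `1 - ba` is. The endomorphism `b ≫ inv u
≫ a` of `P` cannot be invertible, as `P` is not a summand of `X`, so locality inverts its complement
`𝟙 - c`. -/
lemma IsLocalObj.isIso_sub (hP : IsLocalObj P) {X : 𝒯} (hX : ¬ Nonempty (Retract P X))
    (u : X ⟶ X) [IsIso u] (a : X ⟶ P) (b : P ⟶ X) : IsIso (u - a ≫ b) := by
  have h1 : ¬ IsIso (b ≫ inv u ≫ a) := fun h => hX (nonempty_retract_of_isIso _ _ h)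
  have h2 := (hP.2 _).resolve_left h1
  set c := b ≫ inv u ≫ a with hc
  set w := inv (𝟙 P - c) with hw
  have e1 : w - c ≫ w = 𝟙 P := by
    rw [← IsIso.hom_inv_id (𝟙 P - c), Preadditive.sub_comp, Category.id_comp]
  have e2 : w - w ≫ c = 𝟙 P := by
    rw [← IsIso.inv_hom_id (𝟙 P - c), Preadditive.comp_sub, Category.comp_id]
  have h3 : IsIso (𝟙 X - (inv u ≫ a) ≫ b) := by
    refine ⟨𝟙 X + (inv u ≫ a) ≫ w ≫ b, ?_, ?_⟩
    · have : (inv u ≫ a) ≫ w ≫ b - (inv u ≫ a) ≫ b - (inv u ≫ a) ≫ (c ≫ w) ≫ b = 0 := by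
        have h := congr_arg (fun t => (inv u ≫ a) ≫ t ≫ b) e1
        simp only [Preadditive.sub_comp, Preadditive.comp_sub, Category.id_comp] at h ⊢
        rw [← h]
        abel
      simp only [Preadditive.sub_comp, Preadditive.comp_add, Category.assoc, Category.id_comp,
        Category.comp_id, hc] at this ⊢
      rw [← sub_eq_zero, ← this]
      abel
    · have : (inv u ≫ a) ≫ w ≫ b - (inv u ≫ a) ≫ b - (inv u ≫ a) ≫ (w ≫ c) ≫ b = 0 := by
        have h := congr_arg (fun t => (inv u ≫ a) ≫ t ≫ b) e2
        simp only [Preadditive.sub_comp, Preadditive.comp_sub, Category.id_comp] at h ⊢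
        rw [← h]
        abel
      simp only [Preadditive.comp_sub, Preadditive.add_comp, Category.assoc, Category.id_comp,
        Category.comp_id, hc] at this ⊢
      rw [← sub_eq_zero, ← this]
      abel
  have h4 : u - a ≫ b = u ≫ (𝟙 X - (inv u ≫ a) ≫ b) := by simp
  rw [h4]
  infer_instance

end Local

/-! ### Summands avoiding `P`, and mutation as a factorization condition -/

section Complement

variable {𝒯 : Type u} [Category.{v} 𝒯] [HasZeroObject 𝒯] [Preadditive 𝒯] [HasShift 𝒯 ℤ]
  [∀ n : ℤ, (shiftFunctor 𝒯 n).Additive] [Pretriangulated 𝒯] {A P : 𝒯}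

omit [HasZeroObject 𝒯] [Pretriangulated 𝒯] in
lemma IsLocalObj.shift (hP : IsLocalObj P) (n : ℤ) : IsLocalObj (P⟦n⟧) := by
  refine ⟨fun h => hP.1 ?_, fun f => ?_⟩
  · rw [IsZero.iff_id_eq_zero] at h ⊢
    exact (shiftFunctor 𝒯 n).map_injective (by simpa using h)
  · obtain ⟨g, rfl⟩ := (shiftFunctor 𝒯 n).map_surjective f
    rcases hP.2 g with h | h
    · exact .inl inferInstance
    · refine .inr ?_
      rw [← (shiftFunctor 𝒯 n).map_id, ← Functor.map_sub]
      infer_instance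

/-- The identity of `P` is a sum of maps factoring through `N`; by locality one of the terms is
invertible. -/
lemma IsLocalObj.retract_of_inAdd (hP : IsLocalObj P) {N X : 𝒯} (hX : InAdd N X)
    (ρ : Retract P X) : Nonempty (Retract P N) := by
  obtain ⟨n, i, r, hir⟩ := hX.exists_sum
  have : IsIso (∑ k, (ρ.i ≫ i k) ≫ (r k ≫ ρ.r)) := by
    have h : ∑ k, (ρ.i ≫ i k) ≫ (r k ≫ ρ.r) = ρ.i ≫ (∑ k, i k ≫ r k) ≫ ρ.r := by
      rw [Preadditive.sum_comp, Preadditive.comp_sum]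
      simp
    rw [h, hir, Category.id_comp, ρ.retract]
    infer_instance
  obtain ⟨k, hk⟩ := hP.exists_isIso _ _ this
  exact nonempty_retract_of_isIso _ _ hk

omit [HasZeroObject 𝒯] [HasShift 𝒯 ℤ]
  [∀ n : ℤ, (shiftFunctor 𝒯 n).Additive] [Pretriangulated 𝒯] in
lemma IsLocalObj.retract_of_comp (hP : IsLocalObj P) {X Y : 𝒯} {i : P ⟶ X} {r : X ⟶ P}
    (hir : i ≫ r = 𝟙 P) (g : P ⟶ Y) (h : Y ⟶ X) (hc : ¬ IsIso ((i - g ≫ h) ≫ r)) :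
    Nonempty (Retract P Y) := by
  have : IsIso ((i - g ≫ h) ≫ r + g ≫ h ≫ r) := by
    rw [Preadditive.sub_comp, hir, Category.assoc, sub_add_cancel]
    infer_instance
  exact nonempty_retract_of_isIso _ _ ((hP.isIso_or this).resolve_left hc)

/-- Cancellation without Krull-Schmidt: the components of `𝟙 X` passing through `P` are subtracted
one at a time. Each difference stays invertible by `IsLocalObj.isIso_sub`, and what remains at the
end factors through copies of `M`. -/
lemma IsLocalObj.inAdd_of_not_retract (hP : IsLocalObj P) {B M X : 𝒯} (e : B ≅ P ⊞ M)
    (hX : InAdd B X) (h : ¬ Nonempty (Retract P X)) : InAdd M X := by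
  classical
  obtain ⟨n, i, r, hir⟩ := hX.exists_sum
  have key : ∀ s : Finset (Fin n), IsIso (𝟙 X - ∑ k ∈ s,
      (i k ≫ e.hom ≫ biprod.fst) ≫ biprod.inl ≫ e.inv ≫ r k) := by
    intro s
    induction s using Finset.induction_on with
    | empty =>
      rw [Finset.sum_empty, sub_zero]
      infer_instance
    | insert a s ha ih =>
      rw [Finset.sum_insert ha, add_comm, ← sub_sub]
      exact hP.isIso_sub h _ _ _
  have h1 := key Finset.univ
  have h2 : 𝟙 X - ∑ k, (i k ≫ e.hom ≫ biprod.fst) ≫ biprod.inl ≫ e.inv ≫ r k =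
      ∑ k, (i k ≫ e.hom ≫ biprod.snd) ≫ biprod.inr ≫ e.inv ≫ r k := by
    rw [← hir, sub_eq_iff_eq_add, ← Finset.sum_add_distrib]
    refine Finset.sum_congr rfl fun k _ => ?_
    have : i k ≫ r k = i k ≫ e.hom ≫ (biprod.fst ≫ biprod.inl + biprod.snd ≫ biprod.inr) ≫
      e.inv ≫ r k := by simp
    rw [this]
    simp only [Preadditive.add_comp, Preadditive.comp_add, Category.assoc]
    abel
  rw [h2] at h1
  refine inAdd_of_sum (fun k => inv (∑ k, (i k ≫ e.hom ≫ biprod.snd) ≫ biprod.inr ≫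
    e.inv ≫ r k) ≫ (i k ≫ e.hom ≫ biprod.snd)) (fun k => biprod.inr ≫ e.inv ≫ r k) ?_
  simp only [Category.assoc, ← Preadditive.comp_sum]
  simp

/-- `X` lies in `add A` and has no direct summand `P`. -/
def InAddAway (A P X : 𝒯) : Prop :=
  InAdd A X ∧ ¬ Nonempty (Retract P X)

lemma isBasicVersion_iff {A B : 𝒯} : IsBasicVersion B A ↔ IsBasic B ∧ InAdd A B ∧ InAdd B A :=
  ⟨fun h => ⟨h.1, (h.2 B).1 (inAdd_self B), (h.2 A).2 (inAdd_self A)⟩,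
    fun h => ⟨h.1, fun _ => ⟨h.2.1.trans, h.2.2.trans⟩⟩⟩

lemma IsBasic.of_iso {B B' : 𝒯} (h : IsBasic B) (e : B ≅ B') : IsBasic B' :=
  fun X Z ⟨e'⟩ => h X Z ⟨e ≪≫ e'⟩

lemma IsBasic.of_shift {B : 𝒯} {n : ℤ} (h : IsBasic (B⟦n⟧)) : IsBasic B := by
  have : PreservesBinaryBiproducts (shiftFunctor 𝒯 n) := preservesBinaryBiproducts_of_preservesBiproducts _
  rintro X Z ⟨e⟩
  have h0 := h (X⟦n⟧) (Z⟦n⟧) ⟨(shiftFunctor 𝒯 n).mapIso e ≪≫ (shiftFunctor 𝒯 n).mapBiprod _ _ ≪≫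
    biprod.mapIso ((shiftFunctor 𝒯 n).mapBiprod _ _) (Iso.refl _)⟩
  rw [IsZero.iff_id_eq_zero] at h0 ⊢
  exact (shiftFunctor 𝒯 n).map_injective (by simpa using h0)

lemma IsBasic.shift {B : 𝒯} (h : IsBasic B) (n : ℤ) : IsBasic (B⟦n⟧) :=
  IsBasic.of_shift (n := -n)
    (h.of_iso ((shiftFunctorCompIsoId 𝒯 n (-n) (by lia)).symm.app B))

lemma IsBasicVersion.shift {A B : 𝒯} (h : IsBasicVersion B A) (n : ℤ) :
    IsBasicVersion (B⟦n⟧) (A⟦n⟧) := by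
  rw [isBasicVersion_iff] at h ⊢
  exact ⟨h.1.shift n, h.2.1.map (shiftFunctor 𝒯 n), h.2.2.map (shiftFunctor 𝒯 n)⟩

/-- This makes `add M` independent of the basic version and of the complement of `P` in it.
Basicness enters in the converse: a summand `P` of `M` would occur twice in `B`. -/
lemma IsLocalObj.inAddAway_iff (hP : IsLocalObj P) {B M X : 𝒯} (hB : IsBasicVersion B A)
    (e : B ≅ P ⊞ M) : InAddAway A P X ↔ InAdd M X := by
  refine ⟨fun h => hP.inAdd_of_not_retract e ((hB.2 X).2 h.1) h.2, fun h => ⟨?_, ?_⟩⟩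
  · have hM : InAdd B M := inAdd_of_retract ⟨biprod.inr ≫ e.inv, e.hom ≫ biprod.snd, by simp⟩
    exact (hB.2 X).1 (hM.trans h)
  · rintro ⟨ρ⟩
    obtain ⟨σ⟩ := hP.retract_of_inAdd h ρ
    obtain ⟨Z, e', -⟩ := exists_biprod_of_retract σ
    exact hP.1 (hB.1 P Z ⟨e ≪≫ biprod.mapIso (Iso.refl P) e' ≪≫ (biprod.associator _ _ _).symm⟩)

lemma IsLocalObj.exists_complement (hP : IsLocalObj P) {B : 𝒯} (hB : IsBasicVersion B A)
    (hPA : InAdd A P) : ∃ M : 𝒯, Nonempty (B ≅ P ⊞ M) := by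
  obtain ⟨ρ⟩ := hP.retract_of_inAdd ((hB.2 P).2 hPA) (.refl P)
  obtain ⟨Z, e, -⟩ := exists_biprod_of_retract ρ
  exact ⟨Z, ⟨e⟩⟩

/-- All morphisms from `P` to `T` factor through objects of `add A` without summand `P`. -/
def FactorsFrom (A P T : 𝒯) : Prop :=
  ∀ f : P ⟶ T, ∃ (X : 𝒯) (g : P ⟶ X) (h : X ⟶ T), InAddAway A P X ∧ g ≫ h = f

/-- All morphisms from `T` to `P` factor through objects of `add A` without summand `P`. -/
def FactorsTo (A P T : 𝒯) : Prop :=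
  ∀ f : T ⟶ P, ∃ (X : 𝒯) (g : T ⟶ X) (h : X ⟶ P), InAddAway A P X ∧ g ≫ h = f

/-- In degrees at least two the long exact sequence kills `Hom(Y, T[i])`. In degree one it is the
cokernel of `Hom(M', T) ⟶ Hom(P, T)`, so the order relation says that maps `P ⟶ T` factor through
the approximation. -/
lemma IsLeftMutation.geq_iff (hP : IsLocalObj P) {B U T : 𝒯} (hB : IsBasicVersion B A)
    (hU : IsLeftMutation P B U) (hT : Geq A T) : Geq U T ↔ FactorsFrom A P T := by
  obtain ⟨M, M', Y, f, g, h, ⟨e⟩, ⟨hM', hf, -⟩, hD, ⟨e'⟩⟩ := hU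
  have hM : InAdd A M := (hB.2 M).1 (inAdd_of_retract
    ⟨biprod.inr ≫ e.inv, e.hom ≫ biprod.snd, by simp⟩)
  have hPT : Geq P T := ((hB.2 P).1 (inAdd_of_retract
    ⟨biprod.inl ≫ e.inv, e.hom ≫ biprod.fst, by simp⟩)).geq_left hT
  have hMT : Geq M T := hM.geq_left hT
  have hMT' : Geq M' T := hM'.geq_left hMT
  have h1 : Geq U T ↔ Geq Y T := by
    constructor
    · exact fun H => (geq_biprod_left_iff.1 (H.of_iso e' (Iso.refl _))).1
    · exact fun H => (geq_biprod_left_iff.2 ⟨H, hMT⟩).of_iso e'.symm (Iso.refl _)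
  rw [h1]
  constructor
  · intro H w
    have h2 : h ≫ w⟦(1 : ℤ)⟧' = 0 := H 1 one_pos _
    obtain ⟨l, hl⟩ := dist_desc₁ hD w h2
    exact ⟨M', f, l, (hP.inAddAway_iff hB e).2 hM', hl⟩
  · intro H i hi
    by_cases h1 : i = 1
    · subst h1
      intro y
      obtain ⟨z, rfl⟩ := dist_desc₃ hD y (hMT' 1 one_pos _)
      obtain ⟨w, rfl⟩ := (shiftFunctor 𝒯 (1 : ℤ)).map_surjective z
      obtain ⟨X, a, b, hX, rfl⟩ := H w
      obtain ⟨c, rfl⟩ := hf X ((hP.inAddAway_iff hB e).1 hX) a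
      rw [Functor.map_comp, Functor.map_comp, ← Category.assoc, ← Category.assoc,
        dist_comp₃₁ hD, zero_comp, zero_comp]
    · exact homZero_of_obj₃ hD i (i - 1) (by lia) (hMT' i hi) (hPT _ (by lia))

lemma IsRightMutation.geq_iff (hP : IsLocalObj P) {B U T : 𝒯} (hB : IsBasicVersion B A)
    (hU : IsRightMutation P B U) (hT : Geq T A) : Geq T U ↔ FactorsTo A P T := by
  obtain ⟨M, M', Y, g, f, h, ⟨e⟩, ⟨hM', hf, -⟩, hD, ⟨e'⟩⟩ := hU
  have hM : InAdd A M := (hB.2 M).1 (inAdd_of_retract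
    ⟨biprod.inr ≫ e.inv, e.hom ≫ biprod.snd, by simp⟩)
  have hPT : Geq T P := ((hB.2 P).1 (inAdd_of_retract
    ⟨biprod.inl ≫ e.inv, e.hom ≫ biprod.fst, by simp⟩)).geq_right hT
  have hMT : Geq T M := hM.geq_right hT
  have hMT' : Geq T M' := hM'.geq_right hMT
  have h1 : Geq T U ↔ Geq T Y := by
    constructor
    · exact fun H => (geq_biprod_right_iff.1 (H.of_iso (Iso.refl _) e')).1
    · exact fun H => (geq_biprod_right_iff.2 ⟨H, hMT⟩).of_iso (Iso.refl _) e'.symm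
  rw [h1]
  constructor
  · intro H w
    obtain ⟨l, hl⟩ := dist_lift₃ hD w (H 1 one_pos _)
    exact ⟨M', l, f, (hP.inAddAway_iff hB e).2 hM', hl⟩
  · intro H i hi
    by_cases h1 : i = 1
    · subst h1
      intro y
      obtain ⟨z, rfl⟩ := dist_lift₁ hD y (hMT' 1 one_pos _)
      obtain ⟨X, a, b, hX, rfl⟩ := H z
      obtain ⟨c, rfl⟩ := hf X ((hP.inAddAway_iff hB e).1 hX) b
      rw [Category.assoc, Category.assoc, dist_comp₂₃ hD, comp_zero, comp_zero]
    · exact homZero_obj₁ hD i (i - 1) (by lia) (hMT' i hi) (hPT _ (by lia))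

end Complement

end Silting

/-! ### Two-term presentations and the dichotomy -/

namespace Silting

section TwoTerm

variable {𝒯 : Type u} [Category.{v} 𝒯] [HasZeroObject 𝒯] [Preadditive 𝒯] [HasShift 𝒯 ℤ]
  [∀ n : ℤ, (shiftFunctor 𝒯 n).Additive] [Pretriangulated 𝒯]
  (K : Type w) [Field K] [Linear K 𝒯] {A P T : 𝒯}

/-- The presentation of a two-term object by a right approximation, without direct summands
`P = P` in the differential. -/
lemma exists_twoTerm (hfin : ∀ Y : 𝒯, Module.Finite K (A ⟶ Y)) (hA : IsSilting A)
    (hP : ¬ IsZero P) (hT : Geq A T) (hT' : Geq T (A⟦(1 : ℤ)⟧)) :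
    ∃ (T₁ T₀ : 𝒯) (d : T₁ ⟶ T₀) (p : T₀ ⟶ T) (δ : T ⟶ T₁⟦(1 : ℤ)⟧),
      Triangle.mk d p δ ∈ distTriang 𝒯 ∧ InAdd A T₁ ∧ InAdd A T₀ ∧
      (∀ g : A ⟶ T, ∃ l : A ⟶ T₀, l ≫ p = g) ∧
      ∀ (α : P ⟶ T₁) (π : T₀ ⟶ P), ¬ IsIso (α ≫ d ≫ π) := by
  classical
  let S : Set ℕ := {n | ∃ (Y : 𝒯) (p : Y ⟶ T), (InAdd A Y ∧
    ∀ g : A ⟶ T, ∃ l : A ⟶ Y, l ≫ p = g) ∧ Module.finrank K (A ⟶ Y) = n}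
  have hS : S.Nonempty := by
    obtain ⟨Y, p, h, h'⟩ := exists_right_approx K (A := A) T
    exact ⟨_, Y, p, ⟨h, h'⟩, rfl⟩
  obtain ⟨T₀, p, ⟨hT₀, hp⟩, hn⟩ := Nat.sInf_mem hS
  obtain ⟨T₁, d, δ, hD⟩ := distinguished_cocone_triangle₁ p
  -- `T₁` lies in `add A` because `T₁ ≥ A`, from the long exact sequence and `T ≥ A[1]`, and `A ≥
  -- T₁`, as a cocone of an approximation.
  refine ⟨T₁, T₀, d, p, δ, hD, hA.inAdd_of_geq (fun X => exists_right_approx K X) ?_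
    (geq_of_right_approx hA.1 hD hT₀ hp hT), hT₀, hp, fun α π hi => ?_⟩
  · intro i hi
    exact homZero_of_obj₁ hD i (i + 1) rfl (hT₀.geq_left hA.1 i hi)
      ((geq_shift_right_iff 1).1 hT' _ (by lia))
  · obtain ⟨Z, e, he⟩ := exists_biprod_of_retract
      (⟨α ≫ d, π ≫ inv (α ≫ d ≫ π), by
        rw [← Category.assoc, Category.assoc α, IsIso.hom_inv_id]⟩ : Retract P T₀)
    let ρ : Retract Z T₀ := ⟨biprod.inr ≫ e.inv, e.hom ≫ biprod.snd, by simp⟩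
    -- The copy of `P` in `T₀` is the image of `α ≫ d` and is killed by `p`. Hence its complement
    -- already approximates `T`, against the minimal choice of `T₀`.
    have h1 : p = ρ.r ≫ ρ.i ≫ p := by
      rw [← cancel_epi e.inv]
      apply biprod.hom_ext'
      · have : (α ≫ d) ≫ p = 0 := by rw [Category.assoc, dist_comp₁₂ hD, comp_zero]
        have h2 : biprod.inl ≫ e.inv = α ≫ d := by
          rw [Iso.comp_inv_eq, he]
        rw [← Category.assoc, h2, this]
        simp [ρ]
      · simp [ρ]
    have hρ := isIso_of_finrank_le K hT₀ ρ (by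
      rw [hn]
      refine Nat.sInf_le ⟨Z, ρ.i ≫ p, ⟨hT₀.of_retract ρ, fun g => ?_⟩, rfl⟩
      obtain ⟨l, rfl⟩ := hp g
      exact ⟨l ≫ ρ.r, by rw [Category.assoc, ← h1]⟩)
    have h3 : α ≫ d = 0 := by
      rw [← cancel_mono ρ.r]
      simp only [ρ, ← Category.assoc] at he ⊢
      rw [he]
      simp
    rw [← Category.assoc, h3, zero_comp] at hi
    exact hP (isZero_of_isIso_zero hi)

lemma dist_rot {X Y Z : 𝒯} {f : X ⟶ Y} {g : Y ⟶ Z} {h : Z ⟶ X⟦(1 : ℤ)⟧}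
    (hT : Triangle.mk f g h ∈ distTriang 𝒯) : Triangle.mk g h (-f⟦(1 : ℤ)⟧') ∈ distTriang 𝒯 :=
  rot_of_distTriang _ hT

lemma inAddAway_shift (n : ℤ) {X : 𝒯} (hX : InAddAway A P X) :
    InAddAway (A⟦n⟧) (P⟦n⟧) (X⟦n⟧) := by
  refine ⟨hX.1.map (shiftFunctor 𝒯 n), fun ⟨ρ⟩ => hX.2 ?_⟩
  obtain ⟨i, hi⟩ := (shiftFunctor 𝒯 n).map_surjective ρ.i
  obtain ⟨r, hr⟩ := (shiftFunctor 𝒯 n).map_surjective ρ.r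
  exact ⟨⟨i, r, (shiftFunctor 𝒯 n).map_injective (by simp [hi, hr])⟩⟩

/-- Maps `P ⟶ T` lift to `T₀`, and maps `T ⟶ P[1]` vanish on `T₀` and so factor through `T₁[1]`. It
is therefore enough that `P` is not a summand of both terms. -/
lemma factorsFrom_or_factorsTo (hfin : ∀ Y : 𝒯, Module.Finite K (A ⟶ Y)) (hA : IsSilting A)
    (hP : IsLocalObj P) (hPA : InAdd A P) (hT : Geq A T) (hT' : Geq T (A⟦(1 : ℤ)⟧))
    (hTT : Geq T T) :
    FactorsFrom A P T ∨ FactorsTo (A⟦(1 : ℤ)⟧) (P⟦(1 : ℤ)⟧) T := by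
  obtain ⟨T₁, T₀, d, p, δ, hD, h₁, h₀, hp, hd⟩ := exists_twoTerm K hfin hA hP.1 hT hT'
  by_cases hr₀ : Nonempty (Retract P T₀)
  · by_cases hr₁ : Nonempty (Retract P T₁)
    · exfalso
      obtain ⟨ρ₀⟩ := hr₀
      obtain ⟨ρ₁⟩ := hr₁
      -- The map `T₁ ⟶ P ⟶ T₀` induces an element of `Hom(T, T[1])`, which vanishes. The next lines
      -- convert this into a homotopy: the map equals `d ≫ t - s ≫ d`.
      obtain ⟨s', hs'⟩ := dist_lift₁ (dist_rot hD) (δ ≫ (ρ₁.r ≫ ρ₀.i)⟦(1 : ℤ)⟧')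
        (hTT 1 one_pos _)
      obtain ⟨s, rfl⟩ := dist_desc₃ hD s' ((h₁.geq_right (h₀.geq_left hA.1)) 1 one_pos _)
      obtain ⟨s, rfl⟩ := (shiftFunctor 𝒯 (1 : ℤ)).map_surjective s
      obtain ⟨t, ht⟩ := dist_desc₁ hD (ρ₁.r ≫ ρ₀.i + s ≫ d) (by
        rw [Functor.map_add, Preadditive.comp_add, ← hs']
        simp)
      -- Restricted to `P`, the homotopy writes the identity as a sum of two components of `d`,
      -- neither of which is invertible.
      have h1 : ρ₁.i ≫ d ≫ (t ≫ ρ₀.r) + (-ρ₁.i ≫ s) ≫ d ≫ ρ₀.r = 𝟙 P := by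
        have h2 : ρ₁.i ≫ (d ≫ t) ≫ ρ₀.r = 𝟙 P + ρ₁.i ≫ (s ≫ d) ≫ ρ₀.r := by
          rw [ht]
          simp
        simp only [Category.assoc, Preadditive.neg_comp] at h2 ⊢
        rw [h2]
        abel
      rcases hP.isIso_or_of_add_eq h1 with h | h
      · exact hd _ _ h
      · exact hd _ _ h
    · right
      intro f
      obtain ⟨l, rfl⟩ := dist_desc₃ hD f ((hPA.geq_right (h₀.geq_left hA.1)) 1 one_pos _)
      exact ⟨_, δ, l, inAddAway_shift 1 ⟨h₁, hr₁⟩, rfl⟩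
  · left
    intro f
    obtain ⟨l, rfl⟩ := hPA.exists_lift p hp f
    exact ⟨T₀, l, p, ⟨h₀, hr₀⟩, rfl⟩

lemma InAdd.thick {M X : 𝒯} (h : InAdd M X) (Q : ObjectProperty 𝒯) [Q.IsTriangulated]
    [Q.IsStableUnderRetracts] (hM : Q M) : Q X := by
  obtain ⟨n, ⟨ρ⟩⟩ := h
  refine Q.prop_of_retract ρ ?_
  exact (Q.prop_of_iso (biproduct.isoProduct _).symm (Q.prop_product fun _ => hM))

/-- If both factorizations held, `P` would be a summand of neither term, so a complement `M` of `P`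
would generate `T` and hence everything. A silting object has no room for the extra summand `P`. -/
lemma not_factorsFrom_and_factorsTo (hfin : ∀ Y : 𝒯, Module.Finite K (A ⟶ Y)) (hA : IsSilting A)
    (hP : IsLocalObj P) (hPA : InAdd A P) (hT : Geq A T) (hT' : Geq T (A⟦(1 : ℤ)⟧))
    (hTT : IsSilting T) (h : FactorsFrom A P T) :
    ¬ FactorsTo (A⟦(1 : ℤ)⟧) (P⟦(1 : ℤ)⟧) T := by
  intro h'
  obtain ⟨T₁, T₀, d, p, δ, hD, h₁, h₀, hp, hd⟩ := exists_twoTerm K hfin hA hP.1 hT hT'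
  have hr₀ : ¬ Nonempty (Retract P T₀) := by
    rintro ⟨ρ⟩
    obtain ⟨X, g, k, hX, hgk⟩ := h (ρ.i ≫ p)
    obtain ⟨s, rfl⟩ := hX.1.exists_lift p hp k
    -- The inclusion of `P` and the map through `X` agree after `p`, so they differ by a map through
    -- `d`. That difference has no invertible component on `P`, and locality makes `P` a summand of
    -- `X`.
    obtain ⟨t, ht⟩ := dist_lift₂ hD (ρ.i - g ≫ s) (by
      rw [Preadditive.sub_comp, ← hgk, Category.assoc, sub_self])
    refine hX.2 (hP.retract_of_comp ρ.retract g s ?_)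
    rw [← ht, Category.assoc]
    exact hd _ _
  have hr₁ : ¬ Nonempty (Retract P T₁) := by
    rintro ⟨ρ⟩
    obtain ⟨X, g, k, hX, hgk⟩ := h' (δ ≫ ρ.r⟦(1 : ℤ)⟧')
    obtain ⟨g, rfl⟩ := dist_desc₃ hD g
      (hX.1.homZero_right (h₀.geq_left hA.1 1 one_pos) _)
    obtain ⟨q, hq⟩ := (shiftFunctor 𝒯 (1 : ℤ)).map_surjective (g ≫ k)
    obtain ⟨t, ht⟩ := dist_desc₁ hD (ρ.r - q) (by
      rw [Functor.map_sub, Preadditive.comp_sub, ← hgk, hq, Category.assoc, sub_self])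
    -- The first term is a component of `d`, so the second is invertible; its shift factors through
    -- `X`, which has no summand `P[1]`.
    have h1 : ρ.i ≫ d ≫ t + ρ.i ≫ q = 𝟙 P := by
      rw [ht, Preadditive.comp_sub, ρ.retract, sub_add_cancel]
    have h2 := (hP.isIso_or_of_add_eq h1).resolve_left (hd _ _)
    refine hX.2 (nonempty_retract_of_isIso (ρ.i⟦(1 : ℤ)⟧' ≫ g) k ?_)
    rw [Category.assoc, ← hq, ← Functor.map_comp]
    infer_instance
  obtain ⟨B, hB⟩ := exists_isBasicVersion K hfin
  obtain ⟨M, ⟨e⟩⟩ := hP.exists_complement hB hPA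
  have h₀' := (hP.inAddAway_iff hB e).1 ⟨h₀, hr₀⟩
  have h₁' := (hP.inAddAway_iff hB e).1 ⟨h₁, hr₁⟩
  have hM : InAdd A M := ((hP.inAddAway_iff hB e).2 (inAdd_self M)).1
  have hMs : IsSilting M := by
    refine ⟨hM.geq_left (hM.geq_right hA.1), fun X Q hQ hQ' hQM => ?_⟩
    exact hTT.2 X Q hQ hQ'
      (Q.ext_of_isTriangulatedClosed₃ _ hD (h₁'.thick Q hQM) (h₀'.thick Q hQM))
  have hPM : InAdd M P := by
    have := hM.finite K hfin
    exact hMs.inAdd_of_geq (fun X => exists_right_approx K X)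
      (hPA.geq_left (hM.geq_right hA.1)) (hM.geq_left (hPA.geq_right hA.1))
  exact ((hP.inAddAway_iff hB e).2 hPM).2 ⟨.refl P⟩

end TwoTerm

end Silting

/-! ### Dualities of a triangulated category -/

namespace Silting

open Opposite

section Duality

variable {𝒯 : Type u} [Category.{v} 𝒯] [HasZeroObject 𝒯] [Preadditive 𝒯] [HasShift 𝒯 ℤ]
  [∀ n : ℤ, (shiftFunctor 𝒯 n).Additive] [Pretriangulated 𝒯]

lemma thick_induction_cone {A : 𝒯} (Q : ObjectProperty 𝒯)
    (hret : ∀ {X Y : 𝒯}, Retract X Y → Q Y → Q X)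
    (hshift : ∀ (X : 𝒯) (n : ℤ), Q X → Q (X⟦n⟧)) (hzero : ∀ X : 𝒯, IsZero X → Q X)
    (hcone : ∀ {X Y Z : 𝒯} {f : X ⟶ Y} {g : Y ⟶ Z} {h : Z ⟶ X⟦(1 : ℤ)⟧},
      Triangle.mk f g h ∈ distTriang 𝒯 → Q X → Q Y → Q Z)
    (hA : Q A) {X : 𝒯} (hX : thick A X) : Q X :=
  thick_induction Q hret hshift hzero
    (fun T hT h₁ h₃ => hcone (inv_rot_of_distTriang T hT) (hshift _ (-1) h₃) h₁) hA hX

/-- A contravariant autoequivalence compatible with shifts and triangles. -/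
structure IsDuality (D : 𝒯ᵒᵖ ⥤ 𝒯) : Prop where
  full : D.Full
  faithful : D.Faithful
  essSurj : D.EssSurj
  additive : D.Additive
  shift (X : 𝒯) (n : ℤ) : Nonempty (D.obj (op (X⟦n⟧)) ≅ (D.obj (op X))⟦-n⟧)
  triangle {X Y : 𝒯} (g : X ⟶ Y) : ∃ (Z : 𝒯) (a : Y ⟶ Z) (b : Z ⟶ X⟦(1 : ℤ)⟧)
    (c : D.obj (op X) ⟶ (D.obj (op Z))⟦(1 : ℤ)⟧), Triangle.mk g a b ∈ distTriang 𝒯 ∧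
      Triangle.mk (D.map a.op) (D.map g.op) c ∈ distTriang 𝒯

variable {D : 𝒯ᵒᵖ ⥤ 𝒯}

section Functor

variable [D.Full] [D.Faithful]

omit [HasZeroObject 𝒯] [Preadditive 𝒯] [HasShift 𝒯 ℤ]
  [∀ n : ℤ, (shiftFunctor 𝒯 n).Additive] [Pretriangulated 𝒯] in
lemma retract_dual_iff {X Y : 𝒯} : Nonempty (Retract (D.obj (op X)) (D.obj (op Y))) ↔
    Nonempty (Retract X Y) := by
  constructor
  · rintro ⟨ρ⟩
    obtain ⟨i, hi⟩ := D.map_surjective ρ.i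
    obtain ⟨r, hr⟩ := D.map_surjective ρ.r
    exact ⟨⟨r.unop, i.unop, Quiver.Hom.op_inj (D.map_injective (by simp [hi, hr]))⟩⟩
  · rintro ⟨ρ⟩
    exact ⟨⟨D.map ρ.r.op, D.map ρ.i.op, by rw [← D.map_comp, ← op_comp, ρ.retract]; simp⟩⟩

omit [HasZeroObject 𝒯] [Preadditive 𝒯] [HasShift 𝒯 ℤ]
  [∀ n : ℤ, (shiftFunctor 𝒯 n).Additive] [Pretriangulated 𝒯] in
lemma iso_dual_iff {X Y : 𝒯} : Nonempty (D.obj (op X) ≅ D.obj (op Y)) ↔ Nonempty (X ≅ Y) :=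
  ⟨fun ⟨e⟩ => ⟨(D.preimageIso e).unop.symm⟩, fun ⟨e⟩ => ⟨D.mapIso e.symm.op⟩⟩

variable [D.Additive]

omit [HasZeroObject 𝒯] [HasShift 𝒯 ℤ]
  [∀ n : ℤ, (shiftFunctor 𝒯 n).Additive] [Pretriangulated 𝒯] in
lemma homZero_dual_iff {X Y : 𝒯} : HomZero (D.obj (op X)) (D.obj (op Y)) ↔ HomZero Y X := by
  refine ⟨fun H f => ?_, fun H f => ?_⟩
  · exact Quiver.Hom.op_inj (D.map_injective (by rw [H (D.map f.op), op_zero, D.map_zero]))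
  · obtain ⟨g, rfl⟩ := D.map_surjective f
    rw [← Quiver.Hom.op_unop g, H g.unop, op_zero, D.map_zero]

omit [HasZeroObject 𝒯] [HasShift 𝒯 ℤ]
  [∀ n : ℤ, (shiftFunctor 𝒯 n).Additive] [Pretriangulated 𝒯] in
lemma isZero_dual_iff {X : 𝒯} : IsZero (D.obj (op X)) ↔ IsZero X :=
  ⟨fun h => HomZero.isZero (homZero_dual_iff.1 fun f => h.eq_of_src f 0),
    fun h => HomZero.isZero (homZero_dual_iff.2 fun f => h.eq_of_src f 0)⟩

lemma inAdd_dual_iff {M X : 𝒯} : InAdd (D.obj (op M)) (D.obj (op X)) ↔ InAdd M X := by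
  refine ⟨fun h => ?_, fun h => h.map_op D⟩
  obtain ⟨n, i, r, hir⟩ := h.exists_sum
  choose i' hi' using fun k => D.map_surjective (i k)
  choose r' hr' using fun k => D.map_surjective (r k)
  refine inAdd_of_sum (fun k => (r' k).unop) (fun k => (i' k).unop) ?_
  apply Quiver.Hom.op_inj
  apply D.map_injective
  simp [hi', hr', hir]

omit [D.Full] [D.Faithful] in
lemma nonempty_iso_dual_biprod (X Y : 𝒯) :
    Nonempty (D.obj (op (X ⊞ Y)) ≅ D.obj (op X) ⊞ D.obj (op Y)) := by
  refine ⟨⟨biprod.lift (D.map biprod.inl.op) (D.map biprod.inr.op),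
    biprod.desc (D.map biprod.fst.op) (D.map biprod.snd.op), ?_, ?_⟩⟩
  · rw [biprod.lift_desc, ← D.map_comp, ← D.map_comp, ← op_comp, ← op_comp, ← D.map_add,
      ← op_add, biprod.total, op_id, D.map_id]
  · ext <;> simp [← D.map_comp, ← op_comp]

lemma isBasic_dual_iff [D.EssSurj] {T : 𝒯} : IsBasic (D.obj (op T)) ↔ IsBasic T := by
  have key (X Z : 𝒯) : Nonempty (D.obj (op ((X ⊞ X) ⊞ Z)) ≅
      (D.obj (op X) ⊞ D.obj (op X)) ⊞ D.obj (op Z)) := by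
    obtain ⟨e⟩ := nonempty_iso_dual_biprod (D := D) (X ⊞ X) Z
    obtain ⟨e'⟩ := nonempty_iso_dual_biprod (D := D) X X
    exact ⟨e ≪≫ biprod.mapIso e' (Iso.refl _)⟩
  constructor
  · rintro h X Z ⟨e⟩
    obtain ⟨e'⟩ := key X Z
    exact isZero_dual_iff.1 (h _ _ ⟨D.mapIso e.symm.op ≪≫ e'⟩)
  · rintro h X Z ⟨e⟩
    obtain ⟨e'⟩ := key (D.objPreimage X).unop (D.objPreimage Z).unop
    have hX := D.objObjPreimageIso X
    have hZ := D.objObjPreimageIso Z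
    have h1 := h _ _ (iso_dual_iff.1
      ⟨e ≪≫ (biprod.mapIso (biprod.mapIso hX hX) hZ).symm ≪≫ e'.symm⟩)
    exact (isZero_dual_iff.2 h1).of_iso hX.symm

end Functor

namespace IsDuality

variable (hD : IsDuality D)

include hD

/-- `Hom(D U, (D T)[i])` is `Hom((D U)[-i], D T)`, that is `Hom(D(U[i]), D T)`, which is `Hom(T,
U[i])` reversed. -/
lemma geq_iff {T U : 𝒯} : Geq (D.obj (op U)) (D.obj (op T)) ↔ Geq T U := by
  have := hD.full
  have := hD.faithful
  have := hD.additive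
  refine forall₂_congr fun i hi => ?_
  obtain ⟨e⟩ := hD.shift U i
  change HomZero (D.obj (op U)) ((D.obj (op T))⟦i⟧) ↔ HomZero T (U⟦i⟧)
  rw [← homZero_dual_iff (D := D) (Y := T), ← homZero_shift_left_iff (-i) 0 i (by lia)]
  exact ⟨fun H => H.of_iso e ((shiftFunctorZero 𝒯 ℤ).symm.app _),
    fun H => H.of_iso e.symm ((shiftFunctorZero 𝒯 ℤ).app _)⟩

lemma isSilting_iff {T : 𝒯} : IsSilting (D.obj (op T)) ↔ IsSilting T := by
  have := hD.full
  have := hD.faithful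
  have := hD.additive
  have := hD.essSurj
  refine and_congr hD.geq_iff ⟨fun H X Q _ _ hT => ?_, fun H Y Q _ _ hT => ?_⟩
  · have h1 : ∃ X' : 𝒯, Q X' ∧ Nonempty (D.obj (op X') ≅ D.obj (op X)) := by
      refine thick_induction_cone (A := D.obj (op T))
        (fun Y => ∃ X' : 𝒯, Q X' ∧ Nonempty (D.obj (op X') ≅ Y)) ?_ ?_ ?_ ?_ ?_ (H (D.obj (op X)))
      · rintro Y Z ρ ⟨X', hX', ⟨e⟩⟩
        let eY := D.objObjPreimageIso Y
        obtain ⟨σ⟩ := retract_dual_iff.1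
          (show Nonempty (Retract (D.obj (op (D.objPreimage Y).unop)) (D.obj (op X'))) from
            ⟨((Retract.ofIso eY).trans ρ).trans (.ofIso e.symm)⟩)
        exact ⟨_, Q.prop_of_retract σ hX', ⟨eY⟩⟩
      · rintro Y n ⟨X', hX', ⟨e⟩⟩
        obtain ⟨e'⟩ := hD.shift X' (-n)
        exact ⟨_, Q.le_shift (-n) _ hX', ⟨e' ≪≫ eqToIso (by rw [neg_neg]) ≪≫
          (shiftFunctor 𝒯 n).mapIso e⟩⟩
      · intro Y hY
        obtain ⟨Z, hZ, hQZ⟩ := ObjectProperty.ContainsZero.exists_zero (P := Q)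
        exact ⟨Z, hQZ, ⟨(isZero_dual_iff.2 hZ).iso hY⟩⟩
      · rintro Y₁ Y₂ Y₃ f g h hT' ⟨X₁, h₁, ⟨e₁⟩⟩ ⟨X₂, h₂, ⟨e₂⟩⟩
        obtain ⟨k, hk⟩ := D.map_surjective (e₁.hom ≫ f ≫ e₂.inv)
        obtain ⟨Z, a, b, c, hZ, hZ'⟩ := hD.triangle k.unop
        obtain ⟨e', -⟩ := exists_iso_of_arrow_iso _ _ (rot_of_distTriang _ hZ') hT'
          (Arrow.isoMk e₁ e₂
            (show e₁.hom ≫ f = D.map k.unop.op ≫ e₂.hom by rw [Quiver.Hom.op_unop, hk]; simp))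
        obtain ⟨e''⟩ := hD.shift Z (-1)
        exact ⟨_, Q.le_shift (-1) _ (Q.ext_of_isTriangulatedClosed₃ _ hZ h₂ h₁),
          ⟨e'' ≪≫ Triangle.π₃.mapIso e'⟩⟩
      · exact ⟨T, hT, ⟨Iso.refl _⟩⟩
    obtain ⟨X', hX', h2⟩ := h1
    obtain ⟨e⟩ := iso_dual_iff.1 h2
    exact Q.prop_of_iso e hX'
  · refine Q.prop_of_iso (D.objObjPreimageIso Y) ?_
    refine thick_induction_cone (A := T) (fun X => Q (D.obj (op X))) ?_ ?_ ?_ ?_ hT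
      (H (D.objPreimage Y).unop)
    · intro X X' ρ h
      obtain ⟨σ⟩ := (retract_dual_iff (D := D)).2 ⟨ρ⟩
      exact Q.prop_of_retract σ h
    · intro X n h
      obtain ⟨e⟩ := hD.shift X n
      exact Q.prop_of_iso e.symm (Q.le_shift (-n) _ h)
    · intro X hX
      obtain ⟨Z, hZ, hQZ⟩ := ObjectProperty.ContainsZero.exists_zero (P := Q)
      exact Q.prop_of_iso (hZ.iso (isZero_dual_iff.2 hX)) hQZ
    · intro X₁ X₂ X₃ f g h hT' h₁ h₂
      obtain ⟨Z, a, b, c, hZ, hZ'⟩ := hD.triangle f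
      obtain ⟨e⟩ : Nonempty (Z ≅ X₃) := ⟨Triangle.π₃.mapIso (isoTriangleOfIso₁₂ _ _ hZ hT'
        (Iso.refl _) (Iso.refl _) ((Category.comp_id f).trans (Category.id_comp f).symm))⟩
      exact Q.prop_of_iso (D.mapIso e.symm.op) (Q.ext_of_isTriangulatedClosed₁ _ hZ' h₂ h₁)

variable {A P : 𝒯} (hA : InAdd A (D.obj (op A))) (hA' : InAdd (D.obj (op A)) A)
  (hP : Nonempty (D.obj (op P) ≅ P))

include hA hA' hP

lemma inAddAway_iff {X : 𝒯} : InAddAway A P (D.obj (op X)) ↔ InAddAway A P X := by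
  have := hD.full
  have := hD.faithful
  have := hD.additive
  obtain ⟨e⟩ := hP
  refine and_congr ⟨fun h => inAdd_dual_iff.1 (hA'.trans h), fun h => hA.trans (h.map_op D)⟩
    (not_congr ?_)
  rw [← retract_dual_iff (D := D) (X := P) (Y := X)]
  exact ⟨fun ⟨ρ⟩ => ⟨(Retract.ofIso e).trans ρ⟩, fun ⟨ρ⟩ => ⟨(Retract.ofIso e.symm).trans ρ⟩⟩

lemma factorsTo_iff {T : 𝒯} : FactorsTo A P (D.obj (op T)) ↔ FactorsFrom A P T := by
  have := hD.full
  have := hD.faithful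
  have := hD.additive
  have := hD.essSurj
  have hP' := hP
  obtain ⟨e⟩ := hP
  constructor
  · intro H f
    obtain ⟨Y, g, h, hY, hgh⟩ := H (D.map f.op ≫ e.hom)
    let eY := D.objObjPreimageIso Y
    obtain ⟨g', hg'⟩ := D.map_surjective (g ≫ eY.inv)
    obtain ⟨h', hh'⟩ := D.map_surjective (eY.hom ≫ h ≫ e.inv)
    have hY' : InAddAway A P (D.obj (op (D.objPreimage Y).unop)) :=
      ⟨hY.1.of_retract (.ofIso eY), fun ⟨ρ⟩ => hY.2 ⟨ρ.trans (.ofIso eY)⟩⟩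
    refine ⟨(D.objPreimage Y).unop, h'.unop, g'.unop, (hD.inAddAway_iff hA hA' hP').1 hY', ?_⟩
    apply Quiver.Hom.op_inj
    apply D.map_injective
    have : (h'.unop ≫ g'.unop).op = g' ≫ h' := rfl
    rw [this, D.map_comp, hg', hh']
    simp [reassoc_of% hgh]
  · intro H f
    obtain ⟨f', hf'⟩ := D.map_surjective (f ≫ e.inv)
    obtain ⟨X, g, h, hX, hgh⟩ := H f'.unop
    refine ⟨_, D.map h.op, D.map g.op ≫ e.hom, (hD.inAddAway_iff hA hA' hP').2 hX, ?_⟩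
    rw [← Category.assoc, ← D.map_comp, ← op_comp, hgh, Quiver.Hom.op_unop, hf']
    simp

omit hD hA hA' hP in
lemma _root_.Silting.inAddAway_shift_iff (n : ℤ) {X : 𝒯} :
    InAddAway (A⟦n⟧) (P⟦n⟧) (X⟦n⟧) ↔ InAddAway A P X := by
  refine ⟨fun h => ?_, inAddAway_shift n⟩
  obtain ⟨Y, hY, ⟨e⟩⟩ := h.1.exists_shift
  exact ⟨hY.of_retract (.ofIso ((shiftFunctor 𝒯 n).preimageIso e)),
    fun ⟨ρ⟩ => h.2 ⟨ρ.map (shiftFunctor 𝒯 n)⟩⟩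

omit hD hA hA' hP in
lemma _root_.Silting.factorsTo_shift_iff (n : ℤ) {T : 𝒯} :
    FactorsTo (A⟦n⟧) (P⟦n⟧) (T⟦n⟧) ↔ FactorsTo A P T := by
  constructor
  · intro H f
    obtain ⟨Y, g, h, hY, hgh⟩ := H (f⟦n⟧')
    obtain ⟨X, -, ⟨e⟩⟩ := hY.1.exists_shift
    obtain ⟨g', hg'⟩ := (shiftFunctor 𝒯 n).map_surjective (g ≫ e.hom)
    obtain ⟨h', hh'⟩ := (shiftFunctor 𝒯 n).map_surjective (e.inv ≫ h)
    refine ⟨X, g', h', (inAddAway_shift_iff n).1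
      ⟨hY.1.of_retract (.ofIso e.symm), fun ⟨ρ⟩ => hY.2 ⟨ρ.trans (.ofIso e.symm)⟩⟩,
      (shiftFunctor 𝒯 n).map_injective ?_⟩
    simp [hg', hh', hgh]
  · intro H f
    obtain ⟨f, rfl⟩ := (shiftFunctor 𝒯 n).map_surjective f
    obtain ⟨X, g, h, hX, rfl⟩ := H f
    exact ⟨_, g⟦n⟧', h⟦n⟧', inAddAway_shift n hX, by simp⟩

end IsDuality

lemma IsSilting.of_shift {T : 𝒯} {n : ℤ} (h : IsSilting (T⟦n⟧)) : IsSilting T :=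
  ⟨(geq_shift_iff n).1 h.1, fun X Q _ _ hQ => h.2 X Q ‹_› ‹_› (Q.le_shift n _ hQ)⟩

lemma IsSilting.of_iso {T T' : 𝒯} (h : IsSilting T) (e : T ≅ T') : IsSilting T' :=
  ⟨h.1.of_iso e e, fun X Q _ _ hQ => h.2 X Q ‹_› ‹_› (Q.prop_of_iso e.symm hQ)⟩

lemma isSilting_shift_iff {T : 𝒯} (n : ℤ) : IsSilting (T⟦n⟧) ↔ IsSilting T :=
  ⟨.of_shift, fun h => .of_shift (n := -n)
    (h.of_iso ((shiftFunctorCompIsoId 𝒯 n (-n) (by lia)).symm.app T))⟩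

end Duality

end Silting

/-! ### The symmetry produced by a duality -/

namespace Silting

open Opposite

section Main

variable {𝒯 : Type u} [Category.{v} 𝒯] [HasZeroObject 𝒯] [Preadditive 𝒯] [HasShift 𝒯 ℤ]
  [∀ n : ℤ, (shiftFunctor 𝒯 n).Additive] [Pretriangulated 𝒯]
  (K : Type w) [Field K] [Linear K 𝒯] {A P : 𝒯}

omit [HasZeroObject 𝒯] [Preadditive 𝒯] [HasShift 𝒯 ℤ]
  [∀ n : ℤ, (shiftFunctor 𝒯 n).Additive] [Pretriangulated 𝒯] in
lemma IsoClass.mk_eq_iff {X Y : 𝒯} : IsoClass.mk X = IsoClass.mk Y ↔ Nonempty (X ≅ Y) :=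
  Quotient.eq

/-- The objects whose isomorphism classes form `twoSilt A`. -/
def IsTwoSilting (A T : 𝒯) : Prop :=
  IsSilting T ∧ IsBasic T ∧ Geq A T ∧ Geq T (A⟦(1 : ℤ)⟧)

lemma mk_mem_twoSilt_iff {T : 𝒯} : IsoClass.mk T ∈ twoSilt A ↔ IsTwoSilting A T := by
  refine ⟨?_, fun h => ⟨T, h, rfl⟩⟩
  rintro ⟨T', h, h'⟩
  obtain ⟨e⟩ := IsoClass.mk_eq_iff.1 h'
  exact ⟨h.1.of_iso e, h.2.1.of_iso e, h.2.2.1.of_iso (Iso.refl _) e,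
    h.2.2.2.of_iso e (Iso.refl _)⟩

lemma exists_isLeftMutation (hfin : ∀ Y : 𝒯, Module.Finite K (A ⟶ Y)) (hF : FittingProperty A)
    (hP : IsLocalObj P) (hPA : InAdd A P) :
    ∃ B U : 𝒯, IsBasicVersion B A ∧ IsLeftMutation P B U := by
  obtain ⟨B, hB⟩ := exists_isBasicVersion K hfin
  obtain ⟨M, ⟨e⟩⟩ := hP.exists_complement hB hPA
  have hM : InAdd A M := ((hP.inAddAway_iff hB e).2 (inAdd_self M)).1
  obtain ⟨M', f, hf⟩ := exists_isMinLeftApprox K hfin hF hM hPA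
  obtain ⟨Y, g, h, hT⟩ := distinguished_cocone_triangle f
  exact ⟨B, Y ⊞ M, hB, M, M', Y, f, g, h, ⟨e⟩, hf, hT, ⟨Iso.refl _⟩⟩

lemma IsMinRightApprox.shift {M M' X : 𝒯} {f : M' ⟶ X} (hf : IsMinRightApprox M f) (n : ℤ) :
    IsMinRightApprox (M⟦n⟧) (f⟦n⟧') := by
  refine ⟨hf.1.map (shiftFunctor 𝒯 n), fun N hN g => ?_, fun h hh => ?_⟩
  · obtain ⟨N', hN', ⟨e⟩⟩ := hN.exists_shift
    obtain ⟨g', hg'⟩ := (shiftFunctor 𝒯 n).map_surjective (e.inv ≫ g)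
    obtain ⟨l, rfl⟩ := hf.2.1 N' hN' g'
    refine ⟨e.hom ≫ l⟦n⟧', ?_⟩
    rw [Category.assoc, ← Functor.map_comp, hg', e.hom_inv_id_assoc]
  · obtain ⟨h, rfl⟩ := (shiftFunctor 𝒯 n).map_surjective h
    have := hf.2.2 h ((shiftFunctor 𝒯 n).map_injective (by simpa using hh))
    infer_instance

lemma exists_isRightMutation (hfin : ∀ Y : 𝒯, Module.Finite K (A ⟶ Y)) (hF : FittingProperty A)
    (hP : IsLocalObj P) (hPA : InAdd A P) :
    ∃ B U : 𝒯, IsBasicVersion B A ∧ IsRightMutation (P⟦(1 : ℤ)⟧) (B⟦(1 : ℤ)⟧) U := by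
  obtain ⟨B, hB⟩ := exists_isBasicVersion K hfin
  obtain ⟨M, ⟨e⟩⟩ := hP.exists_complement hB hPA
  have hM : InAdd A M := ((hP.inAddAway_iff hB e).2 (inAdd_self M)).1
  obtain ⟨M', f, hf⟩ := exists_isMinRightApprox K hfin hF hM P
  obtain ⟨Y, g, h, hT⟩ := distinguished_cocone_triangle₁ (f⟦(1 : ℤ)⟧')
  have : PreservesBinaryBiproducts (shiftFunctor 𝒯 (1 : ℤ)) :=
    preservesBinaryBiproducts_of_preservesBiproducts _
  exact ⟨B, Y ⊞ M⟦(1 : ℤ)⟧, hB, M⟦(1 : ℤ)⟧, M'⟦(1 : ℤ)⟧, Y, g, f⟦(1 : ℤ)⟧', h,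
    ⟨(shiftFunctor 𝒯 (1 : ℤ)).mapIso e ≪≫ (shiftFunctor 𝒯 (1 : ℤ)).mapBiprod _ _⟩,
    hf.shift 1, hT, ⟨Iso.refl _⟩⟩

/-- All choices of basic version and mutation impose the same factorization condition, so the
existential in the definition is harmless. The existence of a mutation is needed only for the
converse. -/
lemma mk_mem_twoSiltMinus_iff (hfin : ∀ Y : 𝒯, Module.Finite K (A ⟶ Y)) (hF : FittingProperty A)
    (hP : IsLocalObj P) (hPA : InAdd A P) {T : 𝒯} :
    IsoClass.mk T ∈ twoSiltMinus A P ↔ IsTwoSilting A T ∧ FactorsFrom A P T := by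
  refine Iff.trans (and_congr_left' mk_mem_twoSilt_iff) (and_congr_right fun hT => ?_)
  constructor
  · rintro ⟨B, U, hB, hU, h, -⟩
    exact (hU.geq_iff hP hB hT.2.2.1).1 h
  · intro h
    obtain ⟨B, U, hB, hU⟩ := exists_isLeftMutation K hfin hF hP hPA
    exact ⟨B, U, hB, hU, (hU.geq_iff hP hB hT.2.2.1).2 h, hT.2.2.2⟩

lemma mk_mem_twoSiltPlus_iff (hfin : ∀ Y : 𝒯, Module.Finite K (A ⟶ Y)) (hF : FittingProperty A)
    (hP : IsLocalObj P) (hPA : InAdd A P) {T : 𝒯} :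
    IsoClass.mk T ∈ twoSiltPlus A P ↔
      IsTwoSilting A T ∧ FactorsTo (A⟦(1 : ℤ)⟧) (P⟦(1 : ℤ)⟧) T := by
  refine Iff.trans (and_congr_left' mk_mem_twoSilt_iff) (and_congr_right fun hT => ?_)
  constructor
  · rintro ⟨B, U, hB, hU, -, h⟩
    exact (hU.geq_iff (hP.shift 1) (hB.shift 1) hT.2.2.2).1 h
  · intro h
    obtain ⟨B, U, hB, hU⟩ := exists_isRightMutation K hfin hF hP hPA
    exact ⟨B, U, hB, hU, hT.2.2.1, (hU.geq_iff (hP.shift 1) (hB.shift 1) hT.2.2.2).2 h⟩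

variable {D : 𝒯ᵒᵖ ⥤ 𝒯} (hD : IsDuality D)

namespace IsDuality

/-- The map `T ↦ D(T)[1]` on isomorphism classes. -/
def isoClassMap (D : 𝒯ᵒᵖ ⥤ 𝒯) : IsoClass 𝒯 → IsoClass 𝒯 :=
  Quotient.map (fun T => (D.obj (op T))⟦(1 : ℤ)⟧)
    (fun _ _ ⟨e⟩ => ⟨(shiftFunctor 𝒯 (1 : ℤ)).mapIso (D.mapIso e.symm.op)⟩)

include hD

lemma isoClassMap_bijective : Function.Bijective (isoClassMap D) := by
  have := hD.full
  have := hD.faithful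
  have := hD.essSurj
  constructor
  · rintro ⟨X⟩ ⟨Y⟩ h
    obtain ⟨e⟩ := IsoClass.mk_eq_iff.1 h
    exact IsoClass.mk_eq_iff.2 (iso_dual_iff.1 ⟨(shiftFunctor 𝒯 (1 : ℤ)).preimageIso e⟩)
  · rintro ⟨Y⟩
    refine ⟨IsoClass.mk (D.objPreimage (Y⟦(-1 : ℤ)⟧)).unop, IsoClass.mk_eq_iff.2 ⟨?_⟩⟩
    exact (shiftFunctor 𝒯 (1 : ℤ)).mapIso (D.objObjPreimageIso (Y⟦(-1 : ℤ)⟧)) ≪≫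
      (shiftFunctorCompIsoId 𝒯 (-1) 1 (by lia)).app Y

lemma isoClassMap_geq_iff (S T : IsoClass 𝒯) :
    (isoClassMap D T).Geq (isoClassMap D S) ↔ S.Geq T := by
  obtain ⟨S⟩ := S
  obtain ⟨T⟩ := T
  exact (geq_shift_iff 1).trans hD.geq_iff

variable (hA : InAdd A (D.obj (op A))) (hA' : InAdd (D.obj (op A)) A)

include hA hA'

/-- Dualizing `A ≥ T ≥ A[1]` gives `(D A)[-1] ≥ D T ≥ D A`. The shift by one restores the interval,
since `A` and `D A` have the same additive closure. -/
lemma isTwoSilting_iff {T : 𝒯} :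
    IsTwoSilting A ((D.obj (op T))⟦(1 : ℤ)⟧) ↔ IsTwoSilting A T := by
  have := hD.full
  have := hD.faithful
  have := hD.essSurj
  have := hD.additive
  have h1 : Geq A ((D.obj (op T))⟦(1 : ℤ)⟧) ↔ Geq T (A⟦(1 : ℤ)⟧) := by
    have : Geq A ((D.obj (op T))⟦(1 : ℤ)⟧) ↔ Geq (D.obj (op A)) ((D.obj (op T))⟦(1 : ℤ)⟧) :=
      ⟨hA.geq_left, hA'.geq_left⟩
    rw [this]
    obtain ⟨e⟩ := hD.shift A 1
    rw [← hD.geq_iff (T := T), ← geq_shift_iff (U := D.obj (op T)) 1]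
    have e' : D.obj (op A) ≅ (D.obj (op (A⟦(1 : ℤ)⟧)))⟦(1 : ℤ)⟧ :=
      ((shiftFunctorCompIsoId 𝒯 (-1) 1 (by lia)).app (D.obj (op A))).symm ≪≫
        (shiftFunctor 𝒯 (1 : ℤ)).mapIso e.symm
    exact ⟨fun H => H.of_iso e' (Iso.refl _), fun H => H.of_iso e'.symm (Iso.refl _)⟩
  have h2 : Geq ((D.obj (op T))⟦(1 : ℤ)⟧) (A⟦(1 : ℤ)⟧) ↔ Geq A T := by
    rw [geq_shift_iff, ← hD.geq_iff (T := A) (U := T)]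
    exact ⟨hA.geq_right, hA'.geq_right⟩
  have h3 : IsBasic ((D.obj (op T))⟦(1 : ℤ)⟧) ↔ IsBasic T :=
    ⟨fun h => isBasic_dual_iff.1 h.of_shift, fun h => (isBasic_dual_iff.2 h).shift 1⟩
  rw [IsTwoSilting, IsTwoSilting, h1, h2, h3, isSilting_shift_iff, hD.isSilting_iff]
  tauto

/-- A duality fixing `add A` and `P` gives the symmetry of `twoSilt A`. -/
theorem twoSilt_symmetry (hAs : IsSilting A) (hfin : ∀ Y : 𝒯, Module.Finite K (A ⟶ Y))
    (hF : FittingProperty A) (hP : IsLocalObj P) (hPA : InAdd A P)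
    (hDP : Nonempty (D.obj (op P) ≅ P)) :
    (∃ φ : twoSiltMinus A P ≃ twoSiltPlus A P, ∀ S T : twoSiltMinus A P,
      S.1.Geq T.1 ↔ (φ T).1.Geq (φ S).1) ∧
    Cardinal.mk (twoSilt A) = 2 * Cardinal.mk (twoSiltMinus A P) := by
  have key : ∀ t : IsoClass 𝒯, t ∈ twoSiltMinus A P ↔ isoClassMap D t ∈ twoSiltPlus A P := by
    rintro ⟨T⟩
    refine (mk_mem_twoSiltMinus_iff K hfin hF hP hPA).trans (Iff.trans ?_
      (mk_mem_twoSiltPlus_iff K hfin hF hP hPA).symm)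
    rw [hD.isTwoSilting_iff hA hA', factorsTo_shift_iff, hD.factorsTo_iff hA hA' hDP]
  let φ : twoSiltMinus A P ≃ twoSiltPlus A P :=
    (Equiv.ofBijective _ hD.isoClassMap_bijective).subtypeEquiv key
  refine ⟨⟨φ, fun S T => (hD.isoClassMap_geq_iff S.1 T.1).symm⟩, ?_⟩
  have hunion : twoSilt A = twoSiltMinus A P ∪ twoSiltPlus A P := by
    apply Set.Subset.antisymm
    · rintro _ ⟨T, hT, rfl⟩
      exact (factorsFrom_or_factorsTo K hfin hAs hP hPA hT.2.2.1 hT.2.2.2 hT.1.1).imp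
        (fun h => (mk_mem_twoSiltMinus_iff K hfin hF hP hPA).2 ⟨hT, h⟩)
        (fun h => (mk_mem_twoSiltPlus_iff K hfin hF hP hPA).2 ⟨hT, h⟩)
    · exact Set.union_subset (fun t ht => ht.1) (fun t ht => ht.1)
  have hdisj : Disjoint (twoSiltMinus A P) (twoSiltPlus A P) := by
    rw [Set.disjoint_left]
    rintro ⟨T⟩ h h'
    obtain ⟨hT, h⟩ := (mk_mem_twoSiltMinus_iff K hfin hF hP hPA).1 h
    obtain ⟨-, h'⟩ := (mk_mem_twoSiltPlus_iff K hfin hF hP hPA).1 h'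
    exact not_factorsFrom_and_factorsTo K hfin hAs hP hPA hT.2.2.1 hT.2.2.2 hT.1 h h'
  rw [hunion, Cardinal.mk_union_of_disjoint hdisj, ← Cardinal.mk_congr φ, two_mul]

end IsDuality

end Main

end Silting

/-! ### Stalk complexes generate the bounded homotopy category -/

namespace Silting

section Bounded

variable {C : Type u} [Category.{v} C] [Preadditive C]

instance [HasZeroObject C] : (stalk C).Full where
  map_surjective {X Y} f := by
    obtain ⟨g, hg⟩ := (HomotopyCategory.quotient C (ComplexShape.up ℤ)).map_surjective f.hom
    obtain ⟨h, hh⟩ := (CochainComplex.singleFunctor C 0).map_surjective g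
    refine ⟨h, ObjectProperty.hom_ext _ ?_⟩
    rw [← hg, ← hh]
    rfl

instance [HasZeroObject C] : (stalk C).Faithful where
  map_injective {X Y} f g h := by
    have h1 : (HomotopyCategory.quotient C (ComplexShape.up ℤ)).map
        ((CochainComplex.singleFunctor C 0).map f) =
        (HomotopyCategory.quotient C (ComplexShape.up ℤ)).map
        ((CochainComplex.singleFunctor C 0).map g) := congr_arg (fun k => k.hom) h
    apply (CochainComplex.singleFunctor C 0).map_injective
    have h2 := HomotopyCategory.homotopyOfEq _ _ h1
    apply (HomologicalComplex.to_single_hom_ext (c := ComplexShape.up ℤ) (j := 0))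
    -- Both homotopy terms pass through a differential of a complex concentrated in degree zero, so
    -- homotopic maps are equal.
    have h3 := h2.comm 0
    rw [dNext_eq _ (show (ComplexShape.up ℤ).Rel 0 1 by simp),
      prevD_eq _ (show (ComplexShape.up ℤ).Rel (-1) 0 by simp)] at h3
    simp only [CochainComplex.singleFunctor_obj_d, zero_comp, comp_zero, zero_add] at h3
    exact h3

instance [HasZeroObject C] : (stalk C).Additive where
  map_add := ObjectProperty.hom_ext _ ((HomotopyCategory.singleFunctor C 0).map_add)

lemma hom_eq_zero_of_isStrictlyGE {K L : CochainComplex C ℤ} (a b : ℤ) (hab : b < a)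
    (h : (K.IsStrictlyGE a ∧ L.IsStrictlyLE b) ∨ (K.IsStrictlyLE b ∧ L.IsStrictlyGE a))
    (f : K ⟶ L) : f = 0 := by
  ext i
  rcases h with ⟨_, _⟩ | ⟨_, _⟩
  · by_cases hi : i < a
    · exact (K.isZero_of_isStrictlyGE a i hi).eq_of_src _ _
    · exact (L.isZero_of_isStrictlyLE b i (by lia)).eq_of_tgt _ _
  · by_cases hi : i < a
    · exact (L.isZero_of_isStrictlyGE a i hi).eq_of_tgt _ _
    · exact (K.isZero_of_isStrictlyLE b i (by lia)).eq_of_src _ _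

variable [HasZeroObject C] [HasBinaryBiproducts C]

/-- A bounded complex as an object of `K^b(C)`. -/
def Kb.mk (K : CochainComplex C ℤ) (h : ∃ a b : ℤ, K.IsStrictlyGE a ∧ K.IsStrictlyLE b) : Kb C :=
  ⟨(HomotopyCategory.quotient C _).obj K, (bounded_quotient_iff K).2 h⟩

omit [HasZeroObject C] [HasBinaryBiproducts C] in
lemma exists_iso_kbMk (X : Kb C) : ∃ (K : CochainComplex C ℤ) (h : _), X = Kb.mk K h := by
  obtain ⟨X, hX⟩ := X
  obtain ⟨K, rfl⟩ := HomotopyCategory.quotient_obj_surjective X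
  exact ⟨K, (bounded_quotient_iff K).1 hX, rfl⟩

/-- The shift in `K^b(C)` is computed on complexes. -/
noncomputable def Kb.mkShiftIso (K : CochainComplex C ℤ) (h) (n : ℤ) (h') :
    (Kb.mk K h)⟦n⟧ ≅ Kb.mk (K⟦n⟧) h' :=
  ObjectProperty.isoMk _ (((bounded C).ι.commShiftIso n).app _ ≪≫
    (((HomotopyCategory.quotient C _).commShiftIso n).app K).symm)

omit [HasZeroObject C] [HasBinaryBiproducts C] in
lemma Kb.exists_bound_shift {K : CochainComplex C ℤ}
    (h : ∃ a b : ℤ, K.IsStrictlyGE a ∧ K.IsStrictlyLE b) (n : ℤ) :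
    ∃ a b : ℤ, (K⟦n⟧).IsStrictlyGE a ∧ (K⟦n⟧).IsStrictlyLE b := by
  obtain ⟨a, b, _, _⟩ := h
  exact ⟨a - n, b - n, K.isStrictlyGE_shift a n (a - n) (by lia),
    K.isStrictlyLE_shift b n (b - n) (by lia)⟩

omit [HasBinaryBiproducts C] in
lemma Kb.single_bound (X : C) (n : ℤ) : ∃ a b : ℤ,
    ((CochainComplex.singleFunctor C n).obj X).IsStrictlyGE a ∧
    ((CochainComplex.singleFunctor C n).obj X).IsStrictlyLE b :=
  ⟨n, n, inferInstance, inferInstance⟩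

omit [HasBinaryBiproducts C] in
-- The two complexes sit in the different degrees `0` and `-n`, so already the chain map is zero.
lemma homZero_stalk_shift (X Y : C) (n : ℤ) (hn : n ≠ 0) :
    HomZero ((stalk C).obj X) (((stalk C).obj Y)⟦n⟧) := by
  have h := Kb.exists_bound_shift (Kb.single_bound Y 0) n
  have e : ((stalk C).obj Y)⟦n⟧ ≅ Kb.mk (((CochainComplex.singleFunctor C 0).obj Y)⟦n⟧) h :=
    Kb.mkShiftIso _ (Kb.single_bound Y 0) n h
  refine HomZero.of_iso (X := Kb.mk _ (Kb.single_bound X 0)) (fun f => ?_) (Iso.refl _) e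
  obtain ⟨g, hg⟩ := (HomotopyCategory.quotient C (ComplexShape.up ℤ)).map_surjective f.hom
  have := ((CochainComplex.singleFunctor C 0).obj Y).isStrictlyLE_shift 0 n (-n) (by lia)
  have := ((CochainComplex.singleFunctor C 0).obj Y).isStrictlyGE_shift 0 n (-n) (by lia)
  have hg0 : g = 0 := by
    rcases lt_or_gt_of_ne hn with h' | h'
    · exact hom_eq_zero_of_isStrictlyGE (-n) 0 (by lia) (.inr ⟨inferInstance, inferInstance⟩) g
    · exact hom_eq_zero_of_isStrictlyGE 0 (-n) (by lia) (.inl ⟨inferInstance, inferInstance⟩) g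
  refine ObjectProperty.hom_ext _ ?_
  rw [← hg, hg0, Functor.map_zero]
  rfl

omit [HasBinaryBiproducts C] in
lemma geq_stalk (X Y : C) : Geq ((stalk C).obj X) ((stalk C).obj Y) :=
  fun i hi => homZero_stalk_shift X Y i hi.ne'

/-! ### Distinguished triangles in the bounded homotopy category -/

/-- Distinguished triangles of the full subcategory are those of the ambient category; only the
connecting map has to be moved across the comparison of shifts. -/
lemma exists_dist_of_ι {X Y Z : Kb C} (f : X ⟶ Y) (g : Y ⟶ Z) (h : Z.obj ⟶ X.obj⟦(1 : ℤ)⟧)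
    (hT : Triangle.mk f.hom g.hom h ∈ distTriang (HomotopyCategory C (ComplexShape.up ℤ))) :
    ∃ h' : Z ⟶ X⟦(1 : ℤ)⟧, Triangle.mk f g h' ∈ distTriang (Kb C) := by
  refine ⟨(bounded C).fullyFaithfulι.preimage
    (h ≫ ((bounded C).ι.commShiftIso (1 : ℤ)).inv.app X), ?_⟩
  refine isomorphic_distinguished _ hT _ (Triangle.isoMk _ _ (Iso.refl _) (Iso.refl _)
    (Iso.refl _) ?_ ?_ ?_)
  · exact (Category.comp_id _).trans (Category.id_comp _).symm
  · exact (Category.comp_id _).trans (Category.id_comp _).symm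
  · refine (congrArg (_ ≫ ·) ((shiftFunctor _ (1 : ℤ)).map_id _)).trans ?_
    refine (Category.comp_id _).trans (Eq.trans ?_ (Category.id_comp _).symm)
    exact (Category.assoc _ _ _).trans ((congrArg (h ≫ ·)
      (((bounded C).ι.commShiftIso (1 : ℤ)).inv_hom_id_app X)).trans (Category.comp_id _))

lemma exists_iso_of_dist {X Y Z : Kb C} {f : X ⟶ Y} {g : Y ⟶ Z} {h : Z ⟶ X⟦(1 : ℤ)⟧}
    (hT : Triangle.mk f g h ∈ distTriang (Kb C)) :
    ∃ h' : Z.obj ⟶ X.obj⟦(1 : ℤ)⟧,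
      Triangle.mk f.hom g.hom h' ∈ distTriang (HomotopyCategory C (ComplexShape.up ℤ)) :=
  ⟨_, hT⟩

/-! ### Brutal truncation -/

section Truncation

variable [HasFiniteBiproducts C] (K : CochainComplex C ℤ)

omit [HasZeroObject C] [HasBinaryBiproducts C] in
lemma biproduct_lift_desc_eq_zero {J : Type} [Finite J] {X Y Z : C} {f : X ⟶ Y} {g : Y ⟶ Z}
    (h : f ≫ g = 0) :
    (biproduct.lift fun _ : J => f) ≫ (biproduct.desc fun _ : J => g) = 0 := by
  have := Fintype.ofFinite J
  rw [biproduct.lift_desc]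
  simp [h]

omit [HasZeroObject C] [HasBinaryBiproducts C] in
lemma biproduct_lift_desc_of_unique {J : Type} [Finite J] (j : J) [Subsingleton J] {X Y Z : C}
    (f : X ⟶ Y) (g : Y ⟶ Z) :
    (biproduct.lift fun _ : J => f) ≫ (biproduct.desc fun _ : J => g) = f ≫ g := by
  have := Fintype.ofFinite J
  rw [biproduct.lift_desc, Fintype.sum_subsingleton _ j]

omit [HasZeroObject C] [HasBinaryBiproducts C] in
lemma biproduct_desc_lift_id {J : Type} [Finite J] [Subsingleton J] (X : C) :
    (biproduct.desc fun _ : J => 𝟙 X) ≫ (biproduct.lift fun _ : J => 𝟙 X) = 𝟙 _ := by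
  refine biproduct.hom_ext _ _ fun p => biproduct.hom_ext' _ _ fun q => ?_
  obtain rfl := Subsingleton.elim p q
  simp

/-- The part of a complex in the degrees of a set `s`. -/
noncomputable def restrictDegrees (s : Set ℤ) : CochainComplex C ℤ where
  -- A biproduct indexed by the proofs of `i ∈ s` is `K.X i` or zero, with no case distinction on
  -- objects and hence no transport in the differential.
  X i := ⨁ fun _ : PLift (i ∈ s) => K.X i
  d i j := biproduct.matrix fun _ _ => K.d i j
  shape i j h := by
    ext
    simp [K.shape i j h]
  d_comp_d' i j k _ _ := by
    refine biproduct.hom_ext _ _ fun p => biproduct.hom_ext' _ _ fun q => ?_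
    simp [biproduct.matrix_π, biproduct.ι_matrix_assoc,
      biproduct_lift_desc_eq_zero]

omit [HasZeroObject C] [HasBinaryBiproducts C] in
lemma isZero_restrictDegrees_X {s : Set ℤ} {i : ℤ} (h : i ∉ s ∨ IsZero (K.X i)) :
    IsZero ((restrictDegrees K s).X i) := by
  rw [IsZero.iff_id_eq_zero]
  refine biproduct.hom_ext' _ _ fun p => ?_
  rcases h with h | h
  · exact (h p.down).elim
  · exact h.eq_of_src _ _

/-- The short complex of the brutal truncations. -/
noncomputable def truncationShortComplex (a : ℤ) : ShortComplex (CochainComplex C ℤ) where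
  X₁ := restrictDegrees K {i | a < i}
  X₂ := K
  X₃ := restrictDegrees K {i | i ≤ a}
  f :=
    { f := fun i => biproduct.desc fun _ => 𝟙 _
      comm' := fun i j hij => by
        refine biproduct.hom_ext' _ _ fun p => ?_
        have hp : a < i := p.down
        have hij : i + 1 = j := hij
        have hj : a < j := by lia
        simp [restrictDegrees, biproduct.ι_matrix_assoc,
          biproduct_lift_desc_of_unique (PLift.up hj)] }
  g :=
    { f := fun i => biproduct.lift fun _ => 𝟙 _
      comm' := fun i j hij => by
        refine biproduct.hom_ext _ _ fun p => ?_
        have hp : j ≤ a := p.down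
        have hij : i + 1 = j := hij
        have hi : i ≤ a := by lia
        simp [restrictDegrees, biproduct.matrix_π,
          biproduct_lift_desc_of_unique (PLift.up hi)] }
  zero := by
    ext i
    refine biproduct.hom_ext _ _ fun p => biproduct.hom_ext' _ _ fun q => ?_
    have hp : i ≤ a := p.down
    have hq : a < i := q.down
    exact (not_lt_of_ge hp hq).elim

/-- The degreewise splitting of the brutal truncations. -/
noncomputable def truncationSplitting (a n : ℤ) :
    ((truncationShortComplex K a).map (HomologicalComplex.eval C _ n)).Splitting where
  r := biproduct.lift fun _ => 𝟙 _
  s := biproduct.desc fun _ => 𝟙 _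
  f_r := biproduct_desc_lift_id _
  s_g := biproduct_desc_lift_id _
  id := by
    change (biproduct.lift fun _ : PLift (a < n) => 𝟙 (K.X n)) ≫ (biproduct.desc fun _ => 𝟙 _) +
      (biproduct.lift fun _ : PLift (n ≤ a) => 𝟙 (K.X n)) ≫ (biproduct.desc fun _ => 𝟙 _) = 𝟙 _
    rcases lt_or_ge a n with h | h
    · have h2 : IsEmpty (PLift (n ≤ a)) := ⟨fun p => not_lt_of_ge p.down h⟩
      rw [biproduct_lift_desc_of_unique (PLift.up h), biproduct.hom_ext (biproduct.lift
        fun _ : PLift (n ≤ a) => 𝟙 (K.X n)) 0 fun p => h2.elim p]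
      simp
    · have h2 : IsEmpty (PLift (a < n)) := ⟨fun p => not_lt_of_ge h p.down⟩
      rw [biproduct_lift_desc_of_unique (PLift.up h), biproduct.hom_ext (biproduct.lift
        fun _ : PLift (a < n) => 𝟙 (K.X n)) 0 fun p => h2.elim p]
      simp

end Truncation

lemma exists_dist_of_degreewiseSplit (S : ShortComplex (CochainComplex C ℤ))
    (σ : ∀ n, (S.map (HomologicalComplex.eval C _ n)).Splitting) (h₁) (h₂) (h₃) :
    ∃ (f : Kb.mk S.X₁ h₁ ⟶ Kb.mk S.X₂ h₂) (g : Kb.mk S.X₂ h₂ ⟶ Kb.mk S.X₃ h₃) (h : _),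
      Triangle.mk f g h ∈ distTriang (Kb C) :=
  ⟨ObjectProperty.homMk ((HomotopyCategory.quotient C _).map S.f),
    ObjectProperty.homMk ((HomotopyCategory.quotient C _).map S.g), exists_dist_of_ι _ _ _
    ((HomotopyCategory.distinguished_iff_iso_trianglehOfDegreewiseSplit _).2
      ⟨S, σ, ⟨Iso.refl _⟩⟩)⟩

omit [HasBinaryBiproducts C] in
/-- A single complex is a shifted stalk complex. -/
lemma exists_iso_stalk_shift (M : C) (n : ℤ) :
    Nonempty (((stalk C).obj M)⟦-n⟧ ≅
      Kb.mk ((CochainComplex.singleFunctor C n).obj M) (Kb.single_bound M n)) := by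
  refine ⟨Kb.mkShiftIso _ (Kb.single_bound M 0) (-n) (Kb.exists_bound_shift
    (Kb.single_bound M 0) (-n)) ≪≫ ObjectProperty.isoMk _
    ((HomotopyCategory.quotient C _).mapIso
      (((CochainComplex.singleFunctors C).shiftIso (-n) n 0 (by lia)).app M))⟩

/-- The bounded homotopy category is generated by the stalk complexes. -/
lemma prop_of_stalk [HasFiniteBiproducts C] (P : ObjectProperty (Kb C)) [P.IsTriangulated]
    [P.IsClosedUnderIsomorphisms] (hP : ∀ M : C, P ((stalk C).obj M)) (X : Kb C) : P X := by
  have hs (K : CochainComplex C ℤ) (h) (a : ℤ) (_ : K.IsStrictlyGE a) (_ : K.IsStrictlyLE a) :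
      P (Kb.mk K h) := by
    obtain ⟨M, ⟨e⟩⟩ := K.exists_iso_single a
    obtain ⟨e'⟩ := exists_iso_stalk_shift M a
    exact P.prop_of_iso (e' ≪≫ (ObjectProperty.isoMk _
      ((HomotopyCategory.quotient C _).mapIso e.symm))) (P.le_shift (-a) _ (hP M))
  have hn (n : ℕ) : ∀ (K : CochainComplex C ℤ) (h) (a : ℤ) (_ : K.IsStrictlyGE a)
      (_ : K.IsStrictlyLE (a + n)), P (Kb.mk K h) := by
    induction n with
    | zero => exact fun K h a h1 h2 => hs K h a h1 (by simpa using h2)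
    | succ n ih =>
      intro K h a h1 h2
      have h3 : (restrictDegrees K {i | a < i}).IsStrictlyGE (a + 1) :=
        (CochainComplex.isStrictlyGE_iff _ _).2 fun i hi =>
          isZero_restrictDegrees_X K (.inl fun (hai : a < i) => by lia)
      have h4 : (restrictDegrees K {i | a < i}).IsStrictlyLE (a + 1 + n) :=
        (CochainComplex.isStrictlyLE_iff _ _).2 fun i hi =>
          isZero_restrictDegrees_X K (.inr
            (K.isZero_of_isStrictlyLE (a + (n + 1 : ℕ)) i (by push_cast; lia)))
      have h5 : (restrictDegrees K {i | i ≤ a}).IsStrictlyGE a :=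
        (CochainComplex.isStrictlyGE_iff _ _).2 fun i hi =>
          isZero_restrictDegrees_X K (.inr (K.isZero_of_isStrictlyGE a i hi))
      have h6 : (restrictDegrees K {i | i ≤ a}).IsStrictlyLE a :=
        (CochainComplex.isStrictlyLE_iff _ _).2 fun i hi =>
          isZero_restrictDegrees_X K (.inl fun (hai : i ≤ a) => by lia)
      have h34 : ∃ a' b', (restrictDegrees K {i | a < i}).IsStrictlyGE a' ∧
        (restrictDegrees K {i | a < i}).IsStrictlyLE b' := ⟨_, _, h3, h4⟩
      have h56 : ∃ a' b', (restrictDegrees K {i | i ≤ a}).IsStrictlyGE a' ∧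
        (restrictDegrees K {i | i ≤ a}).IsStrictlyLE b' := ⟨_, _, h5, h6⟩
      -- The lowest degree is split off as a quotient; the subcomplex above it has amplitude one
      -- less.
      obtain ⟨f, g, t, ht⟩ := exists_dist_of_degreewiseSplit (truncationShortComplex K a)
        (truncationSplitting K a) h34 h h56
      exact P.ext_of_isTriangulatedClosed₂ _ ht (ih _ h34 _ h3 h4) (hs _ h56 _ h5 h6)
  obtain ⟨K, ⟨a, b, h1, h2⟩, rfl⟩ := exists_iso_kbMk X
  refine hn (b - a).toNat K _ a h1 ((CochainComplex.isStrictlyLE_iff _ _).2 fun i hi =>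
    K.isZero_of_isStrictlyLE b i (by lia))

end Bounded

lemma InAdd.prop {𝒯 : Type u} [Category.{v} 𝒯] [HasZeroObject 𝒯] [Preadditive 𝒯] [HasShift 𝒯 ℤ]
    [∀ n : ℤ, (shiftFunctor 𝒯 n).Additive] [Pretriangulated 𝒯] {M X : 𝒯} (h : InAdd M X)
    (P : ObjectProperty 𝒯) [P.IsTriangulated] [P.IsStableUnderRetracts]
    (hM : P M) : P X := by
  obtain ⟨n, ⟨ρ⟩⟩ := h
  exact P.prop_of_retract ρ (P.prop_of_iso (biproduct.isoProduct _).symm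
    (P.prop_pi _ fun _ => hM))

/-- A generator of an additive category is silting in the bounded homotopy category. -/
lemma isSilting_stalk {C : Type u} [Category.{v} C] [Preadditive C] [HasZeroObject C]
    [HasBinaryBiproducts C] [HasFiniteBiproducts C] (A : C)
    (hA : ∀ M : C, InAdd ((stalk C).obj A) ((stalk C).obj M)) : IsSilting ((stalk C).obj A) :=
  ⟨geq_stalk A A, fun X P _ _ hPA => prop_of_stalk P (fun M => (hA M).prop P hPA) X⟩

end Silting

/-! ### Finiteness, idempotents and Fitting decompositions -/

namespace Silting

section Finite

variable {K : Type w} [Field K]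

/-- Finite dimensionality of the morphism spaces out of `A` and its shifts is inherited by the
thick subcategory generated by a silting object. -/
lemma IsSilting.finite_hom {𝒯 : Type u} [Category.{v} 𝒯] [HasZeroObject 𝒯] [Preadditive 𝒯]
    [HasShift 𝒯 ℤ] [∀ n : ℤ, (shiftFunctor 𝒯 n).Additive] [Pretriangulated 𝒯] [Linear K 𝒯]
    {A : 𝒯} (hA : IsSilting A) (h : ∀ i : ℤ, Module.Finite K (A ⟶ A⟦i⟧)) (X : 𝒯) :
    Module.Finite K (A ⟶ X) := by
  have hret {X Y : 𝒯} (ρ : Retract X Y) (_ : Module.Finite K (A ⟶ Y)) :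
      Module.Finite K (A ⟶ X) :=
    Module.Finite.of_injective (Linear.rightComp K A ρ.i) fun f g hfg => by
      have := congr_arg (· ≫ ρ.r) hfg
      simpa using this
  have hX : ∀ i : ℤ, Module.Finite K (A ⟶ X⟦i⟧) := by
    refine thick_induction (A := A) (fun X => ∀ i : ℤ, Module.Finite K (A ⟶ X⟦i⟧))
      ?_ ?_ ?_ ?_ h (hA.2 X)
    · exact fun ρ H i => hret (ρ.map (shiftFunctor 𝒯 i)) (H i)
    · exact fun X n H i => hret (.ofIso ((shiftFunctorAdd 𝒯 n i).symm.app X)) (H (n + i))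
    · intro X hX i
      have : Subsingleton (A ⟶ X⟦i⟧) :=
        ⟨fun f g => ((shiftFunctor 𝒯 i).map_isZero hX).eq_of_tgt f g⟩
      infer_instance
    · intro T hT H₁ H₃ i
      have hT' := Triangle.shift_distinguished T hT i
      set T' := (Triangle.shiftFunctor 𝒯 i).obj T
      have h1 : Module.Finite K (A ⟶ T'.obj₁) := H₁ i
      have h3 : Module.Finite K (A ⟶ T'.obj₃) := H₃ i
      -- The middle term of an exact sequence of vector spaces with finite-dimensional ends is
      -- finite-dimensional.
      have : IsNoetherian K (A ⟶ T'.obj₂) := by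
        refine isNoetherian_of_range_eq_ker (Linear.rightComp K A T'.mor₁)
          (Linear.rightComp K A T'.mor₂) (le_antisymm ?_ fun f hf => ?_)
        · rintro _ ⟨f, rfl⟩
          have h0 : T'.mor₁ ≫ T'.mor₂ = 0 := comp_distTriang_mor_zero₁₂ _ hT'
          simp [h0]
        · obtain ⟨g, hg⟩ := Triangle.coyoneda_exact₂ _ hT' f hf
          exact ⟨g, hg.symm⟩
      exact inferInstanceAs (Module.Finite K (A ⟶ T'.obj₂))
  exact hret (.ofIso ((shiftFunctorZero 𝒯 ℤ).symm.app X)) (hX 0)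

variable {C : Type u} [Category.{v} C] [Preadditive C] [HasZeroObject C] [Linear K C]
  [HasBinaryBiproducts C]

instance : (stalk C).Linear K where
  map_smul f r := ObjectProperty.hom_ext _ ((HomotopyCategory.singleFunctor C 0).map_smul r f)

lemma finite_hom_stalk {A : C} (hA : IsSilting ((stalk C).obj A)) [Module.Finite K (A ⟶ A)]
    (X : Kb C) : Module.Finite K ((stalk C).obj A ⟶ X) := by
  refine hA.finite_hom (fun i => ?_) X
  by_cases hi : i = 0
  · subst hi
    have e := (shiftFunctorZero (Kb C) ℤ).symm.app ((stalk C).obj A)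
    refine Module.Finite.of_surjective (Linear.rightComp K _ e.hom ∘ₗ (stalk C).mapLinearMap K)
      fun f => ?_
    obtain ⟨g, hg⟩ := (stalk C).map_surjective (f ≫ e.inv)
    exact ⟨g, by simp [hg]⟩
  · have : Subsingleton ((stalk C).obj A ⟶ ((stalk C).obj A)⟦i⟧) :=
      ⟨fun f g => (homZero_stalk_shift A A i hi f).trans (homZero_stalk_shift A A i hi g).symm⟩
    infer_instance

end Finite

section Stalk

variable {C : Type u} [Category.{v} C] [Preadditive C] [HasZeroObject C]
  [HasBinaryBiproducts C]

/-- A summand of a stalk complex is given by an idempotent, which descends along the fully faithful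
stalk functor and splits in `C`. -/
lemma exists_iso_stalk_of_inAdd [HasFiniteBiproducts C] [IsIdempotentComplete C] {A : C} {X : Kb C}
    (h : InAdd ((stalk C).obj A) X) : ∃ M : C, Nonempty (X ≅ (stalk C).obj M) := by
  obtain ⟨n, ⟨ρ⟩⟩ := h
  have e : (stalk C).obj (⨁ fun _ : Fin n => A) ≅ ⨁ fun _ : Fin n => (stalk C).obj A :=
    (stalk C).mapBiproduct _
  have ρ' : Retract X ((stalk C).obj (⨁ fun _ : Fin n => A)) := ρ.trans (.ofIso e.symm)
  obtain ⟨p, hp⟩ := (stalk C).map_surjective (ρ'.r ≫ ρ'.i)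
  obtain ⟨M, i, r, hir, hri⟩ := IsIdempotentComplete.idempotents_split _ p
    ((stalk C).map_injective (by simp [hp]))
  refine ⟨M, ⟨⟨ρ'.i ≫ (stalk C).map r, (stalk C).map i ≫ ρ'.r, ?_, ?_⟩⟩⟩
  · simp [← Functor.map_comp_assoc, hri, hp]
  · have : (stalk C).map i ≫ (ρ'.r ≫ ρ'.i) ≫ (stalk C).map r = 𝟙 _ := by
      rw [← hp, ← Functor.map_comp, ← Functor.map_comp, ← hri]
      simp [hir]
    simpa using this

omit [Preadditive C] [HasZeroObject C] [HasBinaryBiproducts C] in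
lemma iterateHom_map {D : Type*} [Category* D] (F : C ⥤ D) {X : C} (h : X ⟶ X) (n : ℕ) :
    iterateHom (F.map h) n = F.map (iterateHom h n) := by
  induction n with
  | zero => simp [iterateHom]
  | succ n ih => simp [iterateHom, ih]

omit [Preadditive C] [HasZeroObject C] [HasBinaryBiproducts C] in
lemma iterateHom_conj {X Y : C} (e : X ≅ Y) (h : X ⟶ X) (n : ℕ) :
    iterateHom (e.inv ≫ h ≫ e.hom) n = e.inv ≫ iterateHom h n ≫ e.hom := by
  induction n with
  | zero => simp [iterateHom]
  | succ n ih => simp [iterateHom, ih]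

lemma fittingProperty_stalk [HasFiniteBiproducts C] [IsIdempotentComplete C] (A : C)
    (hF : ∀ (X : C) (h : X ⟶ X), IsIso h ∨ ∃ (Y : C) (ρ : Retract Y X) (n : ℕ), ¬ IsIso ρ.r ∧
      iterateHom h n ≫ ρ.r ≫ ρ.i = iterateHom h n ∧
      ρ.r ≫ ρ.i ≫ iterateHom h n = iterateHom h n) :
    FittingProperty ((stalk C).obj A) := by
  intro X hX h
  obtain ⟨M, ⟨e⟩⟩ := exists_iso_stalk_of_inAdd hX
  obtain ⟨g, hg⟩ := (stalk C).map_surjective (e.inv ≫ h ≫ e.hom)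
  have hh : h = e.hom ≫ (stalk C).map g ≫ e.inv := by simp [hg]
  rcases hF M g with hi | ⟨Y, ρ, n, h1, h2, h3⟩
  · left
    rw [hh]
    infer_instance
  · right
    have hit : iterateHom h n = e.hom ≫ (stalk C).map (iterateHom g n) ≫ e.inv := by
      rw [hh, ← iterateHom_map]
      exact iterateHom_conj e.symm ((stalk C).map g) n
    refine ⟨(stalk C).obj Y, (ρ.map (stalk C)).trans (.ofIso e.symm), n, fun hi => h1 ?_, ?_, ?_⟩
    · have : IsIso (e.hom ≫ (stalk C).map ρ.r) := hi
      have : IsIso ((stalk C).map ρ.r) := IsIso.of_isIso_comp_left e.hom _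
      exact isIso_of_reflects_iso ρ.r (stalk C)
    · rw [hit]
      conv_rhs => rw [← h2]
      simp [Retract.ofIso]
    · rw [hit]
      conv_rhs => rw [← h3]
      simp [Retract.ofIso]

omit [HasBinaryBiproducts C] in
lemma isLocalObj_stalk {P : C} (h0 : ¬ IsZero P)
    (hP : ∀ f : P ⟶ P, IsIso f ∨ IsIso (𝟙 P - f)) : IsLocalObj ((stalk C).obj P) := by
  refine ⟨fun h => h0 ?_, fun f => ?_⟩
  · rw [IsZero.iff_id_eq_zero] at h ⊢
    exact (stalk C).map_injective (by simpa using h)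
  · obtain ⟨g, rfl⟩ := (stalk C).map_surjective f
    rw [← (stalk C).map_id, ← (stalk C).map_sub]
    exact (hP g).imp (fun (_ : IsIso g) => inferInstance)
      fun (_ : IsIso (𝟙 P - g)) => inferInstance

end Stalk

/-! ### Finitely generated projective modules over an artinian algebra -/

section Modules

variable {Λ : Type u} [Ring Λ]

/-- Morphisms of projective modules are linear maps. -/
def Proj.homEquiv (X Y : Proj Λ) : (X ⟶ Y) ≃+ (X.obj →ₗ[Λ] Y.obj) where
  toFun f := f.hom.hom
  invFun f := ObjectProperty.homMk (ModuleCat.ofHom f)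
  left_inv _ := rfl
  right_inv _ := rfl
  map_add' _ _ := rfl

/-- The linear endomorphism underlying an endomorphism of a projective module. -/
def Proj.toEnd {X : Proj Λ} (h : X ⟶ X) : Module.End Λ X.obj := h.hom.hom

lemma Proj.toEnd_iterateHom {X : Proj Λ} (h : X ⟶ X) (n : ℕ) :
    Proj.toEnd (iterateHom h n) = Proj.toEnd h ^ n := by
  induction n with
  | zero => rfl
  | succ n ih => rw [pow_succ, ← ih]; rfl

lemma Proj.isIso_of_bijective {X Y : Proj Λ} (h : X ⟶ Y)
    (H : Function.Bijective h.hom.hom) : IsIso h := by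
  have : IsIso ((fgProj Λ).ι.map h) :=
    (ConcreteCategory.isIso_iff_bijective (C := ModuleCat Λ) h.hom).2 H
  exact isIso_of_reflects_iso h (fgProj Λ).ι

lemma Proj.bijective_of_isIso {X Y : Proj Λ} (h : X ⟶ Y) [IsIso h] :
    Function.Bijective h.hom.hom :=
  (ConcreteCategory.isIso_iff_bijective (C := ModuleCat Λ) h.hom).1
    (inferInstanceAs (IsIso ((fgProj Λ).ι.map h)))

/-- The range of an idempotent endomorphism of a projective module is a retract. -/
lemma Proj.exists_retract {X : Proj Λ} (e : Module.End Λ X.obj) (he : e * e = e) :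
    ∃ (Y : Proj Λ) (ρ : Retract Y X), (ρ.r ≫ ρ.i).hom.hom = e := by
  obtain ⟨X, hX, hX'⟩ := X
  have h1 : e.rangeRestrict ∘ₗ e.range.subtype = LinearMap.id := by
    ext ⟨_, ⟨x, rfl⟩⟩
    exact LinearMap.congr_fun he x
  have hf : Module.Finite Λ e.range := Module.Finite.range e
  have hp : Module.Projective Λ e.range := .of_split _ _ h1
  refine ⟨Proj.of Λ e.range, ⟨ObjectProperty.homMk (ModuleCat.ofHom e.range.subtype),
    ObjectProperty.homMk (ModuleCat.ofHom e.rangeRestrict), ?_⟩, ?_⟩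
  · refine ObjectProperty.hom_ext _ (ModuleCat.hom_ext h1)
  · rfl

instance : IsIdempotentComplete (Proj Λ) where
  idempotents_split X p hp := by
    obtain ⟨Y, ρ, h⟩ := Proj.exists_retract (Proj.toEnd p)
      (congr_arg (fun q => Proj.toEnd q) hp)
    exact ⟨Y, ρ.i, ρ.r, ρ.retract, ObjectProperty.hom_ext _ (ModuleCat.hom_ext h)⟩

variable [IsArtinianRing Λ]

lemma exists_isCompl_ker_range (X : Proj Λ) (f : Module.End Λ X.obj) :
    ∃ n : ℕ, n ≠ 0 ∧ IsCompl (LinearMap.ker (f ^ n)) (LinearMap.range (f ^ n)) := by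
  obtain ⟨X, hX, hX'⟩ := X
  obtain ⟨n, hn⟩ := Filter.eventually_atTop.1 f.eventually_isCompl_ker_pow_range_pow
  exact ⟨n + 1, n.succ_ne_zero, hn _ n.le_succ⟩

omit [IsArtinianRing Λ] in
lemma bijective_of_ker_pow_eq_bot {M : Type u} [AddCommGroup M] [Module Λ M]
    {f : Module.End Λ M} {n : ℕ} (hn : n ≠ 0)
    (h : IsCompl (LinearMap.ker (f ^ n)) (LinearMap.range (f ^ n)))
    (h0 : LinearMap.ker (f ^ n) = ⊥) : Function.Bijective f := by
  have h1 : LinearMap.range (f ^ n) = ⊤ := by simpa [h0] using h.sup_eq_top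
  obtain ⟨m, rfl⟩ := Nat.exists_eq_succ_of_ne_zero hn
  refine (Module.End.isUnit_iff f).1 ((isUnit_pow_iff hn).1 ((Module.End.isUnit_iff _).2
    ⟨LinearMap.ker_eq_bot.1 h0, LinearMap.range_eq_top.1 h1⟩))

lemma Proj.fitting (X : Proj Λ) (h : X ⟶ X) :
    IsIso h ∨ ∃ (Y : Proj Λ) (ρ : Retract Y X) (n : ℕ), ¬ IsIso ρ.r ∧
      iterateHom h n ≫ ρ.r ≫ ρ.i = iterateHom h n ∧
      ρ.r ≫ ρ.i ≫ iterateHom h n = iterateHom h n := by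
  obtain ⟨n, hn, hc⟩ := exists_isCompl_ker_range X (Proj.toEnd h)
  set g := Proj.toEnd h ^ n with hg
  by_cases h0 : LinearMap.ker g = ⊥
  · exact .inl (Proj.isIso_of_bijective h (bijective_of_ker_pow_eq_bot hn hc h0))
  · right
    -- The summand is the image of a high power of `h`, split off along the kernel; it is proper
    -- because that kernel is nonzero.
    let e : Module.End Λ X.obj := Submodule.projection _ _ hc.symm
    have he (x : X.obj) : e (e x) = e x :=
      Submodule.projection_apply_of_mem_left hc.symm (Submodule.projection_apply_mem hc.symm x)
    obtain ⟨Y, ρ, hρ⟩ := Proj.exists_retract e (LinearMap.ext he)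
    refine ⟨Y, ρ, n, fun hi => h0 ?_, ?_, ?_⟩
    · have h1 : IsIso (ρ.r ≫ ρ.i) := by
        have : ρ.i = inv ρ.r := by rw [← cancel_mono ρ.r]; simp
        rw [this]
        infer_instance
      have h2 := (Proj.bijective_of_isIso (ρ.r ≫ ρ.i)).1
      rw [hρ] at h2
      rw [← Submodule.ker_projection hc.symm]
      exact LinearMap.ker_eq_bot.2 h2
    · refine ObjectProperty.hom_ext _ (ModuleCat.hom_ext ?_)
      change (ρ.r ≫ ρ.i).hom.hom ∘ₗ Proj.toEnd (iterateHom h n) = Proj.toEnd (iterateHom h n)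
      rw [hρ, Proj.toEnd_iterateHom]
      exact LinearMap.ext fun x => Submodule.projection_apply_of_mem_left hc.symm ⟨x, rfl⟩
    · refine ObjectProperty.hom_ext _ (ModuleCat.hom_ext ?_)
      change Proj.toEnd (iterateHom h n) ∘ₗ (ρ.r ≫ ρ.i).hom.hom = Proj.toEnd (iterateHom h n)
      rw [hρ, Proj.toEnd_iterateHom]
      refine LinearMap.ext fun x => sub_eq_zero.1 ?_
      change g (e x) - g x = 0
      rw [← map_sub, ← LinearMap.mem_ker, ← Submodule.projection_apply_eq_zero_iff hc.symm]
      change e (e x - x) = 0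
      rw [map_sub, he, sub_self]

/-- By Fitting's lemma a high power of `f` has zero kernel or zero image, so `f` is bijective or
nilpotent; in the latter case `1 - f` is a unit. -/
lemma isIso_or_isIso_one_sub_of_indecomposable (X : Proj Λ)
    (hX : IsIndecomposableModule Λ X.obj) (f : X ⟶ X) : IsIso f ∨ IsIso (𝟙 X - f) := by
  obtain ⟨n, hn, hc⟩ := exists_isCompl_ker_range X (Proj.toEnd f)
  rcases hX.2 _ _ hc with h0 | h0
  · exact .inl (Proj.isIso_of_bijective f (bijective_of_ker_pow_eq_bot hn hc h0))
  · right
    have h1 : IsNilpotent (Proj.toEnd f) := ⟨n, LinearMap.range_eq_bot.1 h0⟩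
    exact Proj.isIso_of_bijective _ ((Module.End.isUnit_iff _).1 h1.isUnit_one_sub)

omit [IsArtinianRing Λ] in
lemma Proj.not_isZero (X : Proj Λ) [Nontrivial X.obj] : ¬ IsZero X := fun h => by
  obtain ⟨x, hx⟩ := exists_ne (0 : X.obj)
  rw [IsZero.iff_id_eq_zero] at h
  exact hx (LinearMap.congr_fun (congr_arg (fun f => Proj.toEnd f) h) x)

omit [IsArtinianRing Λ] in
/-- Every finitely generated projective module is in the additive closure of the algebra. -/
lemma inAdd_stalk_regular (M : Proj Λ) : InAdd (Perf.of Λ Λ) ((stalk (Proj Λ)).obj M) := by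
  have := M.property.1
  have := M.property.2
  obtain ⟨n, f, g, -, -, hfg⟩ := Module.Finite.exists_comp_eq_id_of_projective Λ M.obj
  let i (k : Fin n) : M ⟶ Proj.of Λ Λ := (Proj.homEquiv M (Proj.of Λ Λ)).symm
    (LinearMap.proj (R := Λ) (φ := fun _ : Fin n => Λ) k ∘ₗ g)
  let r (k : Fin n) : Proj.of Λ Λ ⟶ M := (Proj.homEquiv (Proj.of Λ Λ) M).symm
    (f ∘ₗ LinearMap.single Λ (fun _ : Fin n => Λ) k)
  have h : ∑ k, i k ≫ r k = 𝟙 M := by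
    apply (Proj.homEquiv M M).injective
    rw [map_sum]
    refine LinearMap.ext fun x => ?_
    rw [LinearMap.sum_apply]
    change ∑ k, f (Pi.single k (g x k)) = x
    rw [← map_sum, Finset.univ_sum_single]
    exact LinearMap.congr_fun hfg x
  refine inAdd_of_sum (fun k => (stalk (Proj Λ)).map (i k))
    (fun k => (stalk (Proj Λ)).map (r k)) ?_
  rw [← (stalk (Proj Λ)).map_id, ← h, Functor.map_sum]
  exact Finset.sum_congr rfl fun k _ => (Functor.map_comp _ _ _).symm

variable (Λ) in
omit [IsArtinianRing Λ] in
lemma isSilting_regular : IsSilting (Perf.of Λ Λ) :=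
  isSilting_stalk (Proj.of Λ Λ) inAdd_stalk_regular

variable (Λ) in
lemma fittingProperty_regular : FittingProperty (Perf.of Λ Λ) :=
  fittingProperty_stalk (Proj.of Λ Λ) Proj.fitting

lemma isLocalObj_perf_of {P : Type u} [AddCommGroup P] [Module Λ P] [Module.Finite Λ P]
    [Module.Projective Λ P] (hP : IsIndecomposableModule Λ P) : IsLocalObj (Perf.of Λ P) := by
  have : Nontrivial (Proj.of Λ P).obj := hP.1
  exact isLocalObj_stalk (Proj.not_isZero (Proj.of Λ P))
    (isIso_or_isIso_one_sub_of_indecomposable (Proj.of Λ P) hP)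

omit [IsArtinianRing Λ] in
lemma finite_hom_perf (K : Type w) [Field K] [Algebra K Λ] [FiniteDimensional K Λ] (X : Perf Λ) :
    Module.Finite K (Perf.of Λ Λ ⟶ X) := by
  have : Module.Finite K (Proj.of Λ Λ ⟶ Proj.of Λ Λ) := by
    let φ : (Proj.of Λ Λ ⟶ Proj.of Λ Λ) →ₗ[K] Λ :=
      { toFun := fun f => show Λ from Proj.toEnd f (1 : Λ)
        map_add' := fun f g => rfl
        map_smul' := fun c f => by
          rw [RingHom.id_apply, Algebra.smul_def]
          rfl }
    exact Module.Finite.of_injective φ fun f g h =>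
      ObjectProperty.hom_ext _ (ModuleCat.hom_ext (LinearMap.ext_ring h))
  exact finite_hom_stalk (isSilting_regular Λ) X

end Modules

end Silting

/-! ### From an anti-equivalence to a duality on bounded complexes -/

namespace Silting

open Opposite

section Duality

variable {C : Type u} [Category.{v} C] [Preadditive C] (E : Cᵒᵖ ⥤ C) [E.Additive]

/-- The contravariant functor on complexes induced by a contravariant functor. -/
noncomputable def dualComplex : (CochainComplex C ℤ)ᵒᵖ ⥤ CochainComplex C ℤ :=
  (CochainComplex.opEquivalence C).functor ⋙ E.mapHomologicalComplex (ComplexShape.up ℤ)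

instance [E.Full] [E.Faithful] : (dualComplex E).Full := by
  unfold dualComplex
  infer_instance

instance : (dualComplex E).Additive where
  map_add {X Y f g} := by
    ext n
    exact E.map_add (f := (f.unop.f (-n)).op) (g := (g.unop.f (-n)).op)

/-- The dual of a homotopy. -/
noncomputable def dualHomotopy {K L : CochainComplex C ℤ} {f g : K ⟶ L} (h : Homotopy f g) :
    Homotopy ((dualComplex E).map f.op) ((dualComplex E).map g.op) :=
  E.mapHomotopy (CochainComplex.homotopyOp h)

/-- The contravariant functor on homotopy categories induced by a contravariant functor. -/
noncomputable def dualHomotopyCategory : (HomotopyCategory C (ComplexShape.up ℤ))ᵒᵖ ⥤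
    HomotopyCategory C (ComplexShape.up ℤ) :=
  (CategoryTheory.Quotient.lift _ ((dualComplex E).rightOp ⋙
    (HomotopyCategory.quotient C (ComplexShape.up ℤ)).op) (by
      rintro K L f g ⟨h⟩
      exact congr_arg Quiver.Hom.op (HomotopyCategory.eq_of_homotopy _ _
        (dualHomotopy E h)))).leftOp

instance [E.Full] [E.Faithful] : (dualHomotopyCategory E).Full where
  map_surjective {X Y} f := by
    obtain ⟨K, hK⟩ := HomotopyCategory.quotient_obj_surjective X.unop
    obtain ⟨L, hL⟩ := HomotopyCategory.quotient_obj_surjective Y.unop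
    obtain rfl : X = op _ := congr_arg op hK.symm
    obtain rfl : Y = op _ := congr_arg op hL.symm
    obtain ⟨g, rfl⟩ := (HomotopyCategory.quotient C (ComplexShape.up ℤ)).map_surjective f
    obtain ⟨h, rfl⟩ := (dualComplex E).map_surjective (X := op K) (Y := op L) g
    exact ⟨((HomotopyCategory.quotient C (ComplexShape.up ℤ)).map h.unop).op, rfl⟩

instance [E.Full] [E.Faithful] : (dualHomotopyCategory E).Faithful where
  map_injective {X Y} f g hfg := by
    obtain ⟨K, hK⟩ := HomotopyCategory.quotient_obj_surjective X.unop
    obtain ⟨L, hL⟩ := HomotopyCategory.quotient_obj_surjective Y.unop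
    obtain rfl : X = op _ := congr_arg op hK.symm
    obtain rfl : Y = op _ := congr_arg op hL.symm
    obtain ⟨f', hf⟩ := (HomotopyCategory.quotient C (ComplexShape.up ℤ)).map_surjective f.unop
    obtain ⟨g', hg⟩ := (HomotopyCategory.quotient C (ComplexShape.up ℤ)).map_surjective g.unop
    obtain rfl : f = Quiver.Hom.op _ := congr_arg Quiver.Hom.op hf.symm
    obtain rfl : g = Quiver.Hom.op _ := congr_arg Quiver.Hom.op hg.symm
    have h1 := HomotopyCategory.homotopyOfEq _ _ hfg
    exact congr_arg Quiver.Hom.op (HomotopyCategory.eq_of_homotopy _ _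
      (CochainComplex.homotopyUnop (E.preimageHomotopy h1)))

instance : (dualHomotopyCategory E).Additive where
  map_add {X Y f g} := by
    obtain ⟨f', hf⟩ := (HomotopyCategory.quotient C (ComplexShape.up ℤ)).map_surjective f.unop
    obtain ⟨g', hg⟩ := (HomotopyCategory.quotient C (ComplexShape.up ℤ)).map_surjective g.unop
    obtain rfl : f = Quiver.Hom.op _ := congr_arg Quiver.Hom.op hf.symm
    obtain rfl : g = Quiver.Hom.op _ := congr_arg Quiver.Hom.op hg.symm
    let Q := HomotopyCategory.quotient C (ComplexShape.up ℤ)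
    exact (congrArg (fun k => (dualHomotopyCategory E).map (Quiver.Hom.op k))
      (Q.map_add (f := f') (g := g')).symm).trans
      ((congrArg (fun k => Q.map k) ((dualComplex E).map_add (f := f'.op) (g := g'.op))).trans
        Q.map_add)

lemma isZero_dual_X {K : CochainComplex C ℤ} {n : ℤ} (h : IsZero (K.X (-n))) :
    IsZero (((dualComplex E).obj (op K)).X n) :=
  E.map_isZero h.op

lemma dualComplex_bounded {K : CochainComplex C ℤ}
    (h : ∃ a b : ℤ, K.IsStrictlyGE a ∧ K.IsStrictlyLE b) :
    ∃ a b : ℤ, ((dualComplex E).obj (op K)).IsStrictlyGE a ∧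
      ((dualComplex E).obj (op K)).IsStrictlyLE b := by
  obtain ⟨a, b, _, _⟩ := h
  refine ⟨-b, -a, ?_, ?_⟩
  · rw [CochainComplex.isStrictlyGE_iff]
    exact fun i hi => isZero_dual_X E (K.isZero_of_isStrictlyLE b _ (by lia))
  · rw [CochainComplex.isStrictlyLE_iff]
    exact fun i hi => isZero_dual_X E (K.isZero_of_isStrictlyGE a _ (by lia))

/-- The contravariant functor on bounded homotopy categories induced by a contravariant functor. -/
noncomputable def dualKb : (Kb C)ᵒᵖ ⥤ Kb C :=
  (bounded C).lift ((bounded C).ι.op ⋙ dualHomotopyCategory E) (by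
    intro X
    obtain ⟨K, h, hX⟩ := exists_iso_kbMk X.unop
    obtain rfl : X = op _ := congr_arg op hX
    exact (bounded_quotient_iff _).2 (dualComplex_bounded E h))

instance [E.Full] [E.Faithful] : (dualKb E).Full where
  map_surjective {X Y} f := by
    obtain ⟨g, hg⟩ := (dualHomotopyCategory E).map_surjective (X := op X.unop.obj)
      (Y := op Y.unop.obj) f.hom
    exact ⟨Quiver.Hom.op (ObjectProperty.homMk g.unop), ObjectProperty.hom_ext _ hg⟩

instance [E.Full] [E.Faithful] : (dualKb E).Faithful where
  map_injective h := Quiver.Hom.unop_inj (ObjectProperty.hom_ext _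
    (Quiver.Hom.op_inj ((dualHomotopyCategory E).map_injective (congr_arg (fun k => k.hom) h))))

instance : (dualKb E).Additive where
  map_add := ObjectProperty.hom_ext _ ((dualHomotopyCategory E).map_add (f := Quiver.Hom.op _)
    (g := Quiver.Hom.op _))

instance [E.Full] [E.Faithful] [E.EssSurj] : (dualComplex E).EssSurj := by
  have : E.IsEquivalence := {}
  have : (E.mapHomologicalComplex (ComplexShape.up ℤ)).IsEquivalence :=
    (E.asEquivalence.mapHomologicalComplex (ComplexShape.up ℤ)).isEquivalence_functor
  unfold dualComplex
  infer_instance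

/-- Isomorphic complexes give isomorphic objects of the bounded homotopy category. -/
noncomputable def Kb.mkIso {K L : CochainComplex C ℤ} (e : K ≅ L) (h) (h') :
    Kb.mk K h ≅ Kb.mk L h' :=
  ObjectProperty.isoMk _ ((HomotopyCategory.quotient C _).mapIso e)

lemma Kb.bounded_of_iso {K L : CochainComplex C ℤ} (e : K ≅ L)
    (h : ∃ a b : ℤ, K.IsStrictlyGE a ∧ K.IsStrictlyLE b) :
    ∃ a b : ℤ, L.IsStrictlyGE a ∧ L.IsStrictlyLE b := by
  obtain ⟨a, b, _, _⟩ := h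
  refine ⟨a, b, ?_, ?_⟩
  · rw [CochainComplex.isStrictlyGE_iff]
    exact fun i hi => (K.isZero_of_isStrictlyGE a i hi).of_iso
      ((HomologicalComplex.eval C _ i).mapIso e.symm)
  · rw [CochainComplex.isStrictlyLE_iff]
    exact fun i hi => (K.isZero_of_isStrictlyLE b i hi).of_iso
      ((HomologicalComplex.eval C _ i).mapIso e.symm)

lemma bounded_of_dualComplex_bounded [E.Full] [E.Faithful] {K : CochainComplex C ℤ}
    (h : ∃ a b : ℤ, ((dualComplex E).obj (op K)).IsStrictlyGE a ∧
      ((dualComplex E).obj (op K)).IsStrictlyLE b) :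
    ∃ a b : ℤ, K.IsStrictlyGE a ∧ K.IsStrictlyLE b := by
  have key (i : ℤ) (hi : IsZero (((dualComplex E).obj (op K)).X (-i))) : IsZero (K.X i) := by
    have h1 : IsZero (K.X (- -i)) := by
      rw [IsZero.iff_id_eq_zero] at hi ⊢
      exact Quiver.Hom.op_inj (E.map_injective ((E.map_id _).trans (hi.trans (E.map_zero _ _).symm)))
    rwa [neg_neg] at h1
  obtain ⟨a, b, _, _⟩ := h
  refine ⟨-b, -a, ?_, ?_⟩
  · rw [CochainComplex.isStrictlyGE_iff]
    exact fun i hi => key i (((dualComplex E).obj (op K)).isZero_of_isStrictlyLE b _ (by lia))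
  · rw [CochainComplex.isStrictlyLE_iff]
    exact fun i hi => key i (((dualComplex E).obj (op K)).isZero_of_isStrictlyGE a _ (by lia))

instance [E.Full] [E.Faithful] [E.EssSurj] : (dualKb E).EssSurj where
  mem_essImage Y := by
    obtain ⟨L, h, rfl⟩ := exists_iso_kbMk Y
    let K := (dualComplex E).objPreimage L
    let e : (dualComplex E).obj (op K.unop) ≅ L := (dualComplex E).objObjPreimageIso L
    have hK := bounded_of_dualComplex_bounded E (Kb.bounded_of_iso e.symm h)
    exact ⟨op (Kb.mk K.unop hK), ⟨Kb.mkIso e (dualComplex_bounded E hK) h⟩⟩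

/-- Passing to the dual changes the sign of a shift. -/
noncomputable def dualComplexShiftIso (K : CochainComplex C ℤ) (n : ℤ) :
    (dualComplex E).obj (op (K⟦n⟧)) ≅ ((dualComplex E).obj (op K))⟦-n⟧ :=
  HomologicalComplex.Hom.isoOfComponents
    (fun p => E.mapIso (K.XIsoOfEq (show -(p + -n) = -p + n by lia)).op) (by
      intro i j hij
      -- The shifts by `n` and by `-n` multiply differentials by the same sign, so the degreewise
      -- identifications need no correction.
      have h1 : (K.XIsoOfEq (show -(j + -n) = -j + n by lia)).hom ≫
          (n.negOnePow • K.d (-j + n) (-i + n)) =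
          ((-n).negOnePow • K.d (-(j + -n)) (-(i + -n))) ≫
            (K.XIsoOfEq (show -(i + -n) = -i + n by lia)).hom := by
        simp [Int.negOnePow_neg]
      have h2 : E.map ((-n).negOnePow • K.d (-(j + -n)) (-(i + -n))).op =
          (-n).negOnePow • E.map (K.d (-(j + -n)) (-(i + -n))).op := by
        simp only [Units.smul_def, op_zsmul, Functor.map_zsmul]
      exact (congr_arg (fun k => E.map (K.XIsoOfEq (show -(i + -n) = -i + n by lia)).hom.op ≫ k)
        h2).symm.trans ((E.map_comp _ _).symm.trans
          ((congr_arg (fun k => E.map (Quiver.Hom.op k)) h1).symm.trans (E.map_comp _ _))))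

lemma nonempty_dualKb_shift_iso [HasZeroObject C] [HasBinaryBiproducts C] (X : Kb C) (n : ℤ) :
    Nonempty ((dualKb E).obj (op (X⟦n⟧)) ≅ ((dualKb E).obj (op X))⟦-n⟧) := by
  obtain ⟨K, h, rfl⟩ := exists_iso_kbMk X
  have h1 := Kb.exists_bound_shift h n
  have h2 := Kb.exists_bound_shift (dualComplex_bounded E h) (-n)
  exact ⟨(dualKb E).mapIso (Kb.mkShiftIso K h n h1).symm.op ≪≫
    Kb.mkIso (dualComplexShiftIso E K n) (dualComplex_bounded E h1) h2 ≪≫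
    (Kb.mkShiftIso _ (dualComplex_bounded E h) (-n) h2).symm⟩

/-- The dual of a short complex of complexes. -/
noncomputable def dualShortComplex (S : ShortComplex (CochainComplex C ℤ)) :
    ShortComplex (CochainComplex C ℤ) :=
  S.op.map (dualComplex E)

/-- The dual of a degreewise splitting. -/
noncomputable def dualSplitting {S : ShortComplex (CochainComplex C ℤ)}
    (σ : ∀ n, (S.map (HomologicalComplex.eval C _ n)).Splitting) (n : ℤ) :
    ((dualShortComplex E S).map (HomologicalComplex.eval C _ n)).Splitting :=
  (σ (-n)).op.map E

lemma map_op_comm {𝒞 𝒟 : Type*} [Category* 𝒞] [Category* 𝒟] (F : 𝒞ᵒᵖ ⥤ 𝒟) {W X Y Z : 𝒞}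
    {f : W ⟶ X} {g : X ⟶ Z} {h : W ⟶ Y} {k : Y ⟶ Z} (H : f ≫ g = h ≫ k) :
    F.map g.op ≫ F.map f.op = F.map k.op ≫ F.map h.op := by
  rw [← F.map_comp, ← F.map_comp, ← op_comp, ← op_comp, H]

lemma exists_dist_of_iso {𝒯 : Type u} [Category.{v} 𝒯] [HasZeroObject 𝒯] [Preadditive 𝒯]
    [HasShift 𝒯 ℤ] [∀ n : ℤ, (shiftFunctor 𝒯 n).Additive] [Pretriangulated 𝒯] {T : Triangle 𝒯}
    (hT : T ∈ distTriang 𝒯) {X Y Z : 𝒯} (f : X ⟶ Y) (g : Y ⟶ Z) (e₁ : X ≅ T.obj₁)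
    (e₂ : Y ≅ T.obj₂) (e₃ : Z ≅ T.obj₃) (h₁ : f ≫ e₂.hom = e₁.hom ≫ T.mor₁)
    (h₂ : g ≫ e₃.hom = e₂.hom ≫ T.mor₂) :
    ∃ h : Z ⟶ X⟦(1 : ℤ)⟧, Triangle.mk f g h ∈ distTriang 𝒯 := by
  refine ⟨e₃.hom ≫ T.mor₃ ≫ e₁.inv⟦1⟧', isomorphic_distinguished _ hT _
    (Triangle.isoMk _ _ e₁ e₂ e₃ h₁ h₂ ?_)⟩
  change (e₃.hom ≫ T.mor₃ ≫ (shiftFunctor 𝒯 (1 : ℤ)).map e₁.inv) ≫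
    (shiftFunctor 𝒯 (1 : ℤ)).map e₁.hom = e₃.hom ≫ T.mor₃
  rw [Category.assoc, Category.assoc, ← Functor.map_comp, e₁.inv_hom_id,
    CategoryTheory.Functor.map_id, Category.comp_id]

/-- A contravariant autoequivalence of an additive category induces a duality of its bounded
homotopy category. -/
lemma isDuality_dualKb [HasZeroObject C] [HasBinaryBiproducts C] [E.Full] [E.Faithful]
    [E.EssSurj] : IsDuality (dualKb E) where
  full := inferInstance
  faithful := inferInstance
  essSurj := inferInstance
  additive := inferInstance
  shift := nonempty_dualKb_shift_iso E
  triangle {X Y} g := by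
    obtain ⟨Z, a, b, hT⟩ := distinguished_cocone_triangle g
    obtain ⟨b', hb⟩ := exists_iso_of_dist hT
    -- Up to isomorphism, distinguished triangles come from degreewise split short exact sequences
    -- of complexes, and an additive contravariant functor preserves these while exchanging the
    -- ends.
    obtain ⟨S, σ, ⟨e⟩⟩ :=
      (HomotopyCategory.distinguished_iff_iso_trianglehOfDegreewiseSplit _).1 hb
    have hd := (HomotopyCategory.distinguished_iff_iso_trianglehOfDegreewiseSplit _).2
      ⟨dualShortComplex E S, dualSplitting E σ, ⟨Iso.refl _⟩⟩
    have h₁ : (dualHomotopyCategory E).map a.hom.op ≫ (dualHomotopyCategory E).map e.inv.hom₂.op =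
        (dualHomotopyCategory E).map e.inv.hom₃.op ≫
          (dualHomotopyCategory E).map (CochainComplex.trianglehOfDegreewiseSplit S σ).mor₂.op := by
      exact map_op_comm _ e.inv.comm₂.symm
    have h₂ : (dualHomotopyCategory E).map g.hom.op ≫ (dualHomotopyCategory E).map e.inv.hom₁.op =
        (dualHomotopyCategory E).map e.inv.hom₂.op ≫
          (dualHomotopyCategory E).map (CochainComplex.trianglehOfDegreewiseSplit S σ).mor₁.op := by
      exact map_op_comm _ e.inv.comm₁.symm
    obtain ⟨c, hc⟩ := exists_dist_of_iso hd ((dualHomotopyCategory E).map a.hom.op)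
      ((dualHomotopyCategory E).map g.hom.op)
      ((dualHomotopyCategory E).mapIso (Triangle.π₃.mapIso e).symm.op)
      ((dualHomotopyCategory E).mapIso (Triangle.π₂.mapIso e).symm.op)
      ((dualHomotopyCategory E).mapIso (Triangle.π₁.mapIso e).symm.op)
      h₁ h₂
    obtain ⟨c', hc'⟩ := exists_dist_of_ι ((dualKb E).map a.op) ((dualKb E).map g.op) c hc
    exact ⟨Z, a, b, c', hT, hc'⟩

lemma nonempty_dualKb_stalk_iso [HasZeroObject C] [HasBinaryBiproducts C] (X : C) :
    Nonempty ((dualKb E).obj (op ((stalk C).obj X)) ≅ (stalk C).obj (E.obj (op X))) := by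
  let S := (CochainComplex.singleFunctor C 0).obj X
  let K := (dualComplex E).obj (op S)
  have : K.IsStrictlyGE 0 := by
    rw [CochainComplex.isStrictlyGE_iff]
    exact fun i hi => isZero_dual_X E (S.isZero_of_isStrictlyLE 0 _ (by lia))
  have : K.IsStrictlyLE 0 := by
    rw [CochainComplex.isStrictlyLE_iff]
    exact fun i hi => isZero_dual_X E (S.isZero_of_isStrictlyGE 0 _ (by lia))
  obtain ⟨M, ⟨e⟩⟩ := K.exists_iso_single 0
  have e₀ : ((HomologicalComplex.single C (ComplexShape.up ℤ) 0).obj M).X 0 ≅ K.X 0 :=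
    HomologicalComplex.Hom.isoApp e.symm 0
  have e' : M ≅ E.obj (op X) :=
    (HomologicalComplex.singleObjXSelf (ComplexShape.up ℤ) 0 M).symm ≪≫
      e₀ ≪≫
      E.mapIso (HomologicalComplex.singleObjXSelf (ComplexShape.up ℤ) 0 X).symm.op
  exact ⟨Kb.mkIso e (dualComplex_bounded E (Kb.single_bound X 0)) (Kb.single_bound M 0) ≪≫
    (stalk C).mapIso e'⟩

end Duality

end Silting

/-! ### Uniserial projectives, radical covers and paths -/

namespace Silting

section Uniserial

variable {Λ : Type u} [Ring Λ]

section

variable {M : Type u} [AddCommGroup M] [Module Λ M]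

lemma isCompl_range_ker_of_comp_eq_id {N : Type u} [AddCommGroup N] [Module Λ N]
    {f : M →ₗ[Λ] N} {s : N →ₗ[Λ] M} (h : f ∘ₗ s = LinearMap.id) :
    IsCompl (LinearMap.range s) (LinearMap.ker f) := by
  have h' (x : N) : f (s x) = x := LinearMap.congr_fun h x
  refine ⟨disjoint_iff_inf_le.2 ?_, codisjoint_iff_le_sup.2 fun x _ => ?_⟩
  · rintro _ ⟨⟨y, rfl⟩, hy⟩
    have hy : f (s y) = 0 := hy
    rw [h'] at hy
    simp [hy]
  · exact Submodule.mem_sup.2 ⟨s (f x), ⟨f x, rfl⟩, x - s (f x), by simp [h'], by simp⟩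

/-- In a uniserial module, a finite supremum of submodules is attained. -/
lemma IsUniserial.exists_eq_top (hM : IsUniserial Λ M) [Nontrivial M] {ι : Type*} (s : Finset ι)
    (N : ι → Submodule Λ M) (h : s.sup N = ⊤) : ∃ k ∈ s, N k = ⊤ := by
  classical
  induction s using Finset.induction_on with
  | empty => exact absurd h (by simp)
  | insert a s ha ih =>
    rw [Finset.sup_insert] at h
    rcases hM (N a) (s.sup N) with h' | h'
    · rw [sup_eq_right.2 h'] at h
      obtain ⟨k, hk, hk'⟩ := ih h
      exact ⟨k, Finset.mem_insert_of_mem hk, hk'⟩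
    · rw [sup_eq_left.2 h'] at h
      exact ⟨a, Finset.mem_insert_self a s, h⟩

/-- A nonzero finitely generated uniserial module has a greatest proper submodule. -/
lemma IsUniserial.exists_greatest_proper (hM : IsUniserial Λ M) [Nontrivial M]
    [Module.Finite Λ M] : ∃ m : Submodule Λ M, m ≠ ⊤ ∧ ∀ N : Submodule Λ M, N ≠ ⊤ → N ≤ m := by
  obtain ⟨m, hm⟩ := IsCoatomic.exists_coatom (Submodule Λ M)
  refine ⟨m, hm.1, fun N hN => ?_⟩
  rcases hM N m with h | h
  · exact h
  · rcases hm.le_iff.1 h with h' | h'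
    · exact absurd h' hN
    · exact h'.le

lemma IsUniserial.eq_bot_of_isCompl (hM : IsUniserial Λ M) {A B : Submodule Λ M}
    (h : IsCompl A B) : A = ⊥ ∨ B = ⊥ := by
  rcases hM A B with h' | h'
  · exact .inl (h.disjoint.eq_bot_of_le h')
  · exact .inr (h.disjoint.symm.eq_bot_of_le h')

/-- A surjection from a uniserial module onto a nonzero projective module is bijective. -/
lemma IsUniserial.bijective_of_surjective {P : Type u} [AddCommGroup P] [Module Λ P]
    (hM : IsUniserial Λ M) [Nontrivial P] [Module.Projective Λ P] (f : M →ₗ[Λ] P)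
    (hf : Function.Surjective f) : Function.Bijective f := by
  obtain ⟨s, hs⟩ := Module.projective_lifting_property f LinearMap.id hf
  have hc : IsCompl (LinearMap.range s) (LinearMap.ker f) :=
    isCompl_range_ker_of_comp_eq_id hs
  refine ⟨LinearMap.ker_eq_bot.1 ?_, hf⟩
  rcases hM.eq_bot_of_isCompl hc with h | h
  · exfalso
    obtain ⟨x, hx⟩ := exists_ne (0 : P)
    have h1 : s x = 0 := by
      rw [← Submodule.mem_bot Λ, ← h]
      exact ⟨x, rfl⟩
    exact hx (by rw [← LinearMap.id_apply (R := Λ) x, ← hs, LinearMap.comp_apply, h1, map_zero])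
  · exact h

lemma IsUniserial.range (hM : IsUniserial Λ M) (N : Submodule Λ M) : IsUniserial Λ N := by
  intro A B
  rw [← Submodule.map_le_map_iff_of_injective N.injective_subtype,
    ← Submodule.map_le_map_iff_of_injective N.injective_subtype]
  exact hM _ _

end

/-- A family of pairwise non-isomorphic uniserial projective-injective modules which covers all
uniserial modules. -/
structure IsProjFamily (Λ : Type u) [Ring Λ] {I : Type} (Q : I → Type u)
    [∀ i, AddCommGroup (Q i)] [∀ i, Module Λ (Q i)] : Prop where
  finite (i : I) : Module.Finite Λ (Q i)
  projective (i : I) : Module.Projective Λ (Q i)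
  nontrivial (i : I) : Nontrivial (Q i)
  uniserial (i : I) : IsUniserial Λ (Q i)
  injective (i : I) : Module.Injective Λ (Q i)
  eq_of_equiv (i j : I) : Nonempty (Q i ≃ₗ[Λ] Q j) → i = j
  exists_cover (N : Type u) [AddCommGroup N] [Module Λ N] [Module.Finite Λ N] [Nontrivial N] :
    IsUniserial Λ N → ∃ (i : I) (f : Q i →ₗ[Λ] N), Function.Surjective f

/-- Projective covers `a i : Q (τ i) → m i` of the maximal submodules `m i` of `Q i`. -/
structure RadicalCover (Λ : Type u) [Ring Λ] {I : Type} (Q : I → Type u)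
    [∀ i, AddCommGroup (Q i)] [∀ i, Module Λ (Q i)] where
  /-- the maximal submodule -/
  m (i : I) : Submodule Λ (Q i)
  /-- the index of the cover -/
  τ : I → I
  /-- the cover -/
  a (i : I) : Q (τ i) →ₗ[Λ] Q i
  m_ne_top (i : I) : m i ≠ ⊤
  le_m (i : I) (N : Submodule Λ (Q i)) : N ≠ ⊤ → N ≤ m i
  range_a (i : I) : LinearMap.range (a i) = m i
  -- When `Q i` is simple its cover is the zero map and any index would do; this normalization keeps
  -- `τ` injective.
  τ_eq (i : I) : m i = ⊥ → τ i = i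

variable {I : Type} {Q : I → Type u} [∀ i, AddCommGroup (Q i)] [∀ i, Module Λ (Q i)]

lemma IsProjFamily.nonempty_radicalCover [IsNoetherianRing Λ] (hQ : IsProjFamily Λ Q) :
    Nonempty (RadicalCover Λ Q) := by
  have := hQ.finite
  have := hQ.nontrivial
  choose m hm hm' using fun i => (hQ.uniserial i).exists_greatest_proper
  have key (i : I) : ∃ (k : I) (a : Q k →ₗ[Λ] Q i), LinearMap.range a = m i ∧
      (m i = ⊥ → k = i) := by
    by_cases h : m i = ⊥
    · exact ⟨i, 0, by rw [h, LinearMap.range_zero], fun _ => rfl⟩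
    · have : Nontrivial (m i) := Submodule.nontrivial_iff_ne_bot.2 h
      obtain ⟨k, f, hf⟩ := hQ.exists_cover (m i) ((hQ.uniserial i).range (m i))
      refine ⟨k, (m i).subtype ∘ₗ f, ?_, fun h' => absurd h' h⟩
      rw [LinearMap.range_comp, LinearMap.range_eq_top.2 hf, Submodule.map_top,
        Submodule.range_subtype]
  choose τ a h1 h2 using key
  exact ⟨⟨m, τ, a, hm, hm', h1, h2⟩⟩

lemma IsProjFamily.eq_of_surjective (hQ : IsProjFamily Λ Q) {i j : I} (f : Q j →ₗ[Λ] Q i)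
    (hf : Function.Surjective f) : j = i := by
  have := hQ.projective i
  have := hQ.nontrivial i
  exact hQ.eq_of_equiv j i
    ⟨LinearEquiv.ofBijective f ((hQ.uniserial j).bijective_of_surjective f hf)⟩

namespace RadicalCover

variable (A : RadicalCover Λ Q)

/-- Nakayama's lemma: if the image of `f` is already the image of the radical, then the radical and
the kernel span `Q j`, while every proper submodule lies in the radical. -/
lemma eq_zero_of_range_le {M : Type u} [AddCommGroup M] [Module Λ M]
    {j : I} (f : Q j →ₗ[Λ] M) (hf : LinearMap.range f ≤ (A.m j).map f) : f = 0 := by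
  have h1 : A.m j ⊔ LinearMap.ker f = ⊤ := by
    rw [← Submodule.comap_map_eq, eq_top_iff]
    exact fun x _ => hf ⟨x, rfl⟩
  by_contra h
  have h2 : LinearMap.ker f ≠ ⊤ := fun h' => h (LinearMap.ker_eq_top.1 h')
  rw [sup_eq_left.2 (A.le_m j _ h2)] at h1
  exact A.m_ne_top j h1

lemma range_le_m {i j : I} (f : Q j →ₗ[Λ] Q i) (hf : ¬ Function.Surjective f) :
    LinearMap.range f ≤ A.m i :=
  A.le_m i _ fun h => hf (LinearMap.range_eq_top.1 h)

lemma exists_factor (hQ : IsProjFamily Λ Q) {i j : I} (f : Q j →ₗ[Λ] Q i)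
    (hf : ¬ Function.Surjective f) : ∃ g : Q j →ₗ[Λ] Q (A.τ i), f = A.a i ∘ₗ g := by
  have := hQ.projective j
  have h1 (x : Q j) : f x ∈ LinearMap.range (A.a i) := by
    rw [A.range_a]
    exact A.range_le_m f hf ⟨x, rfl⟩
  obtain ⟨g, hg⟩ := Module.projective_lifting_property (A.a i).rangeRestrict
    (f.codRestrict _ h1) (LinearMap.surjective_rangeRestrict _)
  refine ⟨g, LinearMap.ext fun x => ?_⟩
  exact (congr_arg Subtype.val (LinearMap.congr_fun hg x)).symm

/-- An injective `a i` would split because `Q (τ i)` is injective. Then indecomposability would make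
the radical zero, with `a i = 0`, or all of `Q i`. -/
lemma ker_a_ne_bot (hQ : IsProjFamily Λ Q) (i : I) : LinearMap.ker (A.a i) ≠ ⊥ := by
  intro h
  have := hQ.nontrivial (A.τ i)
  obtain ⟨s, hs⟩ := (hQ.injective (A.τ i)).out (A.a i) (LinearMap.ker_eq_bot.1 h) LinearMap.id
  have hc : IsCompl (LinearMap.range (A.a i)) (LinearMap.ker s) :=
    isCompl_range_ker_of_comp_eq_id (LinearMap.ext hs)
  rcases (hQ.uniserial i).eq_bot_of_isCompl hc with h' | h'
  · rw [LinearMap.range_eq_bot] at h'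
    rw [h', LinearMap.ker_zero] at h
    exact top_ne_bot h
  · rw [h'] at hc
    exact A.m_ne_top i (by rw [← A.range_a, ← sup_bot_eq (LinearMap.range _), hc.sup_eq_top])

/-- Two covers with the same source have comparable kernels. The one with the larger kernel factors
through the other by injectivity of its target, and for different indices Nakayama forces the
comparison map to vanish. -/
lemma τ_injective (hQ : IsProjFamily Λ Q) : Function.Injective A.τ := by
  have key (i j : I) (k : I) (f : Q k →ₗ[Λ] Q i) (g : Q k →ₗ[Λ] Q j)
      (hf : LinearMap.range f = A.m i) (hg : LinearMap.range g = A.m j)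
      (hfg : LinearMap.ker f ≤ LinearMap.ker g) (hf0 : LinearMap.ker f ≠ ⊥)
      (hi : A.m i = ⊥ → k = i) (hj : A.m j = ⊥ → k = j) : i = j := by
    by_contra hij
    obtain ⟨h, hh⟩ : ∃ h : Q i →ₗ[Λ] Q j, h ∘ₗ f = g := by
      obtain ⟨h, hh⟩ := (hQ.injective j).out ((LinearMap.ker f).liftQ f le_rfl)
        (LinearMap.ker_eq_bot.1 (Submodule.ker_liftQ_eq_bot _ _ _ le_rfl))
        ((LinearMap.ker f).liftQ g hfg)
      exact ⟨h, LinearMap.ext fun x => hh (Submodule.Quotient.mk x)⟩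
    have h1 : LinearMap.range h ≤ A.m j :=
      A.range_le_m h fun hs => hij (hQ.eq_of_surjective h hs)
    have h2 : h = 0 := by
      refine A.eq_zero_of_range_le h (h1.trans ?_)
      rw [← hg, ← hh, LinearMap.range_comp, hf]
    -- The degenerate case: `Q j` is simple, so `k = j`, and the nonzero map `f` out of a simple
    -- module would be injective.
    have h3 : A.m j = ⊥ := by rw [← hg, ← hh, h2, LinearMap.zero_comp, LinearMap.range_zero]
    obtain rfl := hj h3
    have h4 : LinearMap.ker f ≠ ⊤ := fun h5 => by
      rw [LinearMap.ker_eq_top.1 h5, LinearMap.range_zero] at hf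
      exact hij (hi hf.symm).symm
    exact hf0 (le_bot_iff.1 (h3 ▸ A.le_m k _ h4))
  intro i j hij
  obtain ⟨g, hg, hg'⟩ : ∃ g : Q (A.τ i) →ₗ[Λ] Q j, LinearMap.range g = A.m j ∧
      LinearMap.ker g ≠ ⊥ := by
    rw [hij]
    exact ⟨A.a j, A.range_a j, A.ker_a_ne_bot hQ j⟩
  have hj : A.m j = ⊥ → A.τ i = j := fun h => hij.trans (A.τ_eq j h)
  rcases hQ.uniserial _ (LinearMap.ker (A.a i)) (LinearMap.ker g) with h | h
  · exact key i j _ (A.a i) g (A.range_a i) hg h (A.ker_a_ne_bot hQ i) (A.τ_eq i) hj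
  · exact (key j i _ g (A.a i) hg (A.range_a i) h hg' hj (A.τ_eq i)).symm

/-- The composition of `k` radical covers starting at `Q i`, as a map from `Q j`; it is zero unless
`j` is the `k`-th iterate of `i`. -/
def path [DecidableEq I] : ∀ (_ : ℕ) (i j : I), Q j →ₗ[Λ] Q i
  | 0, i, j => if h : i = j then h ▸ LinearMap.id else 0
  | k + 1, i, j => A.a i ∘ₗ path k (A.τ i) j

section Path

variable [DecidableEq I]

lemma path_zero_self (i : I) : A.path 0 i i = LinearMap.id := by simp [path]

lemma path_succ (k : ℕ) (i j : I) : A.path (k + 1) i j = A.a i ∘ₗ A.path k (A.τ i) j := rfl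

lemma path_eq_zero {k : ℕ} {i j : I} (h : A.τ^[k] i ≠ j) : A.path k i j = 0 := by
  induction k generalizing i with
  | zero => exact dif_neg h
  | succ k ih => rw [path_succ, ih h, LinearMap.comp_zero]

/-- The middle index must be the true endpoint: otherwise the left side is zero while the long path
need not be. -/
lemma path_comp {k l : ℕ} {i j h : I} (hj : A.τ^[k] i = j) :
    A.path k i j ∘ₗ A.path l j h = A.path (k + l) i h := by
  induction k generalizing i with
  | zero =>
    obtain rfl : i = j := hj
    rw [path_zero_self, LinearMap.id_comp, zero_add]
  | succ k ih =>
    rw [path_succ, LinearMap.comp_assoc, ih hj, Nat.succ_add, path_succ]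

lemma path_one (j : I) : A.path 1 j (A.τ j) = A.a j := by
  rw [path_succ, path_zero_self, LinearMap.comp_id]

lemma path_comp_a {k : ℕ} {i j : I} (hj : A.τ^[k] i = j) :
    A.path k i j ∘ₗ A.a j = A.path (k + 1) i (A.τ j) := by
  rw [← path_one, path_comp A hj]

lemma range_path_succ {k : ℕ} {i j : I} (hj : A.τ^[k] i = j) :
    LinearMap.range (A.path (k + 1) i (A.τ j)) = (A.m j).map (A.path k i j) := by
  rw [← path_comp_a A hj, LinearMap.range_comp, range_a]

/-- Sufficiently long paths vanish. -/
lemma exists_path_eq_zero [IsArtinianRing Λ] (hQ : IsProjFamily Λ Q) (i : I) :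
    ∃ n : ℕ, ∀ j, A.path n i j = 0 := by
  have := hQ.finite
  let f : ℕ →o (Submodule Λ (Q i))ᵒᵈ :=
    { toFun := fun n => OrderDual.toDual (LinearMap.range (A.path n i (A.τ^[n] i)))
      monotone' := monotone_nat_of_le_succ fun n => by
        change LinearMap.range (A.path (n + 1) i (A.τ^[n + 1] i)) ≤
          LinearMap.range (A.path n i (A.τ^[n] i))
        rw [Function.iterate_succ_apply', A.range_path_succ rfl]
        exact LinearMap.map_le_range }
  obtain ⟨n, hn⟩ := IsArtinian.monotone_stabilizes f
  -- Once the descending images become stationary, the image of a path is the image of the radical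
  -- under it, and Nakayama makes the path zero.
  have h1 : LinearMap.range (A.path n i (A.τ^[n] i)) =
      LinearMap.range (A.path (n + 1) i (A.τ^[n + 1] i)) := hn (n + 1) n.le_succ
  rw [Function.iterate_succ_apply', A.range_path_succ rfl] at h1
  refine ⟨n, fun j => ?_⟩
  by_cases hj : A.τ^[n] i = j
  · subst hj
    exact A.eq_zero_of_range_le _ h1.le
  · exact A.path_eq_zero hj

/-- The number of nonzero paths starting at `Q i`, i.e. the length of `Q i`. -/
noncomputable def len (i : I) : ℕ := sInf {n | ∀ j, A.path n i j = 0}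

variable [IsArtinianRing Λ]

lemma path_len (hQ : IsProjFamily Λ Q) (i j : I) : A.path (A.len i) i j = 0 :=
  Nat.sInf_mem (A.exists_path_eq_zero hQ i) j

lemma path_eq_zero_of_len_le (hQ : IsProjFamily Λ Q) {k : ℕ} {i : I} (h : A.len i ≤ k) (j : I) :
    A.path k i j = 0 := by
  obtain ⟨l, rfl⟩ := Nat.exists_eq_add_of_le h
  rw [← A.path_comp rfl, A.path_len hQ, LinearMap.zero_comp]

omit [IsArtinianRing Λ] in
lemma path_ne_zero {k : ℕ} {i j : I} (hj : A.τ^[k] i = j) (h : k < A.len i) :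
    A.path k i j ≠ 0 := by
  intro h0
  refine Nat.notMem_of_lt_sInf h fun j' => ?_
  by_cases hj' : A.τ^[k] i = j'
  · rwa [← hj', hj]
  · exact A.path_eq_zero hj'

lemma len_pos (hQ : IsProjFamily Λ Q) (i : I) : 0 < A.len i := by
  have := hQ.nontrivial i
  by_contra h
  have h1 := A.path_eq_zero_of_len_le hQ (k := 0) (not_lt.1 h) i
  rw [path_zero_self] at h1
  obtain ⟨x, hx⟩ := exists_ne (0 : Q i)
  exact hx (LinearMap.congr_fun h1 x)

/-- The longest nonzero path into `Q (τ i)` has simple image. The nonzero kernel of `a i` is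
comparable with it and therefore contains it, so prolonging this path by `a i` gives zero. -/
lemma len_le_len_τ (hQ : IsProjFamily Λ Q) (i : I) : A.len i ≤ A.len (A.τ i) := by
  obtain ⟨n, hn⟩ := Nat.exists_eq_succ_of_ne_zero (A.len_pos hQ (A.τ i)).ne'
  rw [hn]
  refine Nat.sInf_le fun j => ?_
  rw [path_succ]
  by_cases hj : A.τ^[n] (A.τ i) = j
  swap
  · rw [A.path_eq_zero hj, LinearMap.comp_zero]
  have h0 : (A.m j).map (A.path n (A.τ i) j) = ⊥ := by
    rw [← A.range_path_succ hj, A.path_eq_zero_of_len_le hQ hn.le, LinearMap.range_zero]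
  rcases eq_or_ne ((LinearMap.ker (A.a i)).comap (A.path n (A.τ i) j)) ⊤ with h | h
  · exact LinearMap.ext fun x => (h ▸ Submodule.mem_top :
      x ∈ (LinearMap.ker (A.a i)).comap (A.path n (A.τ i) j))
  · exfalso
    have h1 := Submodule.map_mono (f := A.path n (A.τ i) j) (A.le_m j _ h)
    rw [h0, Submodule.map_comap_eq, le_bot_iff] at h1
    rcases hQ.uniserial _ (LinearMap.range (A.path n (A.τ i) j)) (LinearMap.ker (A.a i))
      with h2 | h2
    · refine h (eq_top_iff.2 fun x _ => h2 ⟨x, rfl⟩)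
    · rw [inf_eq_right.2 h2] at h1
      exact A.ker_a_ne_bot hQ i h1

/-- Every index is periodic under the injective map `τ`, and the length cannot decrease along a
cycle, so it is constant there. -/
lemma len_iterate [Finite I] (hQ : IsProjFamily Λ Q) (k : ℕ) (i : I) :
    A.len (A.τ^[k] i) = A.len i := by
  have hle (k : ℕ) (i : I) : A.len i ≤ A.len (A.τ^[k] i) := by
    induction k with
    | zero => exact le_rfl
    | succ k ih =>
      rw [Function.iterate_succ_apply']
      exact ih.trans (A.len_le_len_τ hQ _)
  refine le_antisymm ?_ (hle k i)
  obtain ⟨n, hn, hn'⟩ := (A.τ_injective hQ).mem_periodicPts i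
  have h1 := hle (n * k - k) (A.τ^[k] i)
  rwa [← Function.iterate_add_apply, Nat.sub_add_cancel (Nat.le_mul_of_pos_left k hn),
    (hn'.mul_const k).eq] at h1

/-! ### Morphism spaces as quotients of polynomials -/

section Algebra

open Polynomial

variable {K : Type w} [Field K] [Algebra K Λ] [∀ i, Module K (Q i)]
  [∀ i, IsScalarTower K Λ (Q i)]

/-- The `K`-linear map sending a polynomial `∑ c k X ^ k` to the combination of the paths of
length `k` with coefficients `c k`. -/
noncomputable def pathHom (K : Type w) [Field K] [Algebra K Λ] [∀ i, Module K (Q i)]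
    [∀ i, IsScalarTower K Λ (Q i)] (i j : I) : K[X] →ₗ[K] (Q j →ₗ[Λ] Q i) :=
  Polynomial.lsum fun k => (LinearMap.toSpanSingleton K _ (A.path k i j))

omit [IsArtinianRing Λ] in
lemma pathHom_monomial (i j : I) (k : ℕ) (c : K) :
    A.pathHom K i j (monomial k c) = c • A.path k i j := by
  simp [pathHom]

omit [IsArtinianRing Λ] in
lemma pathHom_eq_sum (i j : I) (p : K[X]) :
    A.pathHom K i j p = p.sum fun k c => c • A.path k i j := by
  simp [pathHom, Polynomial.lsum_apply]

/-- The polynomials whose exponents are lengths of paths from `i` to `j`. -/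
def SupportedOn (A : RadicalCover Λ Q) (i j : I) (p : K[X]) : Prop :=
  ∀ k, p.coeff k ≠ 0 → A.τ^[k] i = j

omit [IsArtinianRing Λ] in
lemma pathHom_one (i : I) : A.pathHom K i i 1 = LinearMap.id := by
  rw [← Polynomial.monomial_zero_one, pathHom_monomial, path_zero_self, one_smul]

omit [IsArtinianRing Λ] in
-- Multiplying monomials concatenates paths. The support condition on `p` is needed because
-- monomials of the wrong length are invisible in `pathHom` from `i` to `j` but may contribute to
-- the product.
lemma pathHom_mul {i j h : I} {p : K[X]} (hp : A.SupportedOn i j p) (q : K[X]) :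
    A.pathHom K i h (p * q) = A.pathHom K i j p ∘ₗ A.pathHom K j h q := by
  refine LinearMap.ext fun x => ?_
  rw [Polynomial.mul_eq_sum_sum, map_sum, pathHom_eq_sum A i j p, Polynomial.sum_def,
    LinearMap.comp_apply, LinearMap.sum_apply, LinearMap.sum_apply]
  refine Finset.sum_congr rfl fun k hk => ?_
  rw [pathHom_eq_sum A j h q, Polynomial.sum_def, Polynomial.sum_def, map_sum,
    LinearMap.sum_apply, LinearMap.sum_apply, map_sum]
  refine Finset.sum_congr rfl fun l _ => ?_
  rw [pathHom_monomial, ← A.path_comp (hp k (Polynomial.mem_support_iff.1 hk))]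
  simp [smul_smul, LinearMap.map_smul_of_tower]

variable [IsAlgClosed K] [FiniteDimensional K Λ]

omit [IsArtinianRing Λ] in
-- An endomorphism has an eigenvalue `c`, and `f - c` is not injective, hence not surjective by
-- dimension. It then lands in the radical and lifts through the cover; for `i ≠ j` the map itself
-- is not surjective.
lemma exists_eq_smul_add (hQ : IsProjFamily Λ Q) {i j : I} (f : Q j →ₗ[Λ] Q i) :
    ∃ (c : K) (g : Q j →ₗ[Λ] Q (A.τ i)), (i ≠ j → c = 0) ∧
      f = c • A.path 0 i j + A.a i ∘ₗ g := by
  have hf := hQ.finite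
  have hn := hQ.nontrivial
  have hfin (i : I) : FiniteDimensional K (Q i) := Module.Finite.trans Λ (Q i)
  by_cases hij : i = j
  · subst hij
    obtain ⟨c, hc⟩ := Module.End.exists_eigenvalue (f.restrictScalars K)
    obtain ⟨x, hx, hx0⟩ := hc.exists_hasEigenvector
    have h1 : ¬ Function.Surjective (f - c • LinearMap.id : Q i →ₗ[Λ] Q i) := fun hs => by
      let F : Q i →ₗ[K] Q i := (f - c • LinearMap.id).restrictScalars K
      have h2 : Function.Injective F := LinearMap.injective_iff_surjective.2 hs
      refine hx0 ((map_eq_zero_iff F h2).1 ?_)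
      have := Module.End.mem_eigenspace_iff.1 hx
      have h3 : f x = c • x := this
      simp [F, h3]
    obtain ⟨g, hg⟩ := A.exists_factor hQ _ h1
    exact ⟨c, g, fun h => (h rfl).elim, by rw [path_zero_self, ← hg]; simp⟩
  · obtain ⟨g, hg⟩ := A.exists_factor hQ f fun hs => hij (hQ.eq_of_surjective f hs).symm
    exact ⟨0, g, fun _ => rfl, by rw [hg, zero_smul, zero_add]⟩

/-- All morphisms are combinations of paths. -/
lemma exists_pathHom_eq (hQ : IsProjFamily Λ Q) {i j : I} (f : Q j →ₗ[Λ] Q i) :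
    ∃ p : K[X], A.SupportedOn i j p ∧ A.pathHom K i j p = f := by
  have key (n : ℕ) : ∃ (p : K[X]) (g : Q j →ₗ[Λ] Q (A.τ^[n] i)), A.SupportedOn i j p ∧
      f = A.pathHom K i j p + A.path n i (A.τ^[n] i) ∘ₗ g := by
    induction n with
    | zero => exact ⟨0, f, fun k hk => absurd (coeff_zero k) hk, by
        rw [map_zero, zero_add]
        exact (congr_arg (· ∘ₗ f) (A.path_zero_self i)).symm⟩
    | succ n ih =>
      obtain ⟨p, g, hp, hf⟩ := ih
      obtain ⟨c, g', hc, hg⟩ := A.exists_eq_smul_add (K := K) hQ g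
      obtain ⟨g'', hg''⟩ : ∃ g'' : Q j →ₗ[Λ] Q (A.τ^[n + 1] i),
          A.path (n + 1) i (A.τ^[n + 1] i) ∘ₗ g'' =
          A.path (n + 1) i (A.τ (A.τ^[n] i)) ∘ₗ g' := by
        rw [Function.iterate_succ_apply']
        exact ⟨g', rfl⟩
      refine ⟨p + monomial n c, g'', fun k hk => ?_, ?_⟩
      · by_cases hk' : n = k
        · subst hk'
          by_contra hj
          rw [hc hj, map_zero, add_zero] at hk
          exact hj (hp n hk)
        · rw [coeff_add, coeff_monomial_of_ne _ (Ne.symm hk'), add_zero] at hk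
          exact hp k hk
      · rw [hf, hg, hg'', map_add, pathHom_monomial, LinearMap.comp_add, LinearMap.comp_smul,
          A.path_comp rfl, ← LinearMap.comp_assoc, A.path_comp_a rfl, add_zero, add_assoc]
  obtain ⟨n, hn⟩ := A.exists_path_eq_zero hQ i
  obtain ⟨p, g, hp, hf⟩ := key n
  exact ⟨p, hp, by rw [hf, hn, LinearMap.zero_comp, add_zero]⟩

omit [IsAlgClosed K] [FiniteDimensional K Λ] in
/-- The paths which are nonzero are linearly independent. -/
lemma pathHom_eq_zero_iff (hQ : IsProjFamily Λ Q) {i j : I} (p : K[X]) :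
    A.pathHom K i j p = 0 ↔ ∀ k < A.len i, A.τ^[k] i = j → p.coeff k = 0 := by
  constructor
  · intro h k
    induction k using Nat.strong_induction_on with
    | _ k ih =>
      intro hk hj
      by_contra hc
      -- For the least offending exponent, the path is a combination of longer ones. These have
      -- image inside the image of the radical under it, so Nakayama gives a contradiction.
      have h1 : p.coeff k • A.path k i j =
          -∑ l ∈ p.support.erase k, p.coeff l • A.path l i j := by
        rw [eq_neg_iff_add_eq_zero, ← h, pathHom_eq_sum, Polynomial.sum_def]
        exact Finset.add_sum_erase p.support (fun l => p.coeff l • A.path l i j)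
          (Polynomial.mem_support_iff.2 hc)
      refine A.path_ne_zero hj hk (A.eq_zero_of_range_le _ ?_)
      rw [← A.range_path_succ hj]
      have h2 (l : ℕ) (hl : l ∈ p.support.erase k) (x : Q j) : (p.coeff l • A.path l i j) x ∈
          LinearMap.range (A.path (k + 1) i (A.τ j)) := by
        obtain ⟨hlk, hl⟩ := Finset.mem_erase.1 hl
        by_cases hj' : A.τ^[l] i = j
        swap
        · rw [A.path_eq_zero hj', smul_zero]
          exact zero_mem _
        rcases lt_or_gt_of_ne hlk with h3 | h3
        · exact absurd (ih l h3 (h3.trans hk) hj') (Polynomial.mem_support_iff.1 hl)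
        · obtain ⟨d, rfl⟩ := Nat.exists_eq_add_of_lt h3
          rw [add_right_comm, ← A.path_comp (k := k + 1) (j := A.τ j)
            (by rw [Function.iterate_succ_apply', hj])]
          rw [LinearMap.smul_apply, ← algebraMap_smul Λ]
          exact Submodule.smul_mem _ _ ⟨A.path d (A.τ j) j x, rfl⟩
      rintro _ ⟨x, rfl⟩
      have h3 : A.path k i j x = (p.coeff k)⁻¹ • (p.coeff k • A.path k i j) x := by
        rw [LinearMap.smul_apply, smul_smul, inv_mul_cancel₀ hc, one_smul]
      rw [h3, h1, ← algebraMap_smul Λ]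
      refine Submodule.smul_mem _ _ ?_
      rw [LinearMap.neg_apply, LinearMap.sum_apply]
      exact neg_mem (sum_mem fun l hl => h2 l hl x)
  · intro h
    rw [pathHom_eq_sum, Polynomial.sum_def]
    refine Finset.sum_eq_zero fun k _ => ?_
    by_cases hj : A.τ^[k] i = j
    · rcases lt_or_ge k (A.len i) with hk | hk
      · rw [h k hk hj, zero_smul]
      · rw [A.path_eq_zero_of_len_le hQ hk, smul_zero]
    · rw [A.path_eq_zero hj, smul_zero]

end Algebra

end Path

end RadicalCover

end Uniserial

end Silting

/-! ### Reflecting the cycles and reversing the paths -/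

namespace Silting

section Reflection

/-- A permutation is inverted by an involution which preserves its cycles and fixes a given
point. -/
lemma exists_reflection {I : Type*} (τ : Equiv.Perm I) (p : I) : ∃ r : I → I,
    (∀ i, r (r i) = i) ∧ (∀ i, τ (r (τ i)) = r i) ∧ r p = p ∧ ∀ i, τ.SameCycle i (r i) := by
  classical
  let s := Equiv.Perm.SameCycle.setoid τ
  -- Each cycle gets a base point, which is `p` on the cycle of `p`. The reflection sends `τ ^ n` of
  -- the base point to `τ ^ (-n)` of it.
  let b (i : I) : I := if τ.SameCycle p i then p else (Quotient.mk s i).out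
  have hb (i : I) : τ.SameCycle (b i) i := by
    by_cases h : τ.SameCycle p i
    · simpa only [b, if_pos h] using h
    · simp only [b, if_neg h]
      exact Quotient.mk_out (s := s) i
  have hb' {i j : I} (h : τ.SameCycle i j) : b i = b j := by
    have h1 : τ.SameCycle p i ↔ τ.SameCycle p j := ⟨fun h' => h'.trans h, fun h' => h'.trans h.symm⟩
    have h2 : Quotient.mk s i = Quotient.mk s j := Quotient.sound h
    simp only [b, h1, h2]
  choose n hn using hb
  let r (i : I) : I := (τ ^ (-n i)) (b i)
  -- The exponent is not unique on a finite cycle; the value of the reflection does not depend on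
  -- it.
  have key (i : I) (m : ℤ) (hm : (τ ^ m) (b i) = i) : r i = (τ ^ (-m)) (b i) := by
    have h1 := congr_arg (τ ^ (-n i - m)) ((hn i).trans hm.symm)
    rw [← Equiv.Perm.mul_apply, ← Equiv.Perm.mul_apply, ← zpow_add, ← zpow_add] at h1
    have e1 : -n i - m + n i = -m := by ring
    have e2 : -n i - m + m = -n i := by ring
    rw [e1, e2] at h1
    exact h1.symm
  have hr (i : I) : τ.SameCycle i (r i) :=
    (Equiv.Perm.SameCycle.symm ⟨n i, hn i⟩).trans ⟨-n i, rfl⟩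
  refine ⟨r, fun i => ?_, fun i => ?_, ?_, hr⟩
  · have h1 : b (r i) = b i := (hb' (hr i)).symm
    rw [key (r i) (-n i) (by rw [h1]), h1, neg_neg, hn]
  · have h1 : b (τ i) = b i := (hb' ⟨1, rfl⟩).symm
    rw [key (τ i) (1 + n i) (by rw [h1, zpow_add, Equiv.Perm.mul_apply, hn, zpow_one]), h1,
      key i (n i) (hn i), neg_add, zpow_add, Equiv.Perm.mul_apply, zpow_neg_one]
    simp
  · have h1 : b p = p := if_pos (.refl _ _)
    rw [key p 0 (by simp [h1]), h1]
    simp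

variable {Λ : Type u} [Ring Λ] {I : Type} {Q : I → Type u} [∀ i, AddCommGroup (Q i)]
  [∀ i, Module Λ (Q i)] [Finite I] [IsArtinianRing Λ]
  {K : Type w} [Field K] [Algebra K Λ] [∀ i, Module K (Q i)]
  [∀ i, IsScalarTower K Λ (Q i)] [IsAlgClosed K] [FiniteDimensional K Λ]

variable (K) in
include K in
/-- Reversing all paths is a contravariant self-equivalence of the category of projective
modules over a selfinjective Nakayama algebra. -/
lemma IsProjFamily.exists_reversal (hQ : IsProjFamily Λ Q) (p : I) :
    ∃ (r : I → I) (σ : ∀ i j, (Q j →ₗ[Λ] Q i) ≃+ (Q (r i) →ₗ[Λ] Q (r j))),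
      (∀ i, r (r i) = i) ∧ r p = p ∧ (∀ i, σ i i LinearMap.id = LinearMap.id) ∧
      ∀ (i j h : I) (f : Q j →ₗ[Λ] Q i) (g : Q h →ₗ[Λ] Q j),
        σ i h (f ∘ₗ g) = σ j h g ∘ₗ σ i j f := by
  classical
  obtain ⟨A⟩ := hQ.nonempty_radicalCover
  obtain ⟨r, hrr, hτ, hp, hr⟩ := exists_reflection
    (Equiv.ofBijective A.τ (Finite.injective_iff_bijective.1 (A.τ_injective hQ))) p
  have hτ (i : I) : A.τ (r (A.τ i)) = r i := hτ i
  have hlen (i : I) : A.len (r i) = A.len i := by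
    obtain ⟨k, -, hk⟩ := (hr i).exists_pow_eq'
    rw [← hk, ← A.len_iterate hQ k i]
    congr 1
  have hit (k : ℕ) (i : I) : A.τ^[k] (r (A.τ^[k] i)) = r i := by
    induction k with
    | zero => rfl
    | succ k ih => rw [Function.iterate_succ_apply, Function.iterate_succ_apply', hτ, ih]
  have hiff (k : ℕ) (i j : I) : A.τ^[k] (r j) = r i ↔ A.τ^[k] i = j := by
    constructor
    · intro h
      have h1 := hit k (r j)
      rwa [h, hrr, hrr] at h1
    · rintro rfl
      exact hit k i
  have hker (i j : I) :
      LinearMap.ker (A.pathHom K i j) = LinearMap.ker (A.pathHom K (r j) (r i)) := by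
    ext q
    rw [LinearMap.mem_ker, LinearMap.mem_ker, A.pathHom_eq_zero_iff hQ, A.pathHom_eq_zero_iff hQ]
    simp only [hiff, hlen]
    -- Along a path from `i` to `j` the length is constant, so both truncations occur at the same
    -- exponent.
    refine forall_congr' fun k => ⟨fun h hk hj => h ?_ hj, fun h hk hj => h ?_ hj⟩
    · rwa [← hj, A.len_iterate hQ] at hk
    · rwa [← hj, A.len_iterate hQ]
  have hsurj (i j : I) : Function.Surjective (A.pathHom K i j) := fun f => by
    obtain ⟨q, -, hq⟩ := A.exists_pathHom_eq (K := K) hQ f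
    exact ⟨q, hq⟩
  -- Both morphism spaces are quotients of `K[X]` by the same kernel; `σ` matches classes of the
  -- same polynomial.
  let σ (i j : I) : (Q j →ₗ[Λ] Q i) ≃ₗ[K] (Q (r i) →ₗ[Λ] Q (r j)) :=
    ((A.pathHom K i j).quotKerEquivOfSurjective (hsurj i j)).symm ≪≫ₗ
      Submodule.quotEquivOfEq _ _ (hker i j) ≪≫ₗ
      (A.pathHom K (r j) (r i)).quotKerEquivOfSurjective (hsurj _ _)
  have hσ (i j : I) (q : Polynomial K) : σ i j (A.pathHom K i j q) = A.pathHom K (r j) (r i) q := by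
    have h1 : ((A.pathHom K i j).quotKerEquivOfSurjective (hsurj i j)).symm (A.pathHom K i j q) =
        Submodule.Quotient.mk q := by
      rw [LinearEquiv.symm_apply_eq]
      rfl
    simp only [σ, LinearEquiv.trans_apply, h1]
    rfl
  refine ⟨r, fun i j => (σ i j).toAddEquiv, hrr, hp, fun i => ?_, fun i j h f g => ?_⟩
  · change σ i i LinearMap.id = _
    rw [← A.pathHom_one (K := K), hσ, A.pathHom_one]
  · obtain ⟨x, hx, rfl⟩ := A.exists_pathHom_eq (K := K) hQ f
    obtain ⟨y, hy, rfl⟩ := A.exists_pathHom_eq (K := K) hQ g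
    change σ i h _ = σ j h _ ∘ₗ σ i j _
    -- Commutativity of `K[X]` is what turns the order of composition around.
    rw [← A.pathHom_mul hx, hσ, hσ, hσ, mul_comm,
      A.pathHom_mul fun k hk => (hiff k j h).2 (hy k hk)]

end Reflection

end Silting

/-! ### Extending the reversal by transposing matrices -/

namespace Silting

open Opposite

section Reversal

variable {D : Type u} [Category.{v} D] [Preadditive D] [HasFiniteBiproducts D] {I : Type u}
  (Q : I → D)

/-- The functor from the matrix category of a full subcategory. -/
noncomputable abbrev matLift : Mat_ (InducedCategory D Q) ⥤ D := Mat_.lift (inducedFunctor Q)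

instance : (matLift Q).Faithful where
  map_injective {M N} f g h := by
    ext i j
    have h1 := congr_arg (fun k => biproduct.ι _ i ≫ k ≫ biproduct.π _ j) h
    have h2 : (inducedFunctor Q).map (f i j) = (inducedFunctor Q).map (g i j) := by
      simpa [matLift, Mat_.lift] using h1
    exact h2

instance : (matLift Q).Full where
  map_surjective {M N} f := by
    refine ⟨fun i j => InducedCategory.homMk
      (biproduct.ι (fun i => (inducedFunctor Q).obj (M.X i)) i ≫ f ≫
        biproduct.π (fun j => (inducedFunctor Q).obj (N.X j)) j), ?_⟩
    refine biproduct.hom_ext' _ _ fun i => biproduct.hom_ext _ _ fun j => ?_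
    simp only [matLift, Mat_.lift, biproduct.ι_matrix_assoc, biproduct.lift_π, Category.assoc]
    exact (Category.assoc _ _ _).symm

omit [HasFiniteBiproducts D] in
lemma hom_sum {X Y : InducedCategory D Q} {ι : Type*} (s : Finset ι) (f : ι → (X ⟶ Y)) :
    (∑ k ∈ s, f k).hom = ∑ k ∈ s, (f k).hom :=
  map_sum (InducedCategory.homAddEquiv) f s

variable (r : I → I) (σ : ∀ i j, (Q j ⟶ Q i) ≃+ (Q (r i) ⟶ Q (r j)))

/-- The transpose functor of the matrix category induced by a contravariant functor. -/
noncomputable def matTranspose (hid : ∀ i, σ i i (𝟙 _) = 𝟙 _)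
    (hcomp : ∀ (i j h : I) (f : Q j ⟶ Q i) (g : Q h ⟶ Q j), σ i h (g ≫ f) = σ i j f ≫ σ j h g) :
    (Mat_ (InducedCategory D Q))ᵒᵖ ⥤ Mat_ (InducedCategory D Q) where
  obj M := ⟨M.unop.ι, fun k => (r (M.unop.X k) : I)⟩
  map {M N} f := fun k l => InducedCategory.homMk (σ _ _ (f.unop l k).hom)
  map_id M := by
    ext k l
    by_cases h : k = l
    · subst h
      simp [hid]
    · rw [Mat_.id_apply_of_ne _ k l h]
      exact (congrArg (fun g => σ _ _ g.hom) (Mat_.id_apply_of_ne M.unop l k (Ne.symm h))).trans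
        (map_zero _)
  map_comp f g := by
    ext k l
    refine (congrArg (σ _ _) (hom_sum Q Finset.univ fun j => g.unop l j ≫ f.unop j k)).trans
      (Eq.trans ?_ (hom_sum Q Finset.univ fun j =>
        InducedCategory.homMk (X := (r _ : I)) (Y := (r _ : I)) (σ _ _ (f.unop j k).hom) ≫
          InducedCategory.homMk (σ _ _ (g.unop l j).hom)).symm)
    rw [map_sum]
    exact Finset.sum_congr rfl fun j _ => hcomp _ _ _ _ _

instance (hid) (hcomp) : (matTranspose Q r σ hid hcomp).Additive where
  map_add {M N f g} := by
    ext k l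
    exact (σ _ _).map_add _ _

instance (hid) (hcomp) : (matTranspose Q r σ hid hcomp).Faithful where
  map_injective {M N} f g h := by
    apply Quiver.Hom.unop_inj
    ext k l
    have h1 := congr_arg (fun m => (m l k).hom) h
    exact (σ _ _).injective h1

instance (hid) (hcomp) : (matTranspose Q r σ hid hcomp).Full where
  map_surjective {M N} f := by
    refine ⟨Quiver.Hom.op fun l k => InducedCategory.homMk ((σ _ _).symm (f k l).hom), ?_⟩
    ext k l
    exact (σ _ _).apply_symm_apply _

omit [HasFiniteBiproducts D] in
lemma matTranspose_essSurj (hid) (hcomp) (hr : ∀ i, r (r i) = i) :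
    (matTranspose Q r σ hid hcomp).EssSurj where
  mem_essImage M := by
    refine ⟨op ⟨M.ι, fun k => (r (M.X k) : I)⟩, ⟨eqToIso ?_⟩⟩
    obtain ⟨ι, X⟩ := M
    simp only [matTranspose]
    congr 1
    exact funext fun k => hr (X k)

/-- An additive category generated by finitely many objects with a reversal of the morphisms
between them is anti-equivalent to itself. -/
lemma exists_antiEquivalence (hid : ∀ i, σ i i (𝟙 _) = 𝟙 _)
    (hcomp : ∀ (i j h : I) (f : Q j ⟶ Q i) (g : Q h ⟶ Q j), σ i h (g ≫ f) = σ i j f ≫ σ j h g)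
    (hr : ∀ i, r (r i) = i)
    (hgen : ∀ M : D, ∃ (n : ℕ) (c : Fin n → I), Nonempty ((⨁ fun k => Q (c k)) ≅ M)) :
    ∃ E : Dᵒᵖ ⥤ D, E.Additive ∧ E.Full ∧ E.Faithful ∧ E.EssSurj ∧
      ∀ i, Nonempty (E.obj (op (Q i)) ≅ Q (r i)) := by
  have : (matLift Q).EssSurj := ⟨fun M => by
    obtain ⟨n, c, ⟨e⟩⟩ := hgen M
    exact ⟨⟨Fin n, fun k => (c k : I)⟩, ⟨e⟩⟩⟩
  have : (matLift Q).IsEquivalence := {}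
  have := matTranspose_essSurj Q r σ hid hcomp hr
  let e := (matLift Q).asEquivalence
  have : e.functor.Additive := inferInstanceAs (matLift Q).Additive
  -- Every object is a finite biproduct of the `Q i`, so the category is equivalent to the matrix
  -- category, where transposition with `σ` on the entries is the anti-equivalence.
  refine ⟨e.inverse.op ⋙ matTranspose Q r σ hid hcomp ⋙ matLift Q, ?_, inferInstance,
    inferInstance, inferInstance, fun i => ?_⟩
  · infer_instance
  · let M (i : I) : Mat_ (InducedCategory D Q) := ⟨PUnit, fun _ => (i : I)⟩
    have e1 (i : I) : (matLift Q).obj (M i) ≅ Q i := biproductUniqueIso _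
    have e2 : e.inverse.obj (Q i) ≅ M i :=
      e.inverse.mapIso (e1 i).symm ≪≫ (e.unitIso.app (M i)).symm
    exact ⟨(matLift Q).mapIso ((matTranspose Q r σ hid hcomp).mapIso e2.symm.op) ≪≫ e1 (r i)⟩

end Reversal

end Silting

/-! ### Decomposition into indecomposable projectives -/

namespace Silting

section Decomposition

variable {Λ : Type u} [Ring Λ]

/-- Submodules of an artinian module are finite direct sums of indecomposable modules. -/
lemma exists_decomposition_submodule {M : Type u} [AddCommGroup M] [Module Λ M] [IsArtinian Λ M]
    (N : Submodule Λ M) : ∃ (ι : Type) (_ : Fintype ι) (X : ι → Submodule Λ M),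
      (∀ k, IsIndecomposableModule Λ (X k)) ∧ Nonempty (N ≃ₗ[Λ] Π k, X k) := by
  induction N using WellFoundedLT.induction with
  | _ N ih =>
    by_cases h0 : Subsingleton N
    · exact ⟨Empty, inferInstance, Empty.elim, fun k => k.elim,
        ⟨{ (0 : N →ₗ[Λ] Π k : Empty, (Empty.elim k : Submodule Λ M)) with
            invFun := 0
            left_inv := fun x => Subsingleton.elim _ _
            right_inv := fun x => funext fun k => k.elim }⟩⟩
    have h0 : Nontrivial N := not_subsingleton_iff_nontrivial.1 h0
    by_cases h : ∀ A B : Submodule Λ N, IsCompl A B → A = ⊥ ∨ B = ⊥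
    · exact ⟨Unit, inferInstance, fun _ => N, fun _ => ⟨h0, h⟩,
        ⟨(LinearEquiv.funUnique Unit Λ N).symm⟩⟩
    · push Not at h
      obtain ⟨A, B, hc, hA, hB⟩ := h
      have hlt (A : Submodule Λ N) (hA : A ≠ ⊤) : A.map N.subtype < N := by
        refine lt_of_le_of_ne (Submodule.map_subtype_le N A) fun h => hA ?_
        apply Submodule.map_injective_of_injective N.injective_subtype
        rw [h, Submodule.map_top, Submodule.range_subtype]
      have hA' : A ≠ ⊤ := fun h => hB (by simpa [h] using hc.disjoint)
      have hB' : B ≠ ⊤ := fun h => hA (by simpa [h] using hc.disjoint)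
      obtain ⟨ι₁, _, X₁, h₁, ⟨e₁⟩⟩ := ih _ (hlt A hA')
      obtain ⟨ι₂, _, X₂, h₂, ⟨e₂⟩⟩ := ih _ (hlt B hB')
      refine ⟨ι₁ ⊕ ι₂, inferInstance, Sum.elim X₁ X₂, ?_, ⟨?_⟩⟩
      · rintro (k | k)
        · exact h₁ k
        · exact h₂ k
      · exact (Submodule.prodEquivOfIsCompl A B hc).symm ≪≫ₗ
          LinearEquiv.prodCongr
            (Submodule.equivMapOfInjective N.subtype N.injective_subtype A ≪≫ₗ e₁)
            (Submodule.equivMapOfInjective N.subtype N.injective_subtype B ≪≫ₗ e₂) ≪≫ₗ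
          (LinearEquiv.sumPiEquivProdPi Λ ι₁ ι₂
            fun k => (Sum.elim X₁ X₂ k : Submodule Λ M)).symm

lemma exists_decomposition (M : Type u) [AddCommGroup M] [Module Λ M] [IsArtinian Λ M] :
    ∃ (ι : Type) (_ : Fintype ι) (X : ι → Submodule Λ M),
      (∀ k, IsIndecomposableModule Λ (X k)) ∧ Nonempty (M ≃ₗ[Λ] Π k, X k) := by
  obtain ⟨ι, hι, X, hX, ⟨e⟩⟩ := exists_decomposition_submodule (⊤ : Submodule Λ M)
  exact ⟨ι, hι, X, hX, ⟨Submodule.topEquiv.symm ≪≫ₗ e⟩⟩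

lemma projective_of_equiv_pi {M : Type u} [AddCommGroup M] [Module Λ M] [Module.Projective Λ M]
    {ι : Type} {X : ι → Type u} [∀ k, AddCommGroup (X k)] [∀ k, Module Λ (X k)]
    (e : M ≃ₗ[Λ] Π k, X k) (k : ι) : Module.Projective Λ (X k) := by
  classical
  exact .of_split (e.symm.toLinearMap ∘ₗ LinearMap.single Λ X k)
    (LinearMap.proj k ∘ₗ e.toLinearMap) (LinearMap.ext fun x => by simp)

lemma injective_of_equiv_pi {M : Type u} [AddCommGroup M] [Module Λ M]
    (hM : Module.Injective Λ M)
    {ι : Type} {X : ι → Type u} [∀ k, AddCommGroup (X k)] [∀ k, Module Λ (X k)]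
    (e : M ≃ₗ[Λ] Π k, X k) (k : ι) : Module.Injective Λ (X k) where
  out Y Z _ _ _ _ f hf g := by
    classical
    obtain ⟨h, hh⟩ := hM.out f hf (e.symm.toLinearMap ∘ₗ LinearMap.single Λ X k ∘ₗ g)
    exact ⟨LinearMap.proj k ∘ₗ e.toLinearMap ∘ₗ h, fun y => by simp [hh]⟩

/-- A nonzero finitely generated uniserial module is a quotient of a direct summand of the
algebra. -/
lemma IsUniserial.exists_surjective {N : Type u} [AddCommGroup N] [Module Λ N] [Module.Finite Λ N]
    [Nontrivial N] (hN : IsUniserial Λ N) {ι : Type} [Fintype ι] {X : ι → Type u}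
    [∀ k, AddCommGroup (X k)] [∀ k, Module Λ (X k)] (e : Λ ≃ₗ[Λ] Π k, X k) :
    ∃ (k : ι) (f : X k →ₗ[Λ] N), Function.Surjective f := by
  classical
  obtain ⟨s, hs⟩ := Module.Finite.fg_top (R := Λ) (M := N)
  -- Uniseriality is used twice: one of finitely many generators generates `N`, and then one summand
  -- of `Λ` already surjects.
  obtain ⟨x, -, hx⟩ := hN.exists_eq_top s (fun x => Submodule.span Λ {x}) (by
    rw [← hs, Finset.sup_eq_iSup]
    exact (Submodule.span_eq_iSup_of_singleton_spans _).symm)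
  let f : Λ →ₗ[Λ] N := LinearMap.toSpanSingleton Λ N x
  have hf : Function.Surjective f := by
    rw [← LinearMap.range_eq_top, LinearMap.range_toSpanSingleton, hx]
  let g (k : ι) : X k →ₗ[Λ] N := f ∘ₗ e.symm.toLinearMap ∘ₗ LinearMap.single Λ X k
  obtain ⟨k, -, hk⟩ := hN.exists_eq_top Finset.univ (fun k => LinearMap.range (g k)) (by
    refine eq_top_iff.2 fun y _ => ?_
    obtain ⟨l, rfl⟩ := hf y
    obtain ⟨v, rfl⟩ := e.symm.surjective l
    have h1 : f (e.symm v) = ∑ k, g k (v k) := by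
      simp only [g, LinearMap.comp_apply, LinearEquiv.coe_coe, LinearMap.single_apply]
      rw [← map_sum, ← map_sum, Finset.univ_sum_single]
    rw [h1]
    exact sum_mem fun k _ => (Finset.le_sup (f := fun k => LinearMap.range (g k))
      (Finset.mem_univ k)) ⟨v k, rfl⟩)
  exact ⟨k, g k, LinearMap.range_eq_top.1 hk⟩

/-- Over a selfinjective artinian algebra with uniserial indecomposable projective modules, the
indecomposable projective modules form a finite family as in `IsProjFamily`. -/
lemma exists_isProjFamily [IsArtinianRing Λ] (hU : ProjIndecUniserial Λ)
    (hI : IsSelfinjective Λ) : ∃ (I : Type) (_ : Finite I) (Q : I → Submodule Λ Λ),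
      IsProjFamily Λ (fun i => Q i) := by
  obtain ⟨ι, _, X, hX, ⟨e⟩⟩ := exists_decomposition (Λ := Λ) Λ
  let s : Setoid ι :=
    { r := fun k l => Nonempty (X k ≃ₗ[Λ] X l)
      iseqv := ⟨fun _ => ⟨.refl _ _⟩, fun ⟨h⟩ => ⟨h.symm⟩, fun ⟨h⟩ ⟨h'⟩ => ⟨h.trans h'⟩⟩ }
  have hfin (k : ι) : Module.Finite Λ (X k) := inferInstance
  have hproj (k : ι) : Module.Projective Λ (X k) := projective_of_equiv_pi e k
  refine ⟨Quotient s, inferInstance, fun i => X i.out, fun i => hfin _, fun i => hproj _,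
    fun i => (hX _).1, fun i => hU _ (hX _), fun i => injective_of_equiv_pi hI e _,
    fun i j h => ?_, fun N _ _ _ _ hN => ?_⟩
  · rw [← i.out_eq, ← j.out_eq]
    exact Quotient.sound h
  · obtain ⟨k, f, hf⟩ := hN.exists_surjective e
    obtain ⟨e'⟩ : Nonempty (X (Quotient.mk s k).out ≃ₗ[Λ] X k) := Quotient.mk_out k
    exact ⟨Quotient.mk s k, f ∘ₗ e'.toLinearMap, hf.comp e'.surjective⟩

section Family

variable {I : Type} {Q : I → Type u} [∀ i, AddCommGroup (Q i)] [∀ i, Module Λ (Q i)]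

lemma IsProjFamily.exists_equiv (hQ : IsProjFamily Λ Q) (hU : ProjIndecUniserial Λ)
    (P : Type u) [AddCommGroup P] [Module Λ P] [Module.Finite Λ P] [Module.Projective Λ P]
    (hP : IsIndecomposableModule Λ P) : ∃ i, Nonempty (Q i ≃ₗ[Λ] P) := by
  have := hP.1
  obtain ⟨i, f, hf⟩ := hQ.exists_cover P (hU P hP)
  exact ⟨i, ⟨LinearEquiv.ofBijective f ((hQ.uniserial i).bijective_of_surjective f hf)⟩⟩

lemma IsProjFamily.exists_equiv_pi [IsArtinianRing Λ] (hQ : IsProjFamily Λ Q)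
    (hU : ProjIndecUniserial Λ)
    (M : Type u) [AddCommGroup M] [Module Λ M] [Module.Finite Λ M] [Module.Projective Λ M] :
    ∃ (n : ℕ) (c : Fin n → I), Nonempty ((Π k, Q (c k)) ≃ₗ[Λ] M) := by
  obtain ⟨ι, _, X, hX, ⟨e⟩⟩ := exists_decomposition (Λ := Λ) M
  have hproj (k : ι) : Module.Projective Λ (X k) := projective_of_equiv_pi e k
  choose c hc using fun k => hQ.exists_equiv hU (X k) (hX k)
  refine ⟨Fintype.card ι, fun k => c ((Fintype.equivFin ι).symm k), ⟨?_⟩⟩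
  exact LinearEquiv.piCongrLeft Λ (fun k => Q (c k)) (Fintype.equivFin ι).symm ≪≫ₗ
    LinearEquiv.piCongrRight (fun k => (hc k).some) ≪≫ₗ e.symm

end Family

end Decomposition

/-! ### The anti-equivalence of `proj Λ` fixing `P` -/

section AntiEquivalence

open Opposite

/-- A linear equivalence as an isomorphism of projective modules. -/
def Proj.isoOfEquiv {Λ : Type u} [Ring Λ] {X Y : Proj Λ} (e : X.obj ≃ₗ[Λ] Y.obj) : X ≅ Y where
  hom := (Proj.homEquiv X Y).symm e.toLinearMap
  inv := (Proj.homEquiv Y X).symm e.symm.toLinearMap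
  hom_inv_id := (Proj.homEquiv X X).injective (LinearMap.ext e.symm_apply_apply)
  inv_hom_id := (Proj.homEquiv Y Y).injective (LinearMap.ext e.apply_symm_apply)

/-- Biproducts of projective modules are products of modules. -/
noncomputable def Proj.biproductIso {Λ : Type u} [Ring Λ] {n : ℕ} (X : Fin n → Proj Λ)
    (M : Proj Λ) (e : (Π k, (X k).obj) ≃ₗ[Λ] M.obj) : (⨁ X) ≅ M where
  hom := biproduct.desc fun k => (Proj.homEquiv (X k) M).symm
    (e.toLinearMap ∘ₗ LinearMap.single Λ (fun k => (X k).obj) k)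
  inv := biproduct.lift fun k => (Proj.homEquiv M (X k)).symm
    (LinearMap.proj k ∘ₗ e.symm.toLinearMap)
  hom_inv_id := by
    refine biproduct.hom_ext' _ _ fun k => biproduct.hom_ext _ _ fun l => ?_
    rw [biproduct.ι_desc_assoc, Category.assoc, biproduct.lift_π, Category.comp_id]
    apply (Proj.homEquiv (X k) (X l)).injective
    refine LinearMap.ext fun x => ?_
    have h1 : Proj.homEquiv (X k) (X l) ((Proj.homEquiv (X k) M).symm
        (e.toLinearMap ∘ₗ LinearMap.single Λ (fun k => (X k).obj) k) ≫
          (Proj.homEquiv M (X l)).symm (LinearMap.proj l ∘ₗ e.symm.toLinearMap)) x =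
        e.symm (e (Pi.single k x)) l := rfl
    rw [h1, e.symm_apply_apply]
    by_cases hkl : k = l
    · subst hkl
      rw [Pi.single_eq_same, biproduct.ι_π_self]
      rfl
    · rw [Pi.single_eq_of_ne (Ne.symm hkl), biproduct.ι_π_ne _ hkl]
      rfl
  inv_hom_id := by
    rw [biproduct.lift_desc]
    apply (Proj.homEquiv M M).injective
    rw [map_sum]
    refine LinearMap.ext fun x => ?_
    rw [LinearMap.sum_apply]
    change ∑ k, e (Pi.single k (e.symm x k)) = x
    rw [← map_sum, Finset.univ_sum_single, e.apply_symm_apply]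

/-- The category of finitely generated projective modules over a selfinjective Nakayama algebra
is anti-equivalent to itself, by an anti-equivalence which fixes a given indecomposable. -/
lemma exists_antiEquivalence_proj (K : Type w) [Field K] [IsAlgClosed K] {Λ : Type u} [Ring Λ]
    [Algebra K Λ] [FiniteDimensional K Λ] (hU : ProjIndecUniserial Λ) (hI : IsSelfinjective Λ)
    (P : Type u) [AddCommGroup P] [Module Λ P] [Module.Finite Λ P] [Module.Projective Λ P]
    (hP : IsIndecomposableModule Λ P) :
    ∃ E : (Proj Λ)ᵒᵖ ⥤ Proj Λ, E.Additive ∧ E.Full ∧ E.Faithful ∧ E.EssSurj ∧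
      Nonempty (E.obj (op (Proj.of Λ P)) ≅ Proj.of Λ P) := by
  have : IsArtinianRing Λ := IsArtinianRing.of_finite K Λ
  obtain ⟨I, _, Q, hQ⟩ := exists_isProjFamily hU hI
  have hf := hQ.finite
  have hp := hQ.projective
  obtain ⟨p, ⟨e⟩⟩ := hQ.exists_equiv hU P hP
  obtain ⟨r, σ, hr, hrp, hid, hcomp⟩ := hQ.exists_reversal K p
  -- The index set is lifted to the universe of the objects of `proj Λ`, as the matrix construction
  -- requires.
  let Q' (i : ULift.{u + 1} I) : Proj Λ := Proj.of Λ (Q i.down)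
  let σ' (i j : ULift.{u + 1} I) : (Q' j ⟶ Q' i) ≃+ (Q' ⟨r i.down⟩ ⟶ Q' ⟨r j.down⟩) :=
    ((Proj.homEquiv (Q' j) (Q' i)).trans (σ i.down j.down)).trans
      (Proj.homEquiv (Q' ⟨r i.down⟩) (Q' ⟨r j.down⟩)).symm
  obtain ⟨E, h1, h2, h3, h4, h5⟩ := exists_antiEquivalence Q' (fun i => ⟨r i.down⟩) σ'
    (fun i => (Proj.homEquiv (Q' _) (Q' _)).injective (hid i.down))
    (fun i j h f g => (Proj.homEquiv (Q' _) (Q' _)).injective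
      (hcomp i.down j.down h.down (Proj.homEquiv _ _ f) (Proj.homEquiv _ _ g)))
    (fun i => congr_arg ULift.up (hr i.down)) fun M => by
      have := M.property.1
      have := M.property.2
      obtain ⟨n, c, ⟨e⟩⟩ := hQ.exists_equiv_pi hU M.obj
      exact ⟨n, fun k => ⟨c k⟩, ⟨Proj.biproductIso (fun k => Q' ⟨c k⟩) M e⟩⟩
  obtain ⟨e₁⟩ := h5 ⟨p⟩
  have e₂ : Q' ⟨p⟩ ≅ Proj.of Λ P := Proj.isoOfEquiv (X := Q' ⟨p⟩) (Y := Proj.of Λ P) e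
  refine ⟨E, h1, h2, h3, h4, ⟨E.mapIso e₂.op ≪≫ e₁ ≪≫ eqToIso ?_ ≪≫ e₂⟩⟩
  rw [hrp]

end AntiEquivalence

end Silting

/-! ### The theorem -/

open Silting in
theorem theorem2p8 {K : Type w} [Field K] [IsAlgClosed K]
    {Λ : Type u} [Ring Λ] [Algebra K Λ] [FiniteDimensional K Λ]
    (hN : IsNakayama Λ) (hI : IsSelfinjective Λ)
    (P : Type u) [AddCommGroup P] [Module Λ P] [Module.Finite Λ P] [Module.Projective Λ P]
    (hP : IsIndecomposableModule Λ P) :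
    (∃ φ : tMinus Λ P ≃ tPlus Λ P, ∀ S T : tMinus Λ P,
      S.1.Geq T.1 ↔ (φ T).1.Geq (φ S).1) ∧
    Cardinal.mk (twoSiltAlg Λ) = 2 * Cardinal.mk (tMinus Λ P) := by
  have : IsArtinianRing Λ := IsArtinianRing.of_finite K Λ
  obtain ⟨E, _, _, _, _, ⟨e⟩⟩ := exists_antiEquivalence_proj K hN.1 hI P hP
  have hD : IsDuality (dualKb E) := isDuality_dualKb E
  have := hD.full
  have := hD.faithful
  have := hD.additive
  have hA (X : Proj Λ) : InAdd (Perf.of Λ Λ) ((stalk (Proj Λ)).obj X) := inAdd_stalk_regular X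
  obtain ⟨eA⟩ := nonempty_dualKb_stalk_iso E (Proj.of Λ Λ)
  obtain ⟨eP⟩ := nonempty_dualKb_stalk_iso E (Proj.of Λ P)
  -- This shows that the dual of `Λ` generates `Λ`: a preimage `B` of `Λ` lies in `add Λ`, and
  -- dualizing puts `Λ` in the additive closure of the dual of `Λ`.
  obtain ⟨B, ⟨eB⟩⟩ : ∃ B : Proj Λ, Nonempty (E.obj (.op B) ≅ Proj.of Λ Λ) :=
    ⟨(E.objPreimage (Proj.of Λ Λ)).unop, ⟨E.objObjPreimageIso _⟩⟩
  obtain ⟨eB'⟩ := nonempty_dualKb_stalk_iso E B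
  refine hD.twoSilt_symmetry K ((hA _).of_retract (.ofIso eA)) ?_ (isSilting_regular Λ)
    (finite_hom_perf K) (fittingProperty_regular Λ) (isLocalObj_perf_of hP) (hA _)
    ⟨eP ≪≫ (stalk (Proj Λ)).mapIso e⟩
  exact (inAdd_dual_iff.2 (hA B)).of_retract
    (.ofIso ((stalk (Proj Λ)).mapIso eB.symm ≪≫ eB'.symm))
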